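/- All objects are smooth. A parametrized surface is a map $X:U\to\mathbb R^3$ on an open set $U\subset\mathbb R^2$ with coordinates $(s,v)$, and $I\subset\mathbb R$ denotes the projection of $U$ to the $s$-axis. For a Riemannian metric $g$ on $U$, the map $X:(U,g)\to\mathbb R^3$ is a *conformal immersion with factor* $f>0$ if the metric induced by $X$ is $f g$, i.e. $g=f^{-1}X^*\langle\cdot,\cdot\rangle$. With the tension field $\tau(X)=\mathrm{Trace}_g\nabla dX$ and the bitension field $\tau_2(X)=\mathrm{Trace}_g(\nabla\nabla-\nabla_{\nabla})\tau(X)$, the map is harmonic if $\tau(X)\equiv0$, biharmonic if $\tau_2(X)\equiv 0$, and *proper biharmonic* if it is biharmonic but not harmonic. A *cone* is $X(s,v)=a+v\,b(s)$ with $a$ constant and $b$ a curve on the unit sphere parametrized by arc length; a *tangent surface* is $X(s,v)=a(s)+v\,a'(s)$ with $a$ parametrized by arc length. A *developable surface* is a regular ruled surface $X(s,v)=a(s)+v\,e(s)$, $|e|=1$, with $\det(a',e,e')=0$, on a nonempty connected open set $U$. Such a surface is a *cylinder* with unit direction $b$ and directrix $\gamma$ if $X(s,v)=\gamma(\sigma(s))+w\,b$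 with $w=v+h(s)$, where $\sigma,h$ are smooth functions on $I$, $\sigma'\neq0$, $\gamma$ is a curve parametrized by arc length on the interval $J=\sigma(I)$, and $\gamma'\perp b$. It is *circular of radius $r>0$* if $\gamma$ is an arc of a circle of radius $r$ in a plane orthogonal to $b$. For $K\in\mathbb R$, $\kappa_N(s,K)$ denotes any of the functions $$\kappa_N(s,K)=\begin{cases}\dfrac{1}{C_1e^{2\sqrt{-K}s}+C_2e^{-2\sqrt{-K}s}\pm\sqrt{4C_1C_2+\frac1K}}, & K<0\quad (C_1,C_2>0,\ 4C_1C_2+\tfrac1K\ge0),\\[2mm] \dfrac{4C_3}{16+C_3^2(s+C_4)^2}, & K=0\quad (C_3>0),\\[2mm] \dfrac{1}{C_4\cos(2\sqrt Ks)+C_5\sin(2\sqrt Ks)+\sqrt{\frac1K+C_4^2+C_5^2}}, & K>0,\end{cases}$$ and $\psi(w,K)$ denotes any of the functions $d_5\sin(\sqrt{-K}w)+d_6\cos(\sqrt{-K}w)$ for $K<0$, $d_3w+d_4$ for $K=0$, $d_1e^{\sqrt Kw}+d_2e^{-\sqrt Kw}$ for $K>0$, with real constants $C_i,d_i$. Then: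 (1) If $X$ is a cone or a tangent surface, there are no metric $g$ and function $f>0$ on $U$ for which $X:(U,g)\to\mathbb R^3$ is a conformal immersion with factor $f$ and is proper biharmonic. (2) Let $X$ be a developable surface. (a) There are $g$ and $f>0$ such that $X:(U,g)\to\mathbb R^3$ is a proper biharmonic conformal immersion with factor $f$ if and only if $X$ is (a part of) a circular cylinder, or $X$ is a cylinder with a directrix $\gamma$ of nonconstant curvature $\kappa_1=\kappa_N(\cdot,K)$ and torsion $\kappa_2=0$ for some constant $K$, whose extent along the rulings satisfies, in case $K<0$, $\langle X(p)-X(q),b\rangle\le\pi/\sqrt{-K}$ for all $p,q\in U$. (b) A conformal immersion $X:(U,g)\to\mathbb R^3$ with factor $f>0$ is proper biharmonic if and only if one of the following holds: $X$ is a circular cylinder of some radius $r$ and $f=d_1e^{w/r}+d_2e^{-w/r}$ for constants $d_1,d_2$; or $X$ is a cylinder with a directrix of nonconstant curvature $\kappa_1=\kappa_N(\cdot,K)$ and torsion $\kappa_2=0$, for some constant $K$, and $f(s,v)=\psi(w,K)\,\kappa_1(\sigma(s))^{-3/2}$ for one of the functions $\psi(\cdot,K)$. -/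

import Mathlib

open scoped ContDiff

noncomputable section

namespace ConformalSurface

/-- Euclidean three-space. -/
abbrev E3 : Type := EuclideanSpace ℝ (Fin 3)

/-! ### Riemannian metrics on open subsets of the plane, tension and bitension fields -/

/-- The coordinate vectors of the parameter plane. -/
def coordVec (i : Fin 2) : ℝ × ℝ := ![((1 : ℝ), (0 : ℝ)), ((0 : ℝ), (1 : ℝ))] i

/-- The partial derivative `∂ᵢ u`. -/
def pd {F : Type*} [NormedAddCommGroup F] [NormedSpace ℝ F]
    (i : Fin 2) (u : ℝ × ℝ → F) (p : ℝ × ℝ) : F :=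
  fderiv ℝ u p (coordVec i)

/-- `g` is a smooth Riemannian metric on `U` (given by its matrix in the coordinates). -/
structure IsRiemannianMetric (U : Set (ℝ × ℝ)) (g : ℝ × ℝ → Matrix (Fin 2) (Fin 2) ℝ) :
    Prop where
  smooth : ∀ i j, ContDiffOn ℝ ∞ (fun p => g p i j) U
  posDef : ∀ p ∈ U, (g p).PosDef

/-- The Christoffel symbol `Γᵏᵢⱼ` of the Levi-Civita connection of `g`. -/
def christoffel (g : ℝ × ℝ → Matrix (Fin 2) (Fin 2) ℝ) (k i j : Fin 2) (p : ℝ × ℝ) : ℝ :=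
  (1 / 2) * ∑ l, (g p)⁻¹ k l *
    (pd i (fun q => g q j l) p + pd j (fun q => g q i l) p - pd l (fun q => g q i j) p)

/-- `Trace_g (∇∇ - ∇_{∇})` applied to a function `u` with values in a Euclidean space, that is,
the trace with respect to `g` of the second covariant derivative of `u`. -/
def traceHess (g : ℝ × ℝ → Matrix (Fin 2) (Fin 2) ℝ) (u : ℝ × ℝ → E3) (p : ℝ × ℝ) : E3 :=
  ∑ i, ∑ j, (g p)⁻¹ i j • (pd i (pd j u) p - ∑ k, christoffel g k i j p • pd k u p)

/-- The tension field `τ(φ) = Trace_g ∇dφ` of a map `φ : (U, g) → ℝ³`. -/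
def tension (g : ℝ × ℝ → Matrix (Fin 2) (Fin 2) ℝ) (φ : ℝ × ℝ → E3) : ℝ × ℝ → E3 :=
  traceHess g φ

/-- The bitension field `τ₂(φ) = Trace_g (∇∇ - ∇_{∇}) τ(φ)` of a map `φ : (U, g) → ℝ³`; the
curvature term vanishes and the pull-back connection is the usual derivative, because the
target is flat. -/
def bitension (g : ℝ × ℝ → Matrix (Fin 2) (Fin 2) ℝ) (φ : ℝ × ℝ → E3) : ℝ × ℝ → E3 :=
  traceHess g (tension g φ)

def IsHarmonic (U : Set (ℝ × ℝ)) (g : ℝ × ℝ → Matrix (Fin 2) (Fin 2) ℝ)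
    (φ : ℝ × ℝ → E3) : Prop :=
  ∀ p ∈ U, tension g φ p = 0

def IsBiharmonic (U : Set (ℝ × ℝ)) (g : ℝ × ℝ → Matrix (Fin 2) (Fin 2) ℝ)
    (φ : ℝ × ℝ → E3) : Prop :=
  ∀ p ∈ U, bitension g φ p = 0

/-- Biharmonic and not harmonic. -/
def IsProperBiharmonic (U : Set (ℝ × ℝ)) (g : ℝ × ℝ → Matrix (Fin 2) (Fin 2) ℝ)
    (φ : ℝ × ℝ → E3) : Prop :=
  IsBiharmonic U g φ ∧ ¬ IsHarmonic U g φ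

/-- `X : (U, g) → ℝ³` is a conformal immersion of the Riemannian surface `(U, g)` with
conformal factor `f > 0`: the metric induced by `X` is `f g`, so that `g` is `f⁻¹` times the
induced metric. -/
structure IsConformalImmersion (U : Set (ℝ × ℝ)) (g : ℝ × ℝ → Matrix (Fin 2) (Fin 2) ℝ)
    (f : ℝ × ℝ → ℝ) (X : ℝ × ℝ → E3) : Prop where
  metric : IsRiemannianMetric U g
  smooth : ContDiffOn ℝ ∞ X U
  factor_pos : ∀ p ∈ U, 0 < f p
  induced : ∀ p ∈ U, ∀ i j, inner ℝ (pd i X p) (pd j X p) = f p * g p i j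

/-! ### Curves -/

/-- The determinant of three vectors. -/
def triple (x y z : E3) : ℝ := Matrix.det (Matrix.of fun i j => (![x, y, z] i) j)

/-- The curvature `κ₁` of a curve parametrized by arc length. -/
def curvature (γ : ℝ → E3) (s : ℝ) : ℝ := ‖deriv (deriv γ) s‖

/-- The torsion `κ₂` of a curve parametrized by arc length. -/
def torsion (γ : ℝ → E3) (s : ℝ) : ℝ :=
  triple (deriv γ s) (deriv (deriv γ) s) (deriv (deriv (deriv γ)) s) / curvature γ s ^ 2

/-- The function `k` belongs on `J` to the family `κ_N(·, K)`. -/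
def IsKappaN (K : ℝ) (J : Set ℝ) (k : ℝ → ℝ) : Prop :=
  (K < 0 ∧ ∃ C₁ C₂ ε : ℝ, 0 < C₁ ∧ 0 < C₂ ∧ (ε = 1 ∨ ε = -1) ∧ 0 ≤ 4 * C₁ * C₂ + 1 / K ∧
    ∀ s ∈ J, k s = 1 / (C₁ * Real.exp (2 * √(-K) * s) + C₂ * Real.exp (-(2 * √(-K) * s))
      + ε * √(4 * C₁ * C₂ + 1 / K))) ∨
  (K = 0 ∧ ∃ C₃ C₄ : ℝ, 0 < C₃ ∧
    ∀ s ∈ J, k s = 4 * C₃ / (16 + C₃ ^ 2 * (s + C₄) ^ 2)) ∨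
  (0 < K ∧ ∃ C₄ C₅ : ℝ,
    ∀ s ∈ J, k s = 1 / (C₄ * Real.cos (2 * √K * s) + C₅ * Real.sin (2 * √K * s)
      + √(1 / K + (C₄ ^ 2 + C₅ ^ 2))))

/-- The function `ψ` belongs to the family `ψ(·, K)`. -/
def IsPsi (K : ℝ) (ψ : ℝ → ℝ) : Prop :=
  (K < 0 ∧ ∃ d₅ d₆ : ℝ, ∀ v, ψ v = d₅ * Real.sin (√(-K) * v) + d₆ * Real.cos (√(-K) * v)) ∨
  (K = 0 ∧ ∃ d₃ d₄ : ℝ, ∀ v, ψ v = d₃ * v + d₄) ∨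
  (0 < K ∧ ∃ d₁ d₂ : ℝ, ∀ v, ψ v = d₁ * Real.exp (√K * v) + d₂ * Real.exp (-(√K * v)))

/-! ### Developable surfaces -/

/-- A developable surface: a regular ruled surface `X(s, v) = a(s) + v e(s)`, `|e| = 1`, whose
tangent plane is constant along the rulings, `det (a', e, e') = 0`. -/
def IsDevelopable (U : Set (ℝ × ℝ)) (X : ℝ × ℝ → E3) : Prop :=
  ∃ a e : ℝ → E3,
    ContDiffOn ℝ ∞ a (Prod.fst '' U) ∧ ContDiffOn ℝ ∞ e (Prod.fst '' U) ∧
    (∀ s ∈ Prod.fst '' U, ‖e s‖ = 1) ∧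
    (∀ s ∈ Prod.fst '' U, triple (deriv a s) (e s) (deriv e s) = 0) ∧
    (∀ p ∈ U, X p = a p.1 + p.2 • e p.1) ∧
    (∀ p ∈ U, LinearIndependent ℝ ![pd 0 X p, pd 1 X p])

/-- A cone `X(s, v) = a + v b(s)` over a spherical curve `b` parametrized by arc length. -/
def IsCone (U : Set (ℝ × ℝ)) (X : ℝ × ℝ → E3) : Prop :=
  ∃ (a : E3) (b : ℝ → E3),
    ContDiffOn ℝ ∞ b (Prod.fst '' U) ∧
    (∀ s ∈ Prod.fst '' U, ‖b s‖ = 1 ∧ ‖deriv b s‖ = 1) ∧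
    (∀ p ∈ U, X p = a + p.2 • b p.1)

/-- The tangent surface `X(s, v) = a(s) + v a'(s)` of a curve `a` parametrized by arc length. -/
def IsTangentSurface (U : Set (ℝ × ℝ)) (X : ℝ × ℝ → E3) : Prop :=
  ∃ a : ℝ → E3,
    ContDiffOn ℝ ∞ a (Prod.fst '' U) ∧
    (∀ s ∈ Prod.fst '' U, ‖deriv a s‖ = 1) ∧
    (∀ p ∈ U, X p = a p.1 + p.2 • deriv a p.1)

/-- The surface `X` is a cylinder with rulings in the direction of the unit vector `b` and with
directrix `γ`, a curve parametrized by arc length on `J` and orthogonal to `b`: in the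
parameters `σ = σ(s)` and `w = v + h(s)`, it is `γ(σ) + w b`. -/
structure IsCylinderOver (U : Set (ℝ × ℝ)) (X : ℝ × ℝ → E3) (b : E3) (J : Set ℝ)
    (γ : ℝ → E3) (σ h : ℝ → ℝ) : Prop where
  norm_dir : ‖b‖ = 1
  smooth_directrix : ContDiffOn ℝ ∞ γ J
  unit_speed : ∀ s ∈ J, ‖deriv γ s‖ = 1
  orthogonal : ∀ s ∈ J, inner ℝ (deriv γ s) b = 0
  smooth_param : ContDiffOn ℝ ∞ σ (Prod.fst '' U)
  smooth_shift : ContDiffOn ℝ ∞ h (Prod.fst '' U)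
  regular_param : ∀ s ∈ Prod.fst '' U, deriv σ s ≠ 0
  image_param : σ '' (Prod.fst '' U) = J
  eq_cylinder : ∀ p ∈ U, X p = γ (σ p.1) + (p.2 + h p.1) • b

/-- On `J`, the curve `γ` runs on a circle of radius `r` in a plane orthogonal to `b`. -/
def IsCircleArc (b : E3) (J : Set ℝ) (γ : ℝ → E3) (r : ℝ) : Prop :=
  0 < r ∧ ∃ c : E3, ∀ s ∈ J, ‖γ s - c‖ = r ∧ inner ℝ (γ s - c) b = 0

/-- The directrix has nonconstant curvature `κ₁ = κ_N(·, K)` and torsion `κ₂ = 0`. -/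
def IsKappaNCurve (K : ℝ) (J : Set ℝ) (γ : ℝ → E3) : Prop :=
  IsKappaN K J (curvature γ) ∧ (¬ ∃ c : ℝ, ∀ s ∈ J, curvature γ s = c) ∧
    ∀ s ∈ J, torsion γ s = 0

/-- `X` is (a part of) a circular cylinder. -/
def IsCircularCylinder (U : Set (ℝ × ℝ)) (X : ℝ × ℝ → E3) : Prop :=
  ∃ b J γ σ h r, IsCylinderOver U X b J γ σ h ∧ IsCircleArc b J γ r

/-- `X` is a cylinder containing a directrix with nonconstant curvature `κ_N(·, K)` and zero
torsion; if `K < 0`, its extent along the rulings is at most `π / √(-K)`. -/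
def IsKappaNCylinder (U : Set (ℝ × ℝ)) (X : ℝ × ℝ → E3) : Prop :=
  ∃ K b J γ σ h, IsCylinderOver U X b J γ σ h ∧ IsKappaNCurve K J γ ∧
    (K < 0 → ∀ p ∈ U, ∀ q ∈ U, inner ℝ (X p - X q) b ≤ Real.pi / √(-K))

end ConformalSurface

end

open ConformalSurface

/-! In dimension two the tension field `τ` of a conformal immersion is normal to the surface
(`IsConformalImmersion.inner_tension_pd`). On a developable surface `a + v e` this means `τ ⟂ e, e',
a'` along every ruling. Pairing the bitension field with `e` moves two derivatives from `τ` to `e`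
and leaves `g⁰⁰⟨τ, e''⟩`. Biharmonicity therefore gives `⟨τ, e''⟩ = 0`, and where `e' ≠ 0` also `⟨τ,
a''⟩ = 0`; then `τ` is orthogonal to every second derivative of `X`, hence to itself
(`IsDevelopableOn.tension_eq_zero`). Cones and tangent surfaces have `e' ≠ 0` everywhere, which
proves (1).

For (2), the surface is a cylinder near each ruling carrying a point with `τ ≠ 0`. To make this
global, note that on a cylinder `τ = f γ''`, and the component of the biharmonic equation along `γ'`
says that `|τ|⁶ / f²` does not change along the orthogonal trajectories of the rulings. This
quantity makes sense on the whole developable surface, so the set of rulings with `τ ≠ 0` is closed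
as well as open (`IsDevelopableOn.tension_ne_zero`). A proper biharmonic surface is thus a single
cylinder over a curve without inflection points.

On a cylinder, write `f_σ` for the derivative along the directrix and `f_w` for the one along the
rulings. The biharmonic equation becomes `f_σ = -(3/2)(κ'/κ) f` together with `f_ww = E f`, where `E
= κ² + κ''/(2κ) - 3κ'²/(4κ²)` (`IsCylinderOver.isBiharmonic_iff`). Commuting the derivatives forces
`E` to be a constant `K`. In terms of `1/κ` the equation `E = K` integrates to a linear equation
with constant coefficients, whose positive solutions are the reciprocals of the `κ_N`
(`isKappaN_of_ermakov`); moreover `f κ^(3/2)` depends on `w` alone and solves `ψ'' = K ψ`. Constant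
curvature gives the circular cylinders with `K = 1/r²`. When `K < 0` a positive `ψ` exists exactly
if the open interval of heights has length at most `π/√(-K)`, the distance between consecutive
zeros. -/

noncomputable section

namespace ConformalSurface

/-! ### Partial derivatives on open sets -/

section Partial

variable {F : Type*} [NormedAddCommGroup F] [NormedSpace ℝ F] {U : Set (ℝ × ℝ)} {p : ℝ × ℝ}

theorem differentiableAt_of_contDiffOn {E : Type*} [NormedAddCommGroup E] [NormedSpace ℝ E]
    {S : Set E} {u : E → F} {x : E} (hS : IsOpen S) (hu : ContDiffOn ℝ ∞ u S) (hx : x ∈ S) :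
    DifferentiableAt ℝ u x :=
  (hu.contDiffAt (hS.mem_nhds hx)).differentiableAt (by simp)

theorem contDiffOn_deriv {J : Set ℝ} {c : ℝ → F} (hJ : IsOpen J) (hc : ContDiffOn ℝ ∞ c J) :
    ContDiffOn ℝ ∞ (deriv c) J :=
  hc.deriv_of_isOpen hJ (by simp)

theorem contDiffOn_pd {u : ℝ × ℝ → F} (hU : IsOpen U) (hu : ContDiffOn ℝ ∞ u U) (i : Fin 2) :
    ContDiffOn ℝ ∞ (pd i u) U :=
  (hu.fderiv_of_isOpen hU (by simp)).clm_apply contDiffOn_const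

theorem isOpen_fst_image (hU : IsOpen U) : IsOpen (Prod.fst '' U) := isOpenMap_fst U hU

theorem contDiffOn_comp_fst {J : Set ℝ} {c : ℝ → F} (hc : ContDiffOn ℝ ∞ c J)
    (hUJ : ∀ p ∈ U, p.1 ∈ J) : ContDiffOn ℝ ∞ (fun p : ℝ × ℝ => c p.1) U :=
  hc.comp contDiffOn_fst hUJ

theorem pd_congr {u v : ℝ × ℝ → F} (hU : IsOpen U) (h : ∀ q ∈ U, u q = v q) (hp : p ∈ U)
    (i : Fin 2) : pd i u p = pd i v p := by
  have : u =ᶠ[nhds p] v := by filter_upwards [hU.mem_nhds hp] with q hq using h q hq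
  simp [pd, this.fderiv_eq]

theorem pd_const (i : Fin 2) (c : F) : pd i (fun _ => c) p = 0 := by simp [pd]

theorem pd_add {u v : ℝ × ℝ → F} (hu : DifferentiableAt ℝ u p) (hv : DifferentiableAt ℝ v p)
    (i : Fin 2) : pd i (fun q => u q + v q) p = pd i u p + pd i v p := by
  simp [pd, fderiv_fun_add hu hv]

theorem pd_sub {u v : ℝ × ℝ → F} (hu : DifferentiableAt ℝ u p) (hv : DifferentiableAt ℝ v p)
    (i : Fin 2) : pd i (fun q => u q - v q) p = pd i u p - pd i v p := by
  simp [pd, fderiv_fun_sub hu hv]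

theorem pd_smul {c : ℝ × ℝ → ℝ} {u : ℝ × ℝ → F} (hc : DifferentiableAt ℝ c p)
    (hu : DifferentiableAt ℝ u p) (i : Fin 2) :
    pd i (fun q => c q • u q) p = c p • pd i u p + pd i c p • u p := by
  simp [pd, fderiv_fun_smul hc hu]

theorem pd_mul {c u : ℝ × ℝ → ℝ} (hc : DifferentiableAt ℝ c p)
    (hu : DifferentiableAt ℝ u p) (i : Fin 2) :
    pd i (fun q => c q * u q) p = c p * pd i u p + pd i c p * u p := by
  simpa using pd_smul hc hu i

theorem pd_inner {u v : ℝ × ℝ → E3} (hu : DifferentiableAt ℝ u p)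
    (hv : DifferentiableAt ℝ v p) (i : Fin 2) :
    pd i (fun q => inner ℝ (u q) (v q)) p =
      inner ℝ (u p) (pd i v p) + inner ℝ (pd i u p) (v p) := by
  simp [pd, fderiv_inner_apply ℝ hu hv]

theorem pd_comm {u : ℝ × ℝ → F} (hU : IsOpen U) (hu : ContDiffOn ℝ ∞ u U) (hp : p ∈ U)
    (i j : Fin 2) : pd i (pd j u) p = pd j (pd i u) p := by
  have hd : DifferentiableAt ℝ (fderiv ℝ u) p :=
    differentiableAt_of_contDiffOn hU (hu.fderiv_of_isOpen hU (by simp)) hp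
  have hs : IsSymmSndFDerivAt ℝ u p :=
    (hu.contDiffAt (hU.mem_nhds hp)).isSymmSndFDerivAt
      (by simpa using WithTop.coe_le_coe.2 (le_top : (2 : ℕ∞) ≤ ⊤))
  have key : ∀ i j, pd i (pd j u) p = fderiv ℝ (fderiv ℝ u) p (coordVec i) (coordVec j) := by
    intro i j
    have h1 : HasFDerivAt (fun q => fderiv ℝ u q (coordVec j))
        ((ContinuousLinearMap.apply ℝ F (coordVec j)).comp (fderiv ℝ (fderiv ℝ u) p)) p :=
      (ContinuousLinearMap.apply ℝ F (coordVec j)).hasFDerivAt.comp p hd.hasFDerivAt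
    change fderiv ℝ (fun q => fderiv ℝ u q (coordVec j)) p (coordVec i) = _
    rw [h1.fderiv]; rfl
  rw [key, key]; exact hs.eq _ _

theorem pd_comp {c : ℝ → F} {k : ℝ × ℝ → ℝ} (hc : DifferentiableAt ℝ c (k p))
    (hk : DifferentiableAt ℝ k p) (i : Fin 2) :
    pd i (fun q => c (k q)) p = pd i k p • deriv c (k p) := by
  have := hc.hasDerivAt.hasFDerivAt.comp p hk.hasFDerivAt
  change fderiv ℝ (c ∘ k) p _ = _
  rw [this.fderiv]; simp [pd]

theorem pd_zero_fst : pd 0 Prod.fst p = (1 : ℝ) := by simp [pd, coordVec, fderiv_fst]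
theorem pd_one_fst : pd 1 Prod.fst p = (0 : ℝ) := by simp [pd, coordVec, fderiv_fst]
theorem pd_zero_snd : pd 0 Prod.snd p = (0 : ℝ) := by simp [pd, coordVec, fderiv_snd]
theorem pd_one_snd : pd 1 Prod.snd p = (1 : ℝ) := by simp [pd, coordVec, fderiv_snd]

theorem pd_zero_comp_fst {c : ℝ → F} (hc : DifferentiableAt ℝ c p.1) :
    pd 0 (fun q : ℝ × ℝ => c q.1) p = deriv c p.1 := by
  rw [pd_comp (k := Prod.fst) hc differentiableAt_fst]; simp [pd_zero_fst]

theorem pd_one_comp_fst {c : ℝ → F} (hc : DifferentiableAt ℝ c p.1) :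
    pd 1 (fun q : ℝ × ℝ => c q.1) p = 0 := by
  rw [pd_comp (k := Prod.fst) hc differentiableAt_fst]; simp [pd_one_fst]

theorem fderiv_eq_zero_of_pd {u : ℝ × ℝ → F} (h0 : pd 0 u p = 0) (h1 : pd 1 u p = 0) :
    fderiv ℝ u p = 0 := by
  ext
  · simpa [pd, coordVec] using h0
  · simpa [pd, coordVec] using h1

end Partial

/-! ### The tension field of a conformal immersion is normal -/

section Tangency

variable {U : Set (ℝ × ℝ)} {g : ℝ × ℝ → Matrix (Fin 2) (Fin 2) ℝ} {f : ℝ × ℝ → ℝ}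
  {X : ℝ × ℝ → E3} {p : ℝ × ℝ}

theorem IsRiemannianMetric.symm (hg : IsRiemannianMetric U g) (hp : p ∈ U) (i j : Fin 2) :
    g p i j = g p j i := by
  have := (hg.posDef p hp).isHermitian.apply j i
  simpa using this

theorem IsRiemannianMetric.diag_pos (hg : IsRiemannianMetric U g) (hp : p ∈ U) (i : Fin 2) :
    0 < g p i i := (hg.posDef p hp).diag_pos

theorem IsRiemannianMetric.inv_diag_pos (hg : IsRiemannianMetric U g) (hp : p ∈ U)
    (i : Fin 2) : 0 < (g p)⁻¹ i i := (hg.posDef p hp).inv.diag_pos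

theorem IsRiemannianMetric.inv_mul (hg : IsRiemannianMetric U g) (hp : p ∈ U) :
    (g p)⁻¹ * g p = 1 :=
  Matrix.nonsing_inv_mul _ ((Matrix.isUnit_iff_isUnit_det _).1 (hg.posDef p hp).isUnit)

theorem IsRiemannianMetric.inv_symm (hg : IsRiemannianMetric U g) (hp : p ∈ U) (i j : Fin 2) :
    (g p)⁻¹ i j = (g p)⁻¹ j i := by
  have := (hg.posDef p hp).inv.isHermitian.apply j i
  simpa using this

theorem IsConformalImmersion.contDiffOn_factor (hU : IsOpen U)
    (hX : IsConformalImmersion U g f X) : ContDiffOn ℝ ∞ f U := by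
  have h1 : ContDiffOn ℝ ∞ (fun p => inner ℝ (pd 0 X p) (pd 0 X p) / g p 0 0) U :=
    ((contDiffOn_pd hU hX.smooth 0).inner ℝ (contDiffOn_pd hU hX.smooth 0)).div
      (hX.metric.smooth 0 0) fun q hq => (hX.metric.diag_pos hq 0).ne'
  refine h1.congr fun q hq => ?_
  rw [hX.induced q hq, mul_div_cancel_right₀ _ (hX.metric.diag_pos hq 0).ne']

/-- The induced metric is `f g`, so its Koszul formula differs from that of `g` only by terms in
`df`. Their trace is `(1 - n/2) df` on an `n`-dimensional domain, which vanishes for `n = 2`. -/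
theorem IsConformalImmersion.inner_tension_pd (hU : IsOpen U)
    (hX : IsConformalImmersion U g f X) (hp : p ∈ U) (m : Fin 2) :
    inner ℝ (tension g X p) (pd m X p) = 0 := by
  have hXs := contDiffOn_pd hU hX.smooth
  have hd : ∀ l i j, inner ℝ (pd l (pd i X) p) (pd j X p) + inner ℝ (pd l (pd j X) p) (pd i X p)
      = f p * pd l (fun q => g q i j) p + pd l f p * g p i j := by
    intro l i j
    rw [← pd_mul (differentiableAt_of_contDiffOn hU (hX.contDiffOn_factor hU) hp)
      (differentiableAt_of_contDiffOn hU (hX.metric.smooth i j) hp),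
      ← pd_congr hU (fun q hq => hX.induced q hq i j) hp,
      pd_inner (differentiableAt_of_contDiffOn hU (hXs i) hp)
      (differentiableAt_of_contDiffOn hU (hXs j) hp), real_inner_comm (pd i X p)]
    ring
  have hc : ∀ l i, pd l (pd i X) p = pd i (pd l X) p := fun l i => pd_comm hU hX.smooth hp l i
  have hA : ∀ i j k, inner ℝ (pd i (pd j X) p) (pd k X p) = 1 / 2 *
      (f p * (pd i (fun q => g q j k) p + pd j (fun q => g q i k) p - pd k (fun q => g q i j) p)
      + pd i f p * g p j k + pd j f p * g p i k - pd k f p * g p i j) := by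
    intro i j k
    have h1 := hd i j k
    have h2 := hd j i k
    have h3 := hd k i j
    rw [hc j i] at h2
    rw [hc k i, hc k j] at h3
    linear_combination (h1 + h2 - h3) / 2
  have hinv := hX.metric.inv_mul hp
  have hs := hX.metric.symm hp 1 0
  have hs' := hX.metric.inv_symm hp 1 0
  have e00 := congrFun (congrFun hinv 0) 0
  have e01 := congrFun (congrFun hinv 0) 1
  have e10 := congrFun (congrFun hinv 1) 0
  have e11 := congrFun (congrFun hinv 1) 1
  simp only [Matrix.mul_apply, Fin.sum_univ_two, Matrix.one_apply] at e00 e01 e10 e11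
  simp at e00 e01 e10 e11
  rw [hs'] at e10 e11
  rw [hs] at e00 e10
  have hcontr : ∀ (a : Fin 2 → ℝ) (m : Fin 2),
      ∑ k, (1 / 2 * ∑ l, (g p)⁻¹ k l * a l) * (f p * g p k m) = 1 / 2 * f p * a m := by
    intro a m
    simp only [Fin.sum_univ_two, hs']
    fin_cases m
    · simp only [Fin.zero_eta, hs]
      linear_combination (1 / 2 * f p * a 0) * e00 + (1 / 2 * f p * a 1) * e10
    · simp only [Fin.mk_one]
      linear_combination (1 / 2 * f p * a 0) * e01 + (1 / 2 * f p * a 1) * e11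
  have hΓ : ∀ i j m, ∑ k, christoffel g k i j p * inner ℝ (pd k X p) (pd m X p) =
      1 / 2 * f p * (pd i (fun q => g q j m) p + pd j (fun q => g q i m) p
        - pd m (fun q => g q i j) p) := by
    intro i j m
    simp only [hX.induced p hp, christoffel]
    exact hcontr (fun l => pd i (fun q => g q j l) p + pd j (fun q => g q i l) p
        - pd l (fun q => g q i j) p) m
  simp only [tension, traceHess, sum_inner, real_inner_smul_left, inner_sub_left, hΓ, hA]
  simp only [Fin.sum_univ_two, hs']
  fin_cases m
  · simp only [Fin.zero_eta, hs]
    -- The sum `e00 + e11` says that `g⁻¹ g` has trace 2; this is where the dimension enters.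
    linear_combination pd 0 f p * e00 + pd 1 f p * e10 - 1 / 2 * pd 0 f p * (e00 + e11)
  · simp only [Fin.mk_one, hs]
    linear_combination pd 0 f p * e01 + pd 1 f p * e11 - 1 / 2 * pd 1 f p * (e00 + e11)

end Tangency

/-! ### Smoothness of the tension field and regularity of conformal immersions -/

section Smoothness

variable {U : Set (ℝ × ℝ)} {g : ℝ × ℝ → Matrix (Fin 2) (Fin 2) ℝ} {f : ℝ × ℝ → ℝ}
  {X : ℝ × ℝ → E3} {p : ℝ × ℝ}

theorem IsRiemannianMetric.contDiffOn_inv (hg : IsRiemannianMetric U g) (i j : Fin 2) :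
    ContDiffOn ℝ ∞ (fun p => (g p)⁻¹ i j) U := by
  have hdet : ContDiffOn ℝ ∞ (fun p => (g p).det) U := by
    simp only [Matrix.det_fin_two]
    exact ((hg.smooth 0 0).mul (hg.smooth 1 1)).sub ((hg.smooth 0 1).mul (hg.smooth 1 0))
  have hne : ∀ p ∈ U, (g p).det ≠ 0 := fun p hp => (hg.posDef p hp).det_pos.ne'
  have hadj : ContDiffOn ℝ ∞ (fun p => (g p).adjugate i j) U := by
    simp only [Matrix.adjugate_fin_two]
    fin_cases i <;> fin_cases j
    · exact hg.smooth 1 1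
    · exact (hg.smooth 0 1).neg
    · exact (hg.smooth 1 0).neg
    · exact hg.smooth 0 0
  refine ((hdet.inv hne).mul hadj).congr fun q hq => ?_
  simp [Matrix.inv_def, Ring.inverse_eq_inv']

theorem IsRiemannianMetric.contDiffOn_christoffel (hU : IsOpen U) (hg : IsRiemannianMetric U g)
    (k i j : Fin 2) : ContDiffOn ℝ ∞ (christoffel g k i j) U := by
  have h := fun l i j => contDiffOn_pd hU (hg.smooth i j) l
  exact contDiffOn_const.mul (ContDiffOn.sum fun l _ => (hg.contDiffOn_inv k l).mul
    (((h i j l).add (h j i l)).sub (h l i j)))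

theorem IsRiemannianMetric.contDiffOn_traceHess (hU : IsOpen U) (hg : IsRiemannianMetric U g)
    {u : ℝ × ℝ → E3} (hu : ContDiffOn ℝ ∞ u U) : ContDiffOn ℝ ∞ (traceHess g u) U :=
  ContDiffOn.sum fun i _ => ContDiffOn.sum fun j _ => (hg.contDiffOn_inv i j).smul
    ((contDiffOn_pd hU (contDiffOn_pd hU hu j) i).sub
      (ContDiffOn.sum fun k _ => (hg.contDiffOn_christoffel hU k i j).smul (contDiffOn_pd hU hu k)))

theorem IsConformalImmersion.contDiffOn_tension (hU : IsOpen U)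
    (hX : IsConformalImmersion U g f X) : ContDiffOn ℝ ∞ (tension g X) U :=
  hX.metric.contDiffOn_traceHess hU hX.smooth

theorem IsConformalImmersion.linearIndependent (hX : IsConformalImmersion U g f X)
    (hp : p ∈ U) : LinearIndependent ℝ ![pd 0 X p, pd 1 X p] := by
  rw [LinearIndependent.pair_iff]
  intro α β h
  have hf := (hX.factor_pos p hp).ne'
  have key : ∀ j, α * g p 0 j + β * g p 1 j = 0 := by
    intro j
    have := congrArg (fun y => inner ℝ y (pd j X p)) h
    simp only [inner_add_left, real_inner_smul_left, hX.induced p hp, inner_zero_left] at this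
    have h2 : f p * (α * g p 0 j + β * g p 1 j) = 0 := by linear_combination this
    exact (mul_eq_zero.1 h2).resolve_left hf
  have hinv : g p * (g p)⁻¹ = 1 :=
    Matrix.mul_nonsing_inv _
      ((Matrix.isUnit_iff_isUnit_det _).1 (hX.metric.posDef p hp).isUnit)
  have e00 := congrFun (congrFun hinv 0) 0
  have e01 := congrFun (congrFun hinv 0) 1
  have e10 := congrFun (congrFun hinv 1) 0
  have e11 := congrFun (congrFun hinv 1) 1
  simp only [Matrix.mul_apply, Fin.sum_univ_two, Matrix.one_apply] at e00 e01 e10 e11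
  simp at e00 e01 e10 e11
  constructor
  · linear_combination (g p)⁻¹ 0 0 * key 0 + (g p)⁻¹ 1 0 * key 1 - α * e00 - β * e10
  · linear_combination (g p)⁻¹ 0 1 * key 0 + (g p)⁻¹ 1 1 * key 1 - α * e01 - β * e11

end Smoothness

/-! ### Rulings along which the surface is not cylindrical -/

theorem exists_of_triple_eq_zero {x y z : E3} (h : triple x y z = 0) :
    ∃ α β c : ℝ, (α ≠ 0 ∨ β ≠ 0 ∨ c ≠ 0) ∧ α • x + β • y + c • z = 0 := by
  obtain ⟨w, hw, hw0⟩ := Matrix.exists_vecMul_eq_zero_iff.2 h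
  refine ⟨w 0, w 1, w 2, ?_, ?_⟩
  · by_contra! hc
    exact hw (by ext i; fin_cases i <;> simp [hc])
  · ext j
    have := congrFun hw0 j
    simpa [Matrix.vecMul, dotProduct, Fin.sum_univ_three] using this

/-- `X` is the ruled surface with base curve `a` and ruling directions `e`, and its tangent plane
is constant along the rulings. -/
structure IsDevelopableOn (U : Set (ℝ × ℝ)) (X : ℝ × ℝ → E3) (a e : ℝ → E3) : Prop where
  smooth_base : ContDiffOn ℝ ∞ a (Prod.fst '' U)
  smooth_dir : ContDiffOn ℝ ∞ e (Prod.fst '' U)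
  norm_dir : ∀ s ∈ Prod.fst '' U, ‖e s‖ = 1
  triple_eq_zero : ∀ s ∈ Prod.fst '' U, triple (deriv a s) (e s) (deriv e s) = 0
  eq_ruled : ∀ p ∈ U, X p = a p.1 + p.2 • e p.1

section Developable

variable {U : Set (ℝ × ℝ)} {g : ℝ × ℝ → Matrix (Fin 2) (Fin 2) ℝ} {f : ℝ × ℝ → ℝ}
  {X : ℝ × ℝ → E3} {p : ℝ × ℝ} {a e : ℝ → E3}

theorem mem_fst_image (hp : p ∈ U) : p.1 ∈ Prod.fst '' U := ⟨p, hp, rfl⟩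

theorem pd_ruled {I : Set ℝ} (hI : IsOpen I) (ha : ContDiffOn ℝ ∞ a I)
    (he : ContDiffOn ℝ ∞ e I) (hp : p.1 ∈ I) :
    pd 0 (fun q => a q.1 + q.2 • e q.1) p = deriv a p.1 + p.2 • deriv e p.1 ∧
      pd 1 (fun q => a q.1 + q.2 • e q.1) p = e p.1 := by
  have da := differentiableAt_of_contDiffOn hI ha hp
  have de := differentiableAt_of_contDiffOn hI he hp
  have da' : DifferentiableAt ℝ (fun q : ℝ × ℝ => a q.1) p := da.comp p differentiableAt_fst
  have de' : DifferentiableAt ℝ (fun q : ℝ × ℝ => e q.1) p := de.comp p differentiableAt_fst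
  have hs : DifferentiableAt ℝ (Prod.snd : ℝ × ℝ → ℝ) p := differentiableAt_snd
  constructor
  · rw [pd_add da' (hs.fun_smul de'), pd_smul hs de', pd_zero_comp_fst da, pd_zero_comp_fst de,
      pd_zero_snd]
    simp
  · rw [pd_add da' (hs.fun_smul de'), pd_smul hs de', pd_one_comp_fst da, pd_one_comp_fst de,
      pd_one_snd]
    simp

/-- Differentiating `⟨u, c(s)⟩ = 0`. -/
theorem inner_pd_of_inner_eq_zero (hU : IsOpen U) {u : ℝ × ℝ → E3}
    (hu : ContDiffOn ℝ ∞ u U) {c : ℝ → E3} (hc : ContDiffOn ℝ ∞ c (Prod.fst '' U))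
    (h : ∀ q ∈ U, inner ℝ (u q) (c q.1) = 0) (hp : p ∈ U) :
    inner ℝ (pd 0 u p) (c p.1) = - inner ℝ (u p) (deriv c p.1) ∧
      inner ℝ (pd 1 u p) (c p.1) = 0 := by
  have du := differentiableAt_of_contDiffOn hU hu hp
  have dc := differentiableAt_of_contDiffOn (isOpen_fst_image hU) hc (mem_fst_image hp)
  have dc' : DifferentiableAt ℝ (fun q : ℝ × ℝ => c q.1) p := dc.comp p differentiableAt_fst
  have h0 := pd_inner du dc' 0
  have h1 := pd_inner du dc' 1
  rw [pd_congr hU h hp, pd_const, pd_zero_comp_fst dc] at h0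
  rw [pd_congr hU h hp, pd_const, pd_one_comp_fst dc, inner_zero_right] at h1
  exact ⟨by linarith, by linarith⟩

namespace IsDevelopableOn

theorem pd_zero (hU : IsOpen U) (hD : IsDevelopableOn U X a e) (hp : p ∈ U) :
    pd 0 X p = deriv a p.1 + p.2 • deriv e p.1 := by
  rw [pd_congr hU hD.eq_ruled hp]
  exact (pd_ruled (isOpen_fst_image hU) hD.smooth_base hD.smooth_dir (mem_fst_image hp)).1

theorem pd_one (hU : IsOpen U) (hD : IsDevelopableOn U X a e) (hp : p ∈ U) :
    pd 1 X p = e p.1 := by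
  rw [pd_congr hU hD.eq_ruled hp]
  exact (pd_ruled (isOpen_fst_image hU) hD.smooth_base hD.smooth_dir (mem_fst_image hp)).2

theorem inner_dir_deriv (hU : IsOpen U) (hD : IsDevelopableOn U X a e) {s : ℝ}
    (hs : s ∈ Prod.fst '' U) : inner ℝ (e s) (deriv e s) = 0 := by
  have hI := isOpen_fst_image hU
  have de := differentiableAt_of_contDiffOn hI hD.smooth_dir hs
  have h1 : HasDerivAt (fun t => inner ℝ (e t) (e t))
      (inner ℝ (e s) (deriv e s) + inner ℝ (deriv e s) (e s)) s :=
    de.hasDerivAt.inner ℝ de.hasDerivAt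
  have h2 : HasDerivAt (fun t => inner ℝ (e t) (e t)) 0 s := by
    refine (hasDerivAt_const s (1 : ℝ)).congr_of_eventuallyEq ?_
    filter_upwards [hI.mem_nhds hs] with t ht
    rw [real_inner_self_eq_norm_sq, hD.norm_dir t ht]; norm_num
  have := h1.unique h2
  rw [real_inner_comm] at this
  rw [real_inner_comm]
  linarith

theorem inner_tension_dir (hU : IsOpen U) (hD : IsDevelopableOn U X a e)
    (hX : IsConformalImmersion U g f X) (hp : p ∈ U) : inner ℝ (tension g X p) (e p.1) = 0 := by
  rw [← hD.pd_one hU hp]; exact hX.inner_tension_pd hU hp 1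

/-- A nontrivial relation `α a' + β e + c e' = 0`, paired with `τ`, gives `(c - α v)⟨τ, e'⟩ = 0`. If
`c = α v`, the relation would be one between the tangent vectors `a' + v e'` and `e`, which are
independent. -/
theorem inner_tension_deriv_dir (hU : IsOpen U) (hD : IsDevelopableOn U X a e)
    (hX : IsConformalImmersion U g f X) (hp : p ∈ U) :
    inner ℝ (tension g X p) (deriv e p.1) = 0 := by
  obtain ⟨α, β, c, hne, h⟩ := exists_of_triple_eq_zero (hD.triple_eq_zero _ (mem_fst_image hp))
  have hli := hX.linearIndependent hp
  have h0 := hX.inner_tension_pd hU hp 0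
  have h1 := hX.inner_tension_pd hU hp 1
  rw [hD.pd_zero hU hp, hD.pd_one hU hp, LinearIndependent.pair_iff] at hli
  rw [hD.pd_zero hU hp, inner_add_right, inner_smul_right] at h0
  rw [hD.pd_one hU hp] at h1
  have h2 := congrArg (fun y => inner ℝ (tension g X p) y) h
  simp only [inner_add_right, inner_smul_right, inner_zero_right, h1] at h2
  have h3 : (c - α * p.2) * inner ℝ (tension g X p) (deriv e p.1) = 0 := by
    linear_combination h2 - α * h0
  refine (mul_eq_zero.1 h3).resolve_left fun hc => ?_
  have hc' : c = α * p.2 := by linarith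
  obtain ⟨hα, hβ⟩ := hli α β (by rw [← h, hc']; module)
  simp [hα, hβ] at hne hc'
  exact hne hc'

theorem inner_tension_deriv_base (hU : IsOpen U) (hD : IsDevelopableOn U X a e)
    (hX : IsConformalImmersion U g f X) (hp : p ∈ U) :
    inner ℝ (tension g X p) (deriv a p.1) = 0 := by
  have h0 := hX.inner_tension_pd hU hp 0
  rw [hD.pd_zero hU hp, inner_add_right, inner_smul_right,
    hD.inner_tension_deriv_dir hU hX hp] at h0
  linarith

/-- Since `τ` is orthogonal to `e` and `e'`, both first derivatives of `τ` are orthogonal to `e`,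
and the Christoffel terms drop out. Among the second derivatives only `∂₀∂₀τ` pairs nontrivially
with `e`, because `e` does not depend on `v`. -/
theorem inner_bitension_dir (hU : IsOpen U) (hD : IsDevelopableOn U X a e)
    (hX : IsConformalImmersion U g f X) (hp : p ∈ U) : inner ℝ (bitension g X p) (e p.1) =
    (g p)⁻¹ 0 0 * inner ℝ (tension g X p) (deriv (deriv e) p.1) := by
  have hI := isOpen_fst_image hU
  have hτ := hX.contDiffOn_tension hU
  have he' := contDiffOn_deriv hI hD.smooth_dir
  have h1 := fun q hq => inner_pd_of_inner_eq_zero hU hτ hD.smooth_dir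
    (fun q hq => hD.inner_tension_dir hU hX hq) (p := q) hq
  have h2 := inner_pd_of_inner_eq_zero hU hτ he'
    (fun q hq => hD.inner_tension_deriv_dir hU hX hq) hp
  have hk : ∀ k, ∀ q ∈ U, inner ℝ (pd k (tension g X) q) (e q.1) = 0 := by
    intro k q hq
    fin_cases k
    · have := (h1 q hq).1
      rw [hD.inner_tension_deriv_dir hU hX hq, neg_zero] at this
      exact this
    · exact (h1 q hq).2
  have h3 := fun k => inner_pd_of_inner_eq_zero hU (contDiffOn_pd hU hτ k) hD.smooth_dir (hk k) hp
  simp only [bitension, traceHess, inner_add_left, real_inner_smul_left, inner_sub_left, hk _ p hp,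
    Fin.sum_univ_two, (h3 _).1, (h3 _).2, h2.1, h2.2]
  ring

/-- A biharmonic conformal immersion of a developable surface is harmonic along the rulings at
which the direction of the rulings is not stationary. -/
theorem tension_eq_zero (hU : IsOpen U) (hD : IsDevelopableOn U X a e)
    (hX : IsConformalImmersion U g f X) (hb : IsBiharmonic U g X) (hp : p ∈ U) (hne : deriv e p.1 ≠ 0) :
    tension g X p = 0 := by
  have hI := isOpen_fst_image hU
  have hs := mem_fst_image hp
  have hτ := hX.contDiffOn_tension hU
  have hc := hX.metric.inv_diag_pos hp 0
  have he'' : inner ℝ (tension g X p) (deriv (deriv e) p.1) = 0 := by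
    have := hD.inner_bitension_dir hU hX hp
    rw [hb p hp, inner_zero_left] at this
    exact (mul_eq_zero.1 this.symm).resolve_left hc.ne'
  have h1 := (inner_pd_of_inner_eq_zero hU hτ hD.smooth_dir
    (fun q hq => hD.inner_tension_dir hU hX hq) hp).1
  have h2 := (inner_pd_of_inner_eq_zero hU hτ (contDiffOn_deriv hI hD.smooth_dir)
    (fun q hq => hD.inner_tension_deriv_dir hU hX hq) hp).1
  have h3 := (inner_pd_of_inner_eq_zero hU hτ (contDiffOn_deriv hI hD.smooth_base)
    (fun q hq => hD.inner_tension_deriv_base hU hX hq) hp).1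
  rw [hD.inner_tension_deriv_dir hU hX hp, neg_zero] at h1
  rw [he'', neg_zero] at h2
  -- The nonzero vectors `e` and `e'` are orthogonal, so in the linear relation the coefficient of
  -- `a'` cannot vanish: `a'` lies in the span of `e` and `e'`.
  have ha' : inner ℝ (pd 0 (tension g X) p) (deriv a p.1) = 0 := by
    obtain ⟨α, β, c, hn, h⟩ := exists_of_triple_eq_zero (hD.triple_eq_zero _ hs)
    have h4 := congrArg (fun y => inner ℝ (pd 0 (tension g X) p) y) h
    simp only [inner_add_right, inner_smul_right, inner_zero_right, h1, h2] at h4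
    have h5 : α * inner ℝ (pd 0 (tension g X) p) (deriv a p.1) = 0 := by linear_combination h4
    refine (mul_eq_zero.1 h5).resolve_left fun hα => ?_
    have h6 := congrArg (fun y => inner ℝ (e p.1) y) h
    simp only [hα, inner_add_right, inner_smul_right, inner_zero_right,
      hD.inner_dir_deriv hU hs, real_inner_self_eq_norm_sq, hD.norm_dir _ hs] at h6
    have hβ : β = 0 := by linear_combination h6
    simp [hα, hβ, hne] at h hn
    exact hn h
  have ha'' : inner ℝ (tension g X p) (deriv (deriv a) p.1) = 0 := by linarith
  have hX0 : ∀ q ∈ U, pd 0 X q = deriv a q.1 + q.2 • deriv e q.1 := fun q hq => hD.pd_zero hU hq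
  have hX1 : ∀ q ∈ U, pd 1 X q = e q.1 := fun q hq => hD.pd_one hU hq
  have de := differentiableAt_of_contDiffOn hI hD.smooth_dir hs
  have h7 := pd_ruled hI (contDiffOn_deriv hI hD.smooth_base)
    (contDiffOn_deriv hI hD.smooth_dir) hs
  -- Only one factor is expanded by its definition: it is a combination of `a'' + v e''`, `e'` and
  -- tangent vectors, all orthogonal to `τ`.
  have h8 : inner ℝ (tension g X p) (tension g X p) = 0 := by
    conv_lhs => arg 3; rw [tension, traceHess]
    simp only [real_inner_smul_right, inner_sub_right, hX.inner_tension_pd hU hp,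
      Fin.sum_univ_two, pd_congr hU hX0 hp, pd_congr hU hX1 hp, pd_zero_comp_fst de,
      pd_one_comp_fst de, h7.1, h7.2, inner_add_right, ha'', he'',
      hD.inner_tension_deriv_dir hU hX hp, inner_zero_right]
    ring
  exact inner_self_eq_zero.1 h8

end IsDevelopableOn

theorem IsCone.exists_isDevelopableOn (h : IsCone U X) :
    ∃ a e, IsDevelopableOn U X a e ∧ ∀ p ∈ U, deriv e p.1 ≠ 0 := by
  obtain ⟨a, b, hb, hn, hX⟩ := h
  refine ⟨fun _ => a, b, ⟨contDiffOn_const, hb, fun s hs => (hn s hs).1, fun s _ => ?_, hX⟩,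
    fun p hp h0 => ?_⟩
  · exact Matrix.det_eq_zero_of_row_eq_zero 0 (by simp)
  · simpa [h0] using (hn _ (mem_fst_image hp)).2

/-- Here `e = a'`, and regularity excludes `a'' = 0`: the two coordinate fields `a' + v a''` and
`a'` would coincide. -/
theorem IsTangentSurface.exists_isDevelopableOn (hU : IsOpen U) (h : IsTangentSurface U X)
    (hX : IsConformalImmersion U g f X) :
    ∃ a e, IsDevelopableOn U X a e ∧ ∀ p ∈ U, deriv e p.1 ≠ 0 := by
  obtain ⟨a, ha, hn, hXa⟩ := h
  have hD : IsDevelopableOn U X a (deriv a) :=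
    ⟨ha, contDiffOn_deriv (isOpen_fst_image hU) ha, hn,
      fun s _ => Matrix.det_zero_of_row_eq (i := 0) (j := 1) (by decide) (by ext; simp), hXa⟩
  refine ⟨a, deriv a, hD, fun p hp h0 => ?_⟩
  have := hX.linearIndependent hp
  rw [hD.pd_zero hU hp, hD.pd_one hU hp, h0, LinearIndependent.pair_iff] at this
  have := this 1 (-1) (by simp)
  simp at this

theorem isHarmonic_of_cone_or_tangentSurface (hU : IsOpen U)
    (h : IsCone U X ∨ IsTangentSurface U X) (hX : IsConformalImmersion U g f X)
    (hb : IsBiharmonic U g X) : IsHarmonic U g X := by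
  obtain ⟨a, e, hD, he⟩ := h.elim (fun h => h.exists_isDevelopableOn)
    (fun h => h.exists_isDevelopableOn hU hX)
  exact fun p hp => hD.tension_eq_zero hU hX hb hp (he p hp)

end Developable

/-! ### The flat frame of a cylinder -/

/-- The derivative `(1 / σ') (∂_s - h' ∂_v)` along the field dual to the coordinate `σ(s)` in the
coordinates `σ(s)`, `v + h(s)`. -/
def horiz {F : Type*} [NormedAddCommGroup F] [NormedSpace ℝ F] (σ h : ℝ → ℝ)
    (u : ℝ × ℝ → F) (p : ℝ × ℝ) : F :=
  (deriv σ p.1)⁻¹ • (pd 0 u p - deriv h p.1 • pd 1 u p)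

section Horiz

variable {F : Type*} [NormedAddCommGroup F] [NormedSpace ℝ F] {U : Set (ℝ × ℝ)} {p : ℝ × ℝ}
  {σ h : ℝ → ℝ}

theorem horiz_congr {u v : ℝ × ℝ → F} (hU : IsOpen U) (huv : ∀ q ∈ U, u q = v q) (hp : p ∈ U) :
    horiz σ h u p = horiz σ h v p := by
  simp only [horiz, pd_congr hU huv hp]

theorem horiz_const (c : F) : horiz σ h (fun _ => c) p = 0 := by simp [horiz, pd_const]

theorem horiz_add {u v : ℝ × ℝ → F} (hu : DifferentiableAt ℝ u p) (hv : DifferentiableAt ℝ v p) :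
    horiz σ h (fun q => u q + v q) p = horiz σ h u p + horiz σ h v p := by
  simp only [horiz, pd_add hu hv]; module

theorem horiz_smul {c : ℝ × ℝ → ℝ} {u : ℝ × ℝ → F} (hc : DifferentiableAt ℝ c p)
    (hu : DifferentiableAt ℝ u p) :
    horiz σ h (fun q => c q • u q) p = c p • horiz σ h u p + horiz σ h c p • u p := by
  simp only [horiz, pd_smul hc hu, smul_eq_mul]; module

theorem horiz_mul {c u : ℝ × ℝ → ℝ} (hc : DifferentiableAt ℝ c p) (hu : DifferentiableAt ℝ u p) :
    horiz σ h (fun q => c q * u q) p = c p * horiz σ h u p + horiz σ h c p * u p := by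
  simpa using horiz_smul (σ := σ) (h := h) hc hu

theorem horiz_comp {c : ℝ → F} {k : ℝ × ℝ → ℝ} (hc : DifferentiableAt ℝ c (k p))
    (hk : DifferentiableAt ℝ k p) :
    horiz σ h (fun q => c (k q)) p = horiz σ h k p • deriv c (k p) := by
  simp only [horiz, pd_comp hc hk, smul_eq_mul]; module

theorem contDiffOn_horiz (hU : IsOpen U) (hσ : ContDiffOn ℝ ∞ σ (Prod.fst '' U))
    (hh : ContDiffOn ℝ ∞ h (Prod.fst '' U)) (hreg : ∀ s ∈ Prod.fst '' U, deriv σ s ≠ 0)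
    {u : ℝ × ℝ → F} (hu : ContDiffOn ℝ ∞ u U) : ContDiffOn ℝ ∞ (horiz σ h u) U := by
  have hI := isOpen_fst_image hU
  have h1 : ContDiffOn ℝ ∞ (fun p : ℝ × ℝ => (deriv σ p.1)⁻¹) U :=
    (contDiffOn_comp_fst (contDiffOn_deriv hI hσ) fun p hp => mem_fst_image hp).inv
      fun p hp => hreg _ (mem_fst_image hp)
  have h2 : ContDiffOn ℝ ∞ (fun p : ℝ × ℝ => deriv h p.1) U :=
    contDiffOn_comp_fst (contDiffOn_deriv hI hh) fun p hp => mem_fst_image hp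
  exact h1.smul ((contDiffOn_pd hU hu 0).sub (h2.smul (contDiffOn_pd hU hu 1)))

theorem pd_horiz (hU : IsOpen U) (hσ : ContDiffOn ℝ ∞ σ (Prod.fst '' U))
    (hh : ContDiffOn ℝ ∞ h (Prod.fst '' U)) (hreg : ∀ s ∈ Prod.fst '' U, deriv σ s ≠ 0)
    {u : ℝ × ℝ → F} (hu : ContDiffOn ℝ ∞ u U) (hp : p ∈ U) :
    pd 0 (horiz σ h u) p = (deriv σ p.1)⁻¹ • (pd 0 (pd 0 u) p - deriv h p.1 • pd 0 (pd 1 u) p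
        - deriv (deriv h) p.1 • pd 1 u p)
      + deriv (fun s => (deriv σ s)⁻¹) p.1 • (pd 0 u p - deriv h p.1 • pd 1 u p) ∧
    pd 1 (horiz σ h u) p = (deriv σ p.1)⁻¹ • (pd 1 (pd 0 u) p - deriv h p.1 • pd 1 (pd 1 u) p) := by
  have hI := isOpen_fst_image hU
  have hs := mem_fst_image hp
  have d0 := differentiableAt_of_contDiffOn hU (contDiffOn_pd hU hu 0) hp
  have d1 := differentiableAt_of_contDiffOn hU (contDiffOn_pd hU hu 1) hp
  have dσ : DifferentiableAt ℝ (fun s => (deriv σ s)⁻¹) p.1 :=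
    (differentiableAt_of_contDiffOn hI (contDiffOn_deriv hI hσ) hs).fun_inv (hreg _ hs)
  have dh := differentiableAt_of_contDiffOn hI (contDiffOn_deriv hI hh) hs
  have dσ' : DifferentiableAt ℝ (fun q : ℝ × ℝ => (deriv σ q.1)⁻¹) p :=
    dσ.comp p differentiableAt_fst
  have dh' : DifferentiableAt ℝ (fun q : ℝ × ℝ => deriv h q.1) p := dh.comp p differentiableAt_fst
  have e : ∀ i, pd i (horiz σ h u) p = _ := fun i =>
    pd_smul dσ' (d0.fun_sub (dh'.fun_smul d1)) i
  constructor
  · rw [e, pd_sub d0 (dh'.fun_smul d1), pd_smul dh' d1, pd_zero_comp_fst dh,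
      pd_zero_comp_fst (c := fun s => (deriv σ s)⁻¹) dσ]
    module
  · rw [e, pd_sub d0 (dh'.fun_smul d1), pd_smul dh' d1, pd_one_comp_fst dh,
      pd_one_comp_fst (c := fun s => (deriv σ s)⁻¹) dσ]
    module

/-- The fields of the frame commute. -/
theorem pd_one_horiz (hU : IsOpen U) (hσ : ContDiffOn ℝ ∞ σ (Prod.fst '' U))
    (hh : ContDiffOn ℝ ∞ h (Prod.fst '' U)) (hreg : ∀ s ∈ Prod.fst '' U, deriv σ s ≠ 0)
    {u : ℝ × ℝ → F} (hu : ContDiffOn ℝ ∞ u U) (hp : p ∈ U) :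
    pd 1 (horiz σ h u) p = horiz σ h (pd 1 u) p := by
  rw [(pd_horiz hU hσ hh hreg hu hp).2, pd_comm hU hu hp 1 0, horiz]

end Horiz

theorem isOpen_image_of_deriv_ne_zero {σ : ℝ → ℝ} {I : Set ℝ} (hI : IsOpen I)
    (hσ : ContDiffOn ℝ ∞ σ I) (hreg : ∀ s ∈ I, deriv σ s ≠ 0) : IsOpen (σ '' I) := by
  rw [isOpen_iff_mem_nhds]
  rintro _ ⟨s, hs, rfl⟩
  have h1 : HasStrictDerivAt σ (deriv σ s) s :=
    (hσ.contDiffAt (hI.mem_nhds hs)).hasStrictDerivAt (by simp)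
  rw [← h1.map_nhds_eq (hreg s hs)]
  exact Filter.image_mem_map (hI.mem_nhds hs)

namespace IsCylinderOver

variable {U : Set (ℝ × ℝ)} {g : ℝ × ℝ → Matrix (Fin 2) (Fin 2) ℝ} {f : ℝ × ℝ → ℝ}
  {X : ℝ × ℝ → E3} {p : ℝ × ℝ} {b : E3} {J : Set ℝ} {γ : ℝ → E3} {σ h : ℝ → ℝ}
  {F : Type*} [NormedAddCommGroup F] [NormedSpace ℝ F]

theorem isOpen_J (hU : IsOpen U) (hC : IsCylinderOver U X b J γ σ h) : IsOpen J := by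
  rw [← hC.image_param]
  exact isOpen_image_of_deriv_ne_zero (isOpen_fst_image hU) hC.smooth_param hC.regular_param

theorem mem_J (hC : IsCylinderOver U X b J γ σ h) (hp : p ∈ U) : σ p.1 ∈ J := by
  rw [← hC.image_param]; exact Set.mem_image_of_mem _ (mem_fst_image hp)

theorem contDiffOn_comp (hC : IsCylinderOver U X b J γ σ h) {c : ℝ → F}
    (hc : ContDiffOn ℝ ∞ c J) : ContDiffOn ℝ ∞ (fun p : ℝ × ℝ => c (σ p.1)) U :=
  hc.comp (contDiffOn_comp_fst hC.smooth_param fun _ hp => mem_fst_image hp) fun _ hp => hC.mem_J hp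

theorem contDiffOn_height (hC : IsCylinderOver U X b J γ σ h) :
    ContDiffOn ℝ ∞ (fun p : ℝ × ℝ => p.2 + h p.1) U :=
  contDiffOn_snd.add (contDiffOn_comp_fst hC.smooth_shift fun _ hp => mem_fst_image hp)

theorem contDiffOn_horiz (hU : IsOpen U) (hC : IsCylinderOver U X b J γ σ h) {u : ℝ × ℝ → F}
    (hu : ContDiffOn ℝ ∞ u U) : ContDiffOn ℝ ∞ (horiz σ h u) U :=
  ConformalSurface.contDiffOn_horiz hU hC.smooth_param hC.smooth_shift hC.regular_param hu

theorem pd_one_horiz (hU : IsOpen U) (hC : IsCylinderOver U X b J γ σ h) {u : ℝ × ℝ → F}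
    (hu : ContDiffOn ℝ ∞ u U) (hp : p ∈ U) : pd 1 (horiz σ h u) p = horiz σ h (pd 1 u) p :=
  ConformalSurface.pd_one_horiz hU hC.smooth_param hC.smooth_shift hC.regular_param hu hp

theorem horiz_comp (hU : IsOpen U) (hC : IsCylinderOver U X b J γ σ h) {c : ℝ → F}
    (hc : ContDiffOn ℝ ∞ c J) (hp : p ∈ U) :
    horiz σ h (fun q => c (σ q.1)) p = deriv c (σ p.1) := by
  have hs := mem_fst_image hp
  have dσ := differentiableAt_of_contDiffOn (isOpen_fst_image hU) hC.smooth_param hs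
  have dc := differentiableAt_of_contDiffOn (hC.isOpen_J hU) hc (hC.mem_J hp)
  rw [ConformalSurface.horiz_comp (k := fun q : ℝ × ℝ => σ q.1) dc
    (dσ.comp p differentiableAt_fst), horiz, pd_zero_comp_fst dσ, pd_one_comp_fst dσ]
  simp [hC.regular_param _ hs]

theorem pd_one_comp (hU : IsOpen U) (hC : IsCylinderOver U X b J γ σ h) {c : ℝ → F}
    (hc : ContDiffOn ℝ ∞ c J) (hp : p ∈ U) : pd 1 (fun q => c (σ q.1)) p = 0 := by
  have dσ := differentiableAt_of_contDiffOn (isOpen_fst_image hU) hC.smooth_param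
    (mem_fst_image hp)
  have dc := differentiableAt_of_contDiffOn (hC.isOpen_J hU) hc (hC.mem_J hp)
  exact pd_one_comp_fst (c := fun s => c (σ s)) (dc.comp p.1 dσ)

theorem frame_height (hU : IsOpen U) (hC : IsCylinderOver U X b J γ σ h) (hp : p ∈ U) :
    horiz σ h (fun q => q.2 + h q.1) p = 0 ∧ pd 1 (fun q : ℝ × ℝ => q.2 + h q.1) p = 1 := by
  have dh := differentiableAt_of_contDiffOn (isOpen_fst_image hU) hC.smooth_shift
    (mem_fst_image hp)
  have dh' : DifferentiableAt ℝ (fun q : ℝ × ℝ => h q.1) p := dh.comp p differentiableAt_fst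
  have e0 : pd 0 (fun q : ℝ × ℝ => q.2 + h q.1) p = deriv h p.1 := by
    rw [pd_add differentiableAt_snd dh', pd_zero_comp_fst dh]
    simpa using pd_zero_snd
  have e1 : pd 1 (fun q : ℝ × ℝ => q.2 + h q.1) p = 1 := by
    rw [pd_add differentiableAt_snd dh', pd_one_comp_fst dh]
    simpa using pd_one_snd
  exact ⟨by simp [horiz, e0, e1], e1⟩

theorem frame_X (hU : IsOpen U) (hC : IsCylinderOver U X b J γ σ h) (hp : p ∈ U) :
    horiz σ h X p = deriv γ (σ p.1) ∧ pd 1 X p = b := by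
  have hw := hC.frame_height hU hp
  have dw := differentiableAt_of_contDiffOn hU hC.contDiffOn_height hp
  have dγ := differentiableAt_of_contDiffOn hU (hC.contDiffOn_comp hC.smooth_directrix) hp
  have db : DifferentiableAt ℝ (fun _ : ℝ × ℝ => b) p := differentiableAt_const _
  constructor
  · rw [horiz_congr hU hC.eq_cylinder hp, horiz_add dγ (dw.fun_smul db), horiz_smul dw db, hw.1,
      hC.horiz_comp hU hC.smooth_directrix hp, horiz_const]
    simp
  · rw [pd_congr hU hC.eq_cylinder hp, pd_add dγ (dw.fun_smul db), pd_smul dw db, hw.2,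
      hC.pd_one_comp hU hC.smooth_directrix hp, pd_const]
    simp

theorem pd_zero_X (hU : IsOpen U) (hC : IsCylinderOver U X b J γ σ h) (hp : p ∈ U) :
    pd 0 X p = deriv σ p.1 • deriv γ (σ p.1) + deriv h p.1 • b := by
  have h1 := hC.frame_X hU hp
  rw [← h1.1, horiz, h1.2, smul_inv_smul₀ (hC.regular_param _ (mem_fst_image hp))]
  module

/-! Curves in a plane orthogonal to `b`, parametrized by arc length. -/

theorem contDiffOn_tangent (hU : IsOpen U) (hC : IsCylinderOver U X b J γ σ h) :
    ContDiffOn ℝ ∞ (deriv γ) J := contDiffOn_deriv (hC.isOpen_J hU) hC.smooth_directrix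

theorem contDiffOn_accel (hU : IsOpen U) (hC : IsCylinderOver U X b J γ σ h) :
    ContDiffOn ℝ ∞ (deriv (deriv γ)) J :=
  contDiffOn_deriv (hC.isOpen_J hU) (hC.contDiffOn_tangent hU)

theorem _root_.ConformalSurface.deriv_inner {J : Set ℝ} (hJ : IsOpen J) {x y : ℝ → E3}
    (hx : ContDiffOn ℝ ∞ x J) (hy : ContDiffOn ℝ ∞ y J) {t : ℝ} (ht : t ∈ J) :
    deriv (fun s => inner ℝ (x s) (y s)) t =
      inner ℝ (x t) (deriv y t) + inner ℝ (deriv x t) (y t) :=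
  deriv_inner_apply ℝ (differentiableAt_of_contDiffOn hJ hx ht)
    (differentiableAt_of_contDiffOn hJ hy ht)

theorem _root_.ConformalSurface.deriv_congr_of_isOpen {J : Set ℝ} (hJ : IsOpen J) {x y : ℝ → F}
    (h : ∀ t ∈ J, x t = y t) {t : ℝ} (ht : t ∈ J) : deriv x t = deriv y t :=
  Filter.EventuallyEq.deriv_eq (by filter_upwards [hJ.mem_nhds ht] with s hs using h s hs)

theorem _root_.ConformalSurface.deriv_inner_of_const {J : Set ℝ} (hJ : IsOpen J) {x y : ℝ → E3}
    (hx : ContDiffOn ℝ ∞ x J) (hy : ContDiffOn ℝ ∞ y J) {c : ℝ}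
    (h : ∀ t ∈ J, inner ℝ (x t) (y t) = c) {t : ℝ} (ht : t ∈ J) :
    inner ℝ (x t) (deriv y t) + inner ℝ (deriv x t) (y t) = 0 := by
  rw [← deriv_inner hJ hx hy ht, deriv_congr_of_isOpen hJ h ht, deriv_const]

theorem inner_accel_dir (hU : IsOpen U) (hC : IsCylinderOver U X b J γ σ h) {t : ℝ} (ht : t ∈ J) :
    inner ℝ (deriv (deriv γ) t) b = 0 := by
  simpa using deriv_inner_of_const (hC.isOpen_J hU) (hC.contDiffOn_tangent hU)
    (contDiffOn_const (c := b)) hC.orthogonal ht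

theorem inner_tangent_self (hC : IsCylinderOver U X b J γ σ h) {t : ℝ} (ht : t ∈ J) :
    inner ℝ (deriv γ t) (deriv γ t) = 1 := by
  rw [real_inner_self_eq_norm_sq, hC.unit_speed t ht]; norm_num

theorem inner_accel_tangent (hU : IsOpen U) (hC : IsCylinderOver U X b J γ σ h) {t : ℝ}
    (ht : t ∈ J) : inner ℝ (deriv (deriv γ) t) (deriv γ t) = 0 := by
  have := deriv_inner_of_const (hC.isOpen_J hU) (hC.contDiffOn_tangent hU)
    (hC.contDiffOn_tangent hU) (fun t ht => hC.inner_tangent_self ht) ht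
  rw [real_inner_comm] at this
  linarith

/-- Only the principal parts have to be compared. The remainder is a first-order operator whose
coefficients at `p` do not depend on `u`, so it can be determined later from a single test map. -/
theorem exists_traceHess_eq (hU : IsOpen U) (hC : IsCylinderOver U X b J γ σ h)
    (hX : IsConformalImmersion U g f X) (hp : p ∈ U) :
    ∃ A B : ℝ, ∀ u : ℝ × ℝ → E3, ContDiffOn ℝ ∞ u U →
      traceHess g u p = f p • (horiz σ h (horiz σ h u) p + pd 1 (pd 1 u) p)
        + (A • pd 0 u p + B • pd 1 u p) := by
  have hs := mem_fst_image hp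
  have hσ := hC.regular_param _ hs
  have hinv := hX.metric.inv_mul hp
  have e00 := congrFun (congrFun hinv 0) 0
  have e01 := congrFun (congrFun hinv 0) 1
  have e11 := congrFun (congrFun hinv 1) 1
  have i00 := hX.induced p hp 0 0
  have i01 := hX.induced p hp 0 1
  have i11 := hX.induced p hp 1 1
  have hsym := hX.metric.inv_symm hp 1 0
  have hb : inner ℝ b b = (1 : ℝ) := by rw [real_inner_self_eq_norm_sq, hC.norm_dir]; norm_num
  have hTb := hC.orthogonal _ (hC.mem_J hp)
  have hbT : inner ℝ b (deriv γ (σ p.1)) = (0 : ℝ) := by rw [real_inner_comm]; exact hTb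
  simp only [hC.pd_zero_X hU hp, (hC.frame_X hU hp).2, inner_add_left, inner_add_right,
    real_inner_smul_left, real_inner_smul_right, hb, hTb, hbT,
    hC.inner_tangent_self (hC.mem_J hp)] at i00 i01 i11
  simp only [Matrix.mul_apply, Fin.sum_univ_two, Matrix.one_apply,
    hX.metric.symm hp 1 0] at e00 e01 e11
  simp at e00 e01 e11
  have hf := (hX.factor_pos p hp).ne'
  set r := (deriv σ p.1)⁻¹ with hr
  have hrσ : r * deriv σ p.1 = 1 := inv_mul_cancel₀ hσ
  -- The inverse metric is solved from `g⁻¹ g = 1`; the matrix `f g` has diagonal entries `σ'² +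
  -- h'²` and `1`, and off-diagonal entry `h'`.
  have c01 : (g p)⁻¹ 0 1 = - deriv h p.1 * (g p)⁻¹ 0 0 := by
    linear_combination f p * e01 + (g p)⁻¹ 0 0 * i01 + (g p)⁻¹ 0 1 * i11
  have c00 : (g p)⁻¹ 0 0 = f p * r ^ 2 := by
    have h1 : (g p)⁻¹ 0 0 * deriv σ p.1 ^ 2 = f p := by
      linear_combination f p * e00 + (g p)⁻¹ 0 0 * i00 + (g p)⁻¹ 0 1 * i01 - deriv h p.1 * c01
    linear_combination r ^ 2 * h1 - (g p)⁻¹ 0 0 * (r * deriv σ p.1 + 1) * hrσ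
  have c11 : (g p)⁻¹ 1 1 = f p * (1 + deriv h p.1 ^ 2 * r ^ 2) := by
    rw [hsym] at e11
    rw [c00] at c01
    linear_combination f p * e11 + (g p)⁻¹ 0 1 * i01 + (g p)⁻¹ 1 1 * i11 - deriv h p.1 * c01
  refine ⟨-(∑ i, ∑ j, (g p)⁻¹ i j * christoffel g 0 i j p)
      - f p * r * deriv (fun s => (deriv σ s)⁻¹) p.1,
    -(∑ i, ∑ j, (g p)⁻¹ i j * christoffel g 1 i j p)
      + f p * r * (deriv (fun s => (deriv σ s)⁻¹) p.1 * deriv h p.1 + r * deriv (deriv h) p.1),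
    fun u hu => ?_⟩
  have h1 := pd_horiz hU hC.smooth_param hC.smooth_shift hC.regular_param hu hp
  rw [horiz, h1.1, h1.2, ← hr, pd_comm hU hu hp 1 0]
  simp only [traceHess, Fin.sum_univ_two, hsym, c11, c01, c00, pd_comm hU hu hp 1 0]
  module

/-- This is the conformal covariance of the Laplacian in dimension two, obtained without computing
Christoffel symbols. For the test map `u = X`, both `τ` and `γ''` are normal, so the first-order
remainder `A ∂₀X + B ∂₁X` is normal as well as tangent. Hence it vanishes and `A = B = 0`. -/
theorem traceHess_eq (hU : IsOpen U) (hC : IsCylinderOver U X b J γ σ h)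
    (hX : IsConformalImmersion U g f X) {u : ℝ × ℝ → E3} (hu : ContDiffOn ℝ ∞ u U) (hp : p ∈ U) :
    traceHess g u p = f p • (horiz σ h (horiz σ h u) p + pd 1 (pd 1 u) p) := by
  obtain ⟨A, B, hAB⟩ := hC.exists_traceHess_eq hU hX hp
  have ht := hC.mem_J hp
  have h1 : horiz σ h (horiz σ h X) p = deriv (deriv γ) (σ p.1) := by
    rw [horiz_congr hU (fun q hq => (hC.frame_X hU hq).1) hp,
      hC.horiz_comp hU (hC.contDiffOn_tangent hU) hp]
  have h2 : pd 1 (pd 1 X) p = 0 := by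
    rw [pd_congr hU (fun q hq => (hC.frame_X hU hq).2) hp, pd_const]
  have hτ := hAB X hX.smooth
  rw [h1, h2, add_zero] at hτ
  have h3 : ∀ m, inner ℝ (deriv (deriv γ) (σ p.1)) (pd m X p) = (0 : ℝ) := by
    intro m
    fin_cases m
    · simp [hC.pd_zero_X hU hp, inner_add_right, inner_smul_right, hC.inner_accel_dir hU ht,
        hC.inner_accel_tangent hU ht]
    · simpa [(hC.frame_X hU hp).2] using hC.inner_accel_dir hU ht
  have h4 : ∀ m, inner ℝ (A • pd 0 X p + B • pd 1 X p) (pd m X p) = (0 : ℝ) := by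
    intro m
    have := hX.inner_tension_pd hU hp m
    rwa [tension, hτ, inner_add_left, real_inner_smul_left, h3, mul_zero, zero_add] at this
  have h5 : A • pd 0 X p + B • pd 1 X p = 0 := by
    rw [← inner_self_eq_zero (𝕜 := ℝ)]
    conv_lhs => rw [inner_add_right, inner_smul_right, inner_smul_right, h4, h4]
    simp
  obtain ⟨hA, hB⟩ := LinearIndependent.pair_iff.1 (hX.linearIndependent hp) A B h5
  rw [hAB u hu, hA, hB]; simp

theorem tension_eq (hU : IsOpen U) (hC : IsCylinderOver U X b J γ σ h)
    (hX : IsConformalImmersion U g f X) (hp : p ∈ U) :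
    tension g X p = f p • deriv (deriv γ) (σ p.1) := by
  rw [tension, hC.traceHess_eq hU hX hX.smooth hp,
    horiz_congr hU (fun q hq => (hC.frame_X hU hq).1) hp,
    hC.horiz_comp hU (hC.contDiffOn_tangent hU) hp,
    pd_congr hU (fun q hq => (hC.frame_X hU hq).2) hp, pd_const, add_zero]

end IsCylinderOver

/-! ### The biharmonic equation of a cylinder -/

/-- Four nonzero pairwise orthogonal vectors do not fit in dimension three. This allows vector
identities to be checked against `γ'`, a normal and `b`. -/
theorem eq_zero_of_inner_eq_zero {x y z u : E3} (hx : x ≠ 0) (hy : y ≠ 0) (hz : z ≠ 0)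
    (hxy : inner ℝ x y = 0) (hxz : inner ℝ x z = 0) (hyz : inner ℝ y z = 0)
    (hux : inner ℝ u x = 0) (huy : inner ℝ u y = 0) (huz : inner ℝ u z = 0) : u = 0 := by
  by_contra hu
  have hli : LinearIndependent ℝ ![x, y, z, u] := by
    refine linearIndependent_of_ne_zero_of_inner_eq_zero (𝕜 := ℝ) ?_ ?_
    · intro i; fin_cases i <;> simpa
    · intro i j hij
      rw [real_inner_comm] at hux huy huz
      have hyx := hxy
      have hzx := hxz
      have hzy := hyz
      have hxu := hux
      have hyu := huy
      have hzu := huz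
      rw [real_inner_comm] at hyx hzx hzy hxu hyu hzu
      fin_cases i <;> fin_cases j <;> first | exact absurd rfl hij | simpa
  have := hli.fintype_card_le_finrank
  simp at this

theorem contDiffOn_curvature {γ : ℝ → E3} {J : Set ℝ} (hN : ContDiffOn ℝ ∞ (deriv (deriv γ)) J)
    (h0 : ∀ t ∈ J, deriv (deriv γ) t ≠ 0) : ContDiffOn ℝ ∞ (curvature γ) J :=
  hN.norm ℝ h0

/-- The quantity which is constant along the directrix of a biharmonic cylinder. -/
def ermakov (k : ℝ → ℝ) (t : ℝ) : ℝ :=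
  k t ^ 2 + deriv (deriv k) t / (2 * k t) - 3 * deriv k t ^ 2 / (4 * k t ^ 2)

namespace IsCylinderOver

variable {U : Set (ℝ × ℝ)} {g : ℝ × ℝ → Matrix (Fin 2) (Fin 2) ℝ} {f : ℝ × ℝ → ℝ}
  {X : ℝ × ℝ → E3} {p : ℝ × ℝ} {b : E3} {J : Set ℝ} {γ : ℝ → E3} {σ h : ℝ → ℝ}

/-- The Leibniz rule for the flat Laplacian of `f γ''(σ)`; derivatives along the rulings fall on `f`
only. -/
theorem bitension_eq (hU : IsOpen U) (hC : IsCylinderOver U X b J γ σ h)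
    (hX : IsConformalImmersion U g f X) (hp : p ∈ U) :
    bitension g X p = f p • ((horiz σ h (horiz σ h f) p + pd 1 (pd 1 f) p) •
        deriv (deriv γ) (σ p.1) + (2 * horiz σ h f p) • deriv (deriv (deriv γ)) (σ p.1)
      + f p • deriv (deriv (deriv (deriv γ))) (σ p.1)) := by
  have hJ := hC.isOpen_J hU
  have hf := hX.contDiffOn_factor hU
  have hN := hC.contDiffOn_accel hU
  have hN' := contDiffOn_deriv hJ hN
  have hfN : ContDiffOn ℝ ∞ (fun p => f p • deriv (deriv γ) (σ p.1)) U :=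
    hf.smul (hC.contDiffOn_comp hN)
  have D : ∀ {F : Type} [NormedAddCommGroup F] [NormedSpace ℝ F] {u : ℝ × ℝ → F},
      ContDiffOn ℝ ∞ u U → ∀ {q}, q ∈ U → DifferentiableAt ℝ u q :=
    fun hu _ hq => differentiableAt_of_contDiffOn hU hu hq
  have h1 : ∀ q ∈ U, horiz σ h (fun p => f p • deriv (deriv γ) (σ p.1)) q =
      f q • deriv (deriv (deriv γ)) (σ q.1) + horiz σ h f q • deriv (deriv γ) (σ q.1) := by
    intro q hq
    rw [horiz_smul (D hf hq) (D (hC.contDiffOn_comp hN) hq), hC.horiz_comp hU hN hq]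
  have h2 : ∀ q ∈ U, pd 1 (fun p => f p • deriv (deriv γ) (σ p.1)) q =
      pd 1 f q • deriv (deriv γ) (σ q.1) := by
    intro q hq
    rw [pd_smul (D hf hq) (D (hC.contDiffOn_comp hN) hq), hC.pd_one_comp hU hN hq]
    simp
  have hLf := hC.contDiffOn_horiz hU hf
  have hpf := contDiffOn_pd hU hf 1
  have h3 : traceHess g (tension g X) p =
      traceHess g (fun p => f p • deriv (deriv γ) (σ p.1)) p := by
    rw [hC.traceHess_eq hU hX (hX.contDiffOn_tension hU) hp, hC.traceHess_eq hU hX hfN hp]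
    have h4 : ∀ q ∈ U, tension g X q = f q • deriv (deriv γ) (σ q.1) :=
      fun q hq => hC.tension_eq hU hX hq
    rw [horiz_congr hU (fun q hq => horiz_congr hU h4 hq) hp,
      pd_congr hU (fun q hq => pd_congr hU h4 hq 1) hp]
  rw [bitension, h3, hC.traceHess_eq hU hX hfN hp, horiz_congr hU h1 hp, pd_congr hU h2 hp,
    horiz_add ((D hf hp).fun_smul (D (hC.contDiffOn_comp hN') hp))
      ((D hLf hp).fun_smul (D (hC.contDiffOn_comp hN) hp)),
    horiz_smul (D hf hp) (D (hC.contDiffOn_comp hN') hp),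
    horiz_smul (D hLf hp) (D (hC.contDiffOn_comp hN) hp),
    hC.horiz_comp hU hN hp, hC.horiz_comp hU hN' hp,
    pd_smul (D hpf hp) (D (hC.contDiffOn_comp hN) hp), hC.pd_one_comp hU hN hp]
  module

/-- The component of the bitension field along the directrix. -/
theorem inner_bitension_tangent (hU : IsOpen U) (hC : IsCylinderOver U X b J γ σ h)
    (hX : IsConformalImmersion U g f X) (hp : p ∈ U) :
    inner ℝ (bitension g X p) (deriv γ (σ p.1)) = - f p / 2 *
      (4 * horiz σ h f p * inner ℝ (deriv (deriv γ) (σ p.1)) (deriv (deriv γ) (σ p.1))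
      + 3 * f p * deriv (fun t => inner ℝ (deriv (deriv γ) t) (deriv (deriv γ) t)) (σ p.1)) := by
  have hJ := hC.isOpen_J hU
  have ht := hC.mem_J hp
  have hT := hC.contDiffOn_tangent hU
  have hN := hC.contDiffOn_accel hU
  have hN' := contDiffOn_deriv hJ hN
  have e1 : ∀ t ∈ J, inner ℝ (deriv (deriv (deriv γ)) t) (deriv γ t) =
      - inner ℝ (deriv (deriv γ) t) (deriv (deriv γ) t) := fun t ht => by
    have := deriv_inner_of_const hJ hN hT (fun t ht => hC.inner_accel_tangent hU ht) ht
    linarith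
  have e2 := deriv_inner hJ hN' hT ht
  rw [deriv_congr_of_isOpen hJ e1 ht, deriv.fun_neg, deriv_inner hJ hN hN ht] at e2
  rw [hC.bitension_eq hU hX hp]
  simp only [real_inner_smul_left, inner_add_left, hC.inner_accel_tangent hU ht, e1 _ ht,
    deriv_inner hJ hN hN ht]
  rw [real_inner_comm (deriv (deriv (deriv γ)) (σ p.1))] at e2 ⊢
  linear_combination f p ^ 2 * (-1) * e2

/-- In arc length `σ` along lines parallel to the directrix, the function `|τ|⁶ / f²` of a
biharmonic cylinder is constant. -/
theorem horiz_first_integral (hU : IsOpen U) (hC : IsCylinderOver U X b J γ σ h)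
    (hX : IsConformalImmersion U g f X) (hb : IsBiharmonic U g X) (hp : p ∈ U) :
    horiz σ h (fun q => inner ℝ (tension g X q) (tension g X q) ^ 3 / f q ^ 2) p = 0 := by
  have hf := hX.contDiffOn_factor hU
  have hN := hC.contDiffOn_accel hU
  have hfp := (hX.factor_pos p hp).ne'
  -- In terms of the cylinder the quantity is `f⁴ |γ''|⁶`, whose logarithmic derivative is governed
  -- by the tangential equation. The expression in `τ` and `f` is kept in the statement because it
  -- refers to no cylinder.
  have h1 : ∀ q ∈ U, inner ℝ (tension g X q) (tension g X q) ^ 3 / f q ^ 2 =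
      f q ^ 4 * inner ℝ (deriv (deriv γ) (σ q.1)) (deriv (deriv γ) (σ q.1)) ^ 3 := by
    intro q hq
    have := (hX.factor_pos q hq).ne'
    rw [hC.tension_eq hU hX hq, real_inner_smul_left, real_inner_smul_right]
    field_simp
  set Q : ℝ → ℝ := fun t => inner ℝ (deriv (deriv γ) t) (deriv (deriv γ) t) with hQ
  have hQs : ContDiffOn ℝ ∞ Q J := hN.inner ℝ hN
  have hQ' := hC.contDiffOn_comp hQs
  have df := differentiableAt_of_contDiffOn hU hf hp
  have dQ := differentiableAt_of_contDiffOn hU hQ' hp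
  rw [horiz_congr hU h1 hp]
  have h2 := hC.inner_bitension_tangent hU hX hp
  rw [hb p hp, inner_zero_left] at h2
  have h3 : 4 * horiz σ h f p * Q (σ p.1) + 3 * f p * deriv Q (σ p.1) = 0 := by
    have := mul_eq_zero.1 h2.symm
    exact this.resolve_left (by simpa using hfp)
  have e1 : horiz σ h (fun q => f q ^ 4) p = 4 * f p ^ 3 * horiz σ h f p := by
    rw [ConformalSurface.horiz_comp (c := fun x => x ^ 4) (by fun_prop) df]
    simp; ring
  have e2 : horiz σ h (fun q => Q (σ q.1) ^ 3) p = 3 * Q (σ p.1) ^ 2 * deriv Q (σ p.1) := by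
    rw [ConformalSurface.horiz_comp (c := fun x => x ^ 3) (k := fun q : ℝ × ℝ => Q (σ q.1))
      (by fun_prop) dQ, hC.horiz_comp hU hQs hp]
    simp; ring
  change horiz σ h (fun q => f q ^ 4 * Q (σ q.1) ^ 3) p = 0
  rw [horiz_mul (df.fun_pow 4) (dQ.fun_pow 3), e1, e2]
  linear_combination f p ^ 3 * Q (σ p.1) ^ 2 * h3

theorem dir_ne_zero (hC : IsCylinderOver U X b J γ σ h) : b ≠ 0 := by
  intro h0; simpa [h0] using hC.norm_dir

theorem tangent_ne_zero (hC : IsCylinderOver U X b J γ σ h) {t : ℝ} (ht : t ∈ J) :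
    deriv γ t ≠ 0 := by
  intro h0; simpa [h0] using hC.unit_speed t ht

/-- Frenet equations. -/
theorem frenet (hU : IsOpen U) (hC : IsCylinderOver U X b J γ σ h)
    (h0 : ∀ t ∈ J, deriv (deriv γ) t ≠ 0) {t : ℝ} (ht : t ∈ J) :
    curvature γ t • deriv (deriv (deriv γ)) t =
      deriv (curvature γ) t • deriv (deriv γ) t - curvature γ t ^ 3 • deriv γ t := by
  have hJ := hC.isOpen_J hU
  have hT := hC.contDiffOn_tangent hU
  have hN := hC.contDiffOn_accel hU
  have hκ := contDiffOn_curvature hN h0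
  have dκ := differentiableAt_of_contDiffOn hJ hκ ht
  have hq : ∀ t ∈ J, inner ℝ (deriv (deriv γ) t) (deriv (deriv γ) t) = curvature γ t ^ 2 :=
    fun t _ => by rw [real_inner_self_eq_norm_sq, curvature]
  have e1 := deriv_inner_of_const hJ hN hT (fun t ht => hC.inner_accel_tangent hU ht) ht
  have e2 := deriv_inner hJ hN hN ht
  rw [deriv_congr_of_isOpen hJ hq ht, deriv_fun_pow dκ, real_inner_comm] at e2
  have e3 : inner ℝ (deriv (deriv (deriv γ)) t) b = (0 : ℝ) := by
    simpa using deriv_inner_of_const hJ hN (contDiffOn_const (c := b))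
      (fun t ht => hC.inner_accel_dir hU ht) ht
  rw [← sub_eq_zero]
  refine eq_zero_of_inner_eq_zero (hC.tangent_ne_zero ht) (h0 t ht) hC.dir_ne_zero ?_
    (hC.orthogonal t ht) (hC.inner_accel_dir hU ht) ?_ ?_ ?_
  · rw [real_inner_comm]; exact hC.inner_accel_tangent hU ht
  · simp only [inner_sub_left, real_inner_smul_left, hC.inner_accel_tangent hU ht,
      hC.inner_tangent_self ht]
    rw [hq t ht] at e1
    linear_combination curvature γ t * e1
  · simp only [inner_sub_left, real_inner_smul_left, hq t ht]
    rw [real_inner_comm (deriv (deriv γ) t) (deriv γ t), hC.inner_accel_tangent hU ht]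
    simp at e2
    linear_combination -curvature γ t / 2 * e2
  · simp [inner_sub_left, real_inner_smul_left, e3, hC.inner_accel_dir hU ht, hC.orthogonal t ht]

/-- The biharmonic equation of a cylinder over a curve without inflection points. -/
theorem isBiharmonic_iff (hU : IsOpen U) (hC : IsCylinderOver U X b J γ σ h)
    (hX : IsConformalImmersion U g f X) (h0 : ∀ t ∈ J, deriv (deriv γ) t ≠ 0) :
    IsBiharmonic U g X ↔ ∀ p ∈ U,
      horiz σ h f p = -(3 / 2) * (deriv (curvature γ) (σ p.1) / curvature γ (σ p.1)) * f p ∧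
      pd 1 (pd 1 f) p = ermakov (curvature γ) (σ p.1) * f p := by
  have hJ := hC.isOpen_J hU
  have hf := hX.contDiffOn_factor hU
  have hT := hC.contDiffOn_tangent hU
  have hN := hC.contDiffOn_accel hU
  have hκ := contDiffOn_curvature hN h0
  have hκ' := contDiffOn_deriv hJ hκ
  have hpos : ∀ t ∈ J, curvature γ t ≠ 0 := fun t ht => by simpa [curvature] using h0 t ht
  set k := curvature γ with hk
  have hm : ContDiffOn ℝ ∞ (fun t => deriv k t / k t) J := hκ'.div hκ hpos
  have hm' : ∀ t ∈ J, deriv (fun t => deriv k t / k t) t =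
      deriv (deriv k) t / k t - deriv k t ^ 2 / k t ^ 2 := by
    intro t ht
    rw [deriv_fun_div (differentiableAt_of_contDiffOn hJ hκ' ht)
      (differentiableAt_of_contDiffOn hJ hκ ht) (hpos t ht)]
    have := hpos t ht
    field_simp
  have e1 : ∀ t ∈ J, deriv (deriv (deriv γ)) t =
      (deriv k t / k t) • deriv (deriv γ) t - k t ^ 2 • deriv γ t := by
    intro t ht
    have h1 := hC.frenet hU h0 ht
    rw [← hk] at h1
    have := hpos t ht
    have h2 := congrArg (fun y => (k t)⁻¹ • y) h1
    simp only [inv_smul_smul₀ this, smul_sub, smul_smul] at h2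
    rw [h2]
    congr 2 <;> field_simp
  have e2 : ∀ t ∈ J, deriv (deriv (deriv (deriv γ))) t =
      (deriv (deriv k) t / k t - k t ^ 2) • deriv (deriv γ) t -
        (3 * k t * deriv k t) • deriv γ t := by
    intro t ht
    have dk := differentiableAt_of_contDiffOn hJ hκ ht
    have dm := differentiableAt_of_contDiffOn hJ hm ht
    have dN := differentiableAt_of_contDiffOn hJ hN ht
    have dT := differentiableAt_of_contDiffOn hJ hT ht
    rw [deriv_congr_of_isOpen hJ e1 ht, deriv_fun_sub (dm.fun_smul dN) ((dk.fun_pow 2).fun_smul dT),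
      deriv_fun_smul dm dN, deriv_fun_smul (dk.fun_pow 2) dT, e1 t ht, hm' t ht, deriv_fun_pow dk]
    have := hpos t ht
    match_scalars <;> field_simp <;> ring
  -- By the Frenet equations the bitension field lies in the span of the orthogonal vectors `γ'` and
  -- `γ''`; the two equations are its coefficients.
  have key : ∀ p ∈ U, bitension g X p = 0 ↔
      (2 * k (σ p.1) ^ 2 * horiz σ h f p + 3 * k (σ p.1) * deriv k (σ p.1) * f p = 0 ∧
      horiz σ h (horiz σ h f) p + pd 1 (pd 1 f) p
        + 2 * horiz σ h f p * (deriv k (σ p.1) / k (σ p.1))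
        + f p * (deriv (deriv k) (σ p.1) / k (σ p.1) - k (σ p.1) ^ 2) = 0) := by
    intro p hp
    have ht := hC.mem_J hp
    have hTT := hC.inner_tangent_self ht
    have hNT := hC.inner_accel_tangent hU ht
    have hY : bitension g X p = f p • ((horiz σ h (horiz σ h f) p + pd 1 (pd 1 f) p
        + 2 * horiz σ h f p * (deriv k (σ p.1) / k (σ p.1))
        + f p * (deriv (deriv k) (σ p.1) / k (σ p.1) - k (σ p.1) ^ 2)) • deriv (deriv γ) (σ p.1)
        - (2 * k (σ p.1) ^ 2 * horiz σ h f p + 3 * k (σ p.1) * deriv k (σ p.1) * f p) •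
          deriv γ (σ p.1)) := by
      rw [hC.bitension_eq hU hX hp, e2 _ ht, e1 _ ht]
      module
    rw [hY, smul_eq_zero, or_iff_right (hX.factor_pos p hp).ne']
    constructor
    · intro h1
      have h2 := congrArg (fun y => inner ℝ y (deriv γ (σ p.1))) h1
      simp only [inner_sub_left, real_inner_smul_left, hTT, hNT, inner_zero_left] at h2
      have h3 : 2 * k (σ p.1) ^ 2 * horiz σ h f p + 3 * k (σ p.1) * deriv k (σ p.1) * f p = 0 := by
        linear_combination -h2
      refine ⟨h3, ?_⟩
      rw [h3, zero_smul, sub_zero, smul_eq_zero] at h1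
      exact h1.resolve_right (h0 _ ht)
    · rintro ⟨h1, h2⟩
      rw [h1, h2]; simp
  have hB : ∀ p ∈ U, 2 * k (σ p.1) ^ 2 * horiz σ h f p + 3 * k (σ p.1) * deriv k (σ p.1) * f p = 0 ↔
      horiz σ h f p = -(3 / 2) * (deriv k (σ p.1) / k (σ p.1)) * f p := by
    intro p hp
    have := hpos _ (hC.mem_J hp)
    constructor
    · intro h1
      have h2 : k (σ p.1) * (2 * k (σ p.1) * horiz σ h f p + 3 * deriv k (σ p.1) * f p) = 0 := by
        linear_combination h1
      have h3 := (mul_eq_zero.1 h2).resolve_left this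
      field_simp
      linear_combination h3
    · intro h1
      rw [h1]; field_simp; ring
  -- Differentiating the first equation once more expresses `f_σσ` through `f`, so the normal
  -- equation retains only `∂₁∂₁f`.
  have hA : (∀ p ∈ U, horiz σ h f p = -(3 / 2) * (deriv k (σ p.1) / k (σ p.1)) * f p) →
      ∀ p ∈ U, horiz σ h (horiz σ h f) p = (-(3 / 2) * (deriv (deriv k) (σ p.1) / k (σ p.1)
        - deriv k (σ p.1) ^ 2 / k (σ p.1) ^ 2)
        + 9 / 4 * (deriv k (σ p.1) / k (σ p.1)) ^ 2) * f p := by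
    intro hf1 p hp
    have df := differentiableAt_of_contDiffOn hU hf hp
    have hm2 : ContDiffOn ℝ ∞ (fun t => -(3 / 2) * (deriv k t / k t)) J := contDiffOn_const.mul hm
    have dm := differentiableAt_of_contDiffOn hU (hC.contDiffOn_comp hm2) hp
    rw [horiz_congr hU hf1 hp, horiz_mul dm df, hC.horiz_comp hU hm2 hp, hf1 p hp,
      deriv_const_mul _ (differentiableAt_of_contDiffOn hJ hm (hC.mem_J hp)), hm' _ (hC.mem_J hp)]
    ring
  constructor
  · intro hb p hp
    have h1 := fun p hp => (hB p hp).1 ((key p hp).1 (hb p hp)).1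
    have h2 := ((key p hp).1 (hb p hp)).2
    refine ⟨h1 p hp, ?_⟩
    rw [hA h1 p hp, h1 p hp] at h2
    have := hpos _ (hC.mem_J hp)
    rw [ermakov]
    field_simp
    field_simp at h2
    linear_combination h2
  · intro hh p hp
    refine (key p hp).2 ⟨(hB p hp).2 (hh p hp).1, ?_⟩
    rw [hA (fun p hp => (hh p hp).1) p hp, (hh p hp).1, (hh p hp).2, ermakov]
    have := hpos _ (hC.mem_J hp)
    field_simp
    ring

/-- The quantity `ermakov` is constant along the directrix of a biharmonic cylinder. -/
theorem deriv_ermakov (hU : IsOpen U) (hC : IsCylinderOver U X b J γ σ h)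
    (hX : IsConformalImmersion U g f X) (h0 : ∀ t ∈ J, deriv (deriv γ) t ≠ 0)
    (hb : IsBiharmonic U g X) :
    ContDiffOn ℝ ∞ (ermakov (curvature γ)) J ∧ ∀ t ∈ J, deriv (ermakov (curvature γ)) t = 0 := by
  have hJ := hC.isOpen_J hU
  have hf := hX.contDiffOn_factor hU
  have hκ := contDiffOn_curvature (hC.contDiffOn_accel hU) h0
  have hκ' := contDiffOn_deriv hJ hκ
  have hκ'' := contDiffOn_deriv hJ hκ'
  have hpos : ∀ t ∈ J, curvature γ t ≠ 0 := fun t ht => by simpa [curvature] using h0 t ht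
  have hE : ContDiffOn ℝ ∞ (ermakov (curvature γ)) J :=
    ((hκ.pow 2).add (hκ''.div (contDiffOn_const.mul hκ) fun t ht =>
      mul_ne_zero two_ne_zero (hpos t ht))).sub
      ((contDiffOn_const.mul (hκ'.pow 2)).div (contDiffOn_const.mul (hκ.pow 2)) fun t ht =>
        mul_ne_zero four_ne_zero (pow_ne_zero 2 (hpos t ht)))
  refine ⟨hE, ?_⟩
  rw [← hC.image_param]
  rintro _ ⟨_, ⟨p, hp, rfl⟩, rfl⟩
  have hh := (hC.isBiharmonic_iff hU hX h0).1 hb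
  set k := curvature γ
  have hm : ContDiffOn ℝ ∞ (fun t => -(3 / 2) * (deriv k t / k t)) J :=
    contDiffOn_const.mul (hκ'.div hκ hpos)
  have hmc := hC.contDiffOn_comp hm
  have hEc := hC.contDiffOn_comp hE
  have D : ∀ {u : ℝ × ℝ → ℝ}, ContDiffOn ℝ ∞ u U → ∀ {q}, q ∈ U → DifferentiableAt ℝ u q :=
    fun hu _ hq => differentiableAt_of_contDiffOn hU hu hq
  have hf1 := contDiffOn_pd hU hf 1
  have h1 : ∀ q ∈ U, pd 1 (horiz σ h f) q =
      -(3 / 2) * (deriv k (σ q.1) / k (σ q.1)) * pd 1 f q := by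
    intro q hq
    rw [pd_congr hU (fun q hq => (hh q hq).1) hq, pd_mul (D hmc hq) (D hf hq),
      hC.pd_one_comp hU hm hq]
    ring
  have h2 : pd 1 (pd 1 (horiz σ h f)) p =
      -(3 / 2) * (deriv k (σ p.1) / k (σ p.1)) * (ermakov k (σ p.1) * f p) := by
    rw [pd_congr hU h1 hp, pd_mul (D hmc hp) (D hf1 hp), hC.pd_one_comp hU hm hp, (hh p hp).2]
    ring
  -- Compatibility of the two equations: computed in the two orders, the mixed third derivative of
  -- `f` differs exactly by `E' f`.
  have h3 : pd 1 (pd 1 (horiz σ h f)) p = horiz σ h (pd 1 (pd 1 f)) p := by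
    rw [pd_congr hU (fun q hq => hC.pd_one_horiz hU hf hq) hp, hC.pd_one_horiz hU hf1 hp]
  rw [h2, horiz_congr hU (fun q hq => (hh q hq).2) hp, horiz_mul (D hEc hp) (D hf hp),
    hC.horiz_comp hU hE hp, (hh p hp).1] at h3
  have h4 : deriv (ermakov k) (σ p.1) * f p = 0 := by linear_combination -h3
  exact (mul_eq_zero.1 h4).resolve_right (hX.factor_pos p hp).ne'

end IsCylinderOver

/-! ### Ruled surfaces with parallel rulings are cylinders -/

/-- Injectivity on `I` identifies the global inverse with the smooth local inverses of the inverse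
function theorem. -/
theorem contDiffOn_invFunOn {σ : ℝ → ℝ} {I : Set ℝ} (hI : IsOpen I) (hσ : ContDiffOn ℝ ∞ σ I)
    (hinj : Set.InjOn σ I) (hreg : ∀ s ∈ I, deriv σ s ≠ 0) :
    ContDiffOn ℝ ∞ (Function.invFunOn σ I) (σ '' I) := by
  rintro _ ⟨s, hs, rfl⟩
  have hc := hσ.contDiffAt (hI.mem_nhds hs)
  have hd := (differentiableAt_of_contDiffOn hI hσ hs).hasDerivAt.hasFDerivAt_equiv (hreg s hs)
  have h1 := hc.to_localInverse hd (by simp)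
  refine (h1.congr_of_eventuallyEq ?_).contDiffWithinAt
  refine HasStrictFDerivAt.localInverse_unique _ ?_
  filter_upwards [hI.mem_nhds hs] with x hx
  exact hinj.leftInvOn_invFunOn hx

theorem exists_smooth_primitive {ρ : ℝ → ℝ} {I : Set ℝ} (hI : IsOpen I) (hc : IsPreconnected I)
    (hρ : ContDiffOn ℝ ∞ ρ I) :
    ∃ σ : ℝ → ℝ, ContDiffOn ℝ ∞ σ I ∧ ∀ s ∈ I, deriv σ s = ρ s := by
  rcases I.eq_empty_or_nonempty with rfl | ⟨s₀, hs₀⟩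
  · exact ⟨ρ, hρ, by simp⟩
  have hd : ∀ s ∈ I, HasDerivAt (fun u => ∫ x in s₀..u, ρ x) (ρ s) s := by
    intro s hs
    refine intervalIntegral.integral_hasDerivAt_right
      (ContinuousOn.intervalIntegrable (hρ.continuousOn.mono (hc.ordConnected.uIcc_subset hs₀ hs)))
      (hρ.continuousOn.stronglyMeasurableAtFilter hI s hs)
      (hρ.continuousOn.continuousAt (hI.mem_nhds hs))
  refine ⟨_, (contDiffOn_infty_iff_deriv_of_isOpen hI).2
    ⟨fun s hs => (hd s hs).differentiableAt.differentiableWithinAt, ?_⟩,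
    fun s hs => (hd s hs).deriv⟩
  exact hρ.congr fun s hs => (hd s hs).deriv

/-- The directrix is the orthogonal projection of the base curve along `b`, reparametrized by arc
length; the shift `⟨a, b⟩` is the height removed by the projection. Only the projection of `U` has
to be connected, so the lemma also applies to strips of rulings that are not connected themselves.
-/
theorem exists_isCylinderOver {U : Set (ℝ × ℝ)} {X : ℝ × ℝ → E3} {a : ℝ → E3} {b : E3}
    (hU : IsOpen U) (hc : IsPreconnected (Prod.fst '' U)) (ha : ContDiffOn ℝ ∞ a (Prod.fst '' U))
    (hb : ‖b‖ = 1) (hX : ∀ p ∈ U, X p = a p.1 + p.2 • b)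
    (hreg : ∀ p ∈ U, LinearIndependent ℝ ![pd 0 X p, pd 1 X p]) :
    ∃ J γ σ, IsCylinderOver U X b J γ σ (fun s => inner ℝ (a s) b) := by
  have hI := isOpen_fst_image hU
  set I := Prod.fst '' U
  have hbb : inner ℝ b b = (1 : ℝ) := by rw [real_inner_self_eq_norm_sq, hb]; norm_num
  set h : ℝ → ℝ := fun s => inner ℝ (a s) b
  have hh : ContDiffOn ℝ ∞ h I := ha.inner ℝ contDiffOn_const
  set c : ℝ → E3 := fun s => a s - h s • b
  have hcs : ContDiffOn ℝ ∞ c I := ha.sub (hh.smul contDiffOn_const)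
  have hcb : ∀ s ∈ I, inner ℝ (c s) b = (0 : ℝ) := by
    intro s _
    simp only [c, inner_sub_left, real_inner_smul_left, hbb, h]; ring
  have hc'b : ∀ s ∈ I, inner ℝ (deriv c s) b = (0 : ℝ) := by
    intro s hs
    simpa using deriv_inner_of_const hI hcs (contDiffOn_const (c := b)) hcb hs
  have hc' : ∀ s ∈ I, deriv c s = deriv a s - deriv h s • b := by
    intro s hs
    have da := differentiableAt_of_contDiffOn hI ha hs
    have dh := differentiableAt_of_contDiffOn hI hh hs
    rw [deriv_fun_sub da (dh.smul_const b), deriv_smul_const dh]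
  have hne : ∀ s ∈ I, deriv c s ≠ 0 := by
    rintro _ ⟨p, hp, rfl⟩ h0
    have h1 := pd_ruled hI ha (contDiffOn_const (c := b)) (mem_fst_image hp)
    have h2 := hreg p hp
    rw [pd_congr hU hX hp, pd_congr hU hX hp, h1.1, h1.2, LinearIndependent.pair_iff] at h2
    rw [hc' _ (mem_fst_image hp)] at h0
    have := h2 1 (-deriv h p.1) (by simp only [deriv_const, smul_zero, add_zero]; rw [← h0]; module)
    simp at this
  have hc's := contDiffOn_deriv hI hcs
  obtain ⟨σ, hσ, hσ'⟩ := exists_smooth_primitive hI hc (hc's.norm ℝ hne)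
  have hpos : ∀ s ∈ I, 0 < deriv σ s := fun s hs => by
    rw [hσ' s hs]; exact norm_pos_iff.2 (hne s hs)
  have hmono : StrictMonoOn σ I :=
    strictMonoOn_of_deriv_pos hc.ordConnected.convex hσ.continuousOn
      fun s hs => hpos s (interior_subset hs)
  have hreg' : ∀ s ∈ I, deriv σ s ≠ 0 := fun s hs => (hpos s hs).ne'
  have hinv : ∀ s ∈ I, Function.invFunOn σ I (σ s) = s := hmono.injOn.leftInvOn_invFunOn
  set γ : ℝ → E3 := fun t => c (Function.invFunOn σ I t)
  have hγ : ContDiffOn ℝ ∞ γ (σ '' I) := by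
    refine hcs.comp (contDiffOn_invFunOn hI hσ hmono.injOn hreg') ?_
    rintro _ ⟨s, hs, rfl⟩
    rw [hinv s hs]; exact hs
  have hγσ : ∀ s ∈ I, γ (σ s) = c s := fun s hs => by simp only [γ, hinv s hs]
  have hJ : IsOpen (σ '' I) := isOpen_image_of_deriv_ne_zero hI hσ hreg'
  have hγ' : ∀ s ∈ I, deriv γ (σ s) = (‖deriv c s‖)⁻¹ • deriv c s := by
    intro s hs
    have h1 : deriv (fun s => γ (σ s)) s = deriv σ s • deriv γ (σ s) :=
      ((differentiableAt_of_contDiffOn hJ hγ ⟨s, hs, rfl⟩).hasDerivAt.scomp s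
        (differentiableAt_of_contDiffOn hI hσ hs).hasDerivAt).deriv
    rw [deriv_congr_of_isOpen hI hγσ hs, hσ' s hs] at h1
    exact (eq_inv_smul_iff₀ (norm_ne_zero_iff.2 (hne s hs))).2 h1.symm
  refine ⟨σ '' I, γ, σ, hb, hγ, ?_, ?_, hσ, hh, hreg', rfl, ?_⟩
  · rintro _ ⟨s, hs, rfl⟩
    rw [hγ' s hs, norm_smul, norm_inv, norm_norm, inv_mul_cancel₀ (norm_ne_zero_iff.2 (hne s hs))]
  · rintro _ ⟨s, hs, rfl⟩
    rw [hγ' s hs, real_inner_smul_left, hc'b s hs, mul_zero]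
  · intro p hp
    rw [hX p hp, hγσ _ (mem_fst_image hp)]
    simp only [c]; module

/-! ### Biharmonic developable surfaces are cylinders -/

section Propagation

variable {U : Set (ℝ × ℝ)} {g : ℝ × ℝ → Matrix (Fin 2) (Fin 2) ℝ} {f : ℝ × ℝ → ℝ}
  {X : ℝ × ℝ → E3} {p : ℝ × ℝ} {a e : ℝ → E3}

theorem IsConformalImmersion.mono {V : Set (ℝ × ℝ)} (hX : IsConformalImmersion U g f X)
    (hV : V ⊆ U) : IsConformalImmersion V g f X :=
  ⟨⟨fun i j => (hX.metric.smooth i j).mono hV, fun p hp => hX.metric.posDef p (hV hp)⟩,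
    hX.smooth.mono hV, fun p hp => hX.factor_pos p (hV hp), fun p hp => hX.induced p (hV hp)⟩

namespace IsDevelopableOn

/-- The parameters of rulings containing a point with `τ ≠ 0` form an open set, on which `e' = 0`.
The neighbourhood is the whole part of `U` over an interval, so it contains every point of `U` on
the given ruling. -/
theorem exists_local_cylinder (hU : IsOpen U) (hD : IsDevelopableOn U X a e)
    (hX : IsConformalImmersion U g f X) (hb : IsBiharmonic U g X) (hp : p ∈ U)
    (hτ : tension g X p ≠ 0) :
    ∃ V ⊆ U, IsOpen V ∧ (∀ q ∈ U, q.1 = p.1 → q ∈ V) ∧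
      ∃ J γ σ, IsCylinderOver V X (e p.1) J γ σ (fun s => inner ℝ (a s) (e p.1)) := by
  have hI := isOpen_fst_image hU
  have hW : IsOpen {q ∈ U | tension g X q ≠ 0} :=
    (hX.contDiffOn_tension hU).continuousOn.isOpen_inter_preimage hU isOpen_compl_singleton
  obtain ⟨δ, hδ, hball⟩ := Metric.isOpen_iff.1 (isOpen_fst_image hW) p.1 ⟨p, ⟨hp, hτ⟩, rfl⟩
  have hBI : Metric.ball p.1 δ ⊆ Prod.fst '' U :=
    hball.trans (Set.image_mono fun q hq => hq.1)
  have he' : ∀ s ∈ Metric.ball p.1 δ, deriv e s = 0 := by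
    intro s hs
    obtain ⟨q, ⟨hq, hqτ⟩, rfl⟩ := hball hs
    by_contra hne
    exact hqτ (hD.tension_eq_zero hU hX hb hq hne)
  have he : ∀ s ∈ Metric.ball p.1 δ, e s = e p.1 := fun s hs =>
    Metric.isOpen_ball.is_const_of_deriv_eq_zero (convex_ball _ _).isPreconnected
      ((hD.smooth_dir.mono hBI).differentiableOn (by simp)) (fun x hx => he' x hx) hs
      (Metric.mem_ball_self hδ)
  set V := U ∩ Prod.fst ⁻¹' Metric.ball p.1 δ
  have hV : IsOpen V := hU.inter (Metric.isOpen_ball.preimage continuous_fst)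
  have hVB : Prod.fst '' V = Metric.ball p.1 δ := by
    ext s
    constructor
    · rintro ⟨q, hq, rfl⟩; exact hq.2
    · intro hs
      obtain ⟨q, hq, rfl⟩ := hBI hs
      exact ⟨q, ⟨hq, hs⟩, rfl⟩
  refine ⟨V, Set.inter_subset_left, hV, fun q hq h1 => ⟨hq, ?_⟩, ?_⟩
  · simp [h1, hδ]
  · refine exists_isCylinderOver hV ?_ ?_ (hD.norm_dir _ (mem_fst_image hp)) ?_ ?_
    · rw [hVB]; exact (convex_ball _ _).isPreconnected
    · rw [hVB]; exact hD.smooth_base.mono hBI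
    · intro q hq
      rw [hD.eq_ruled q hq.1, he _ hq.2]
    · exact fun q hq => hX.linearIndependent hq.1

/-- On the local cylinder `τ = f γ''(σ(s))`, so its vanishing is decided by `s` alone, even if the
ruling meets `U` in several segments. -/
theorem tension_ne_zero_of_fst_eq (hU : IsOpen U) (hD : IsDevelopableOn U X a e)
    (hX : IsConformalImmersion U g f X) (hb : IsBiharmonic U g X) (hp : p ∈ U)
    (hτ : tension g X p ≠ 0) {q : ℝ × ℝ} (hq : q ∈ U) (hqp : q.1 = p.1) : tension g X q ≠ 0 := by
  obtain ⟨V, hVU, hV, hmem, J, γ, σ, hC⟩ := hD.exists_local_cylinder hU hX hb hp hτ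
  rw [hC.tension_eq hV (hX.mono hVU) (hmem p hp rfl)] at hτ
  rw [hC.tension_eq hV (hX.mono hVU) (hmem q hq hqp), hqp]
  exact smul_ne_zero (hX.factor_pos q hq).ne' (right_ne_zero_of_smul hτ)

/-- The function `|τ|⁶ / f²` is constant along the orthogonal trajectories of the rulings. -/
theorem first_integral (hU : IsOpen U) (hD : IsDevelopableOn U X a e)
    (hX : IsConformalImmersion U g f X) (hb : IsBiharmonic U g X) (hp : p ∈ U) :
    pd 0 (fun q => inner ℝ (tension g X q) (tension g X q) ^ 3 / f q ^ 2) p =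
      inner ℝ (deriv a p.1) (e p.1) *
        pd 1 (fun q => inner ℝ (tension g X q) (tension g X q) ^ 3 / f q ^ 2) p := by
  by_cases hτ : tension g X p = 0
  -- At a zero of `τ` the factor `|τ|⁶` has vanishing differential, so both sides are 0 and no
  -- cylinder is needed.
  · have dτ := differentiableAt_of_contDiffOn hU (hX.contDiffOn_tension hU) hp
    have df := differentiableAt_of_contDiffOn hU (hX.contDiffOn_factor hU) hp
    have dR : DifferentiableAt ℝ (fun q => inner ℝ (tension g X q) (tension g X q)) p :=
      dτ.inner ℝ dτ
    have h1 : ∀ i, pd i (fun q => inner ℝ (tension g X q) (tension g X q) ^ 3 / f q ^ 2) p = 0 := by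
      intro i
      simp only [div_eq_mul_inv]
      rw [pd_mul (dR.fun_pow 3) ((df.fun_pow 2).fun_inv (pow_ne_zero 2 (hX.factor_pos p hp).ne')),
        pd_comp (c := fun x => x ^ 3) (by fun_prop) dR]
      simp [hτ]
    rw [h1, h1, mul_zero]
  · obtain ⟨V, hVU, hV, hmem, J, γ, σ, hC⟩ := hD.exists_local_cylinder hU hX hb hp hτ
    have hpV := hmem p hp rfl
    have h1 := hC.horiz_first_integral hV (hX.mono hVU) (fun q hq => hb q (hVU hq)) hpV
    have h2 : deriv (fun s => inner ℝ (a s) (e p.1)) p.1 = inner ℝ (deriv a p.1) (e p.1) := by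
      simpa using deriv_inner (isOpen_fst_image hU) hD.smooth_base
        (contDiffOn_const (c := e p.1)) (mem_fst_image hp)
    rw [horiz, smul_eq_zero, h2] at h1
    have h3 := h1.resolve_left (inv_ne_zero (hC.regular_param _ (mem_fst_image hpV)))
    simpa [sub_eq_zero] using h3

/-- The set of parameters whose ruling carries a point with `τ ≠ 0` is open, nonempty and relatively
closed. Closedness comes from transporting `|τ|⁶ / f²` along an orthogonal trajectory of the
rulings. -/
theorem tension_ne_zero (hU : IsOpen U) (hc : IsPreconnected U) (hD : IsDevelopableOn U X a e)
    (hX : IsConformalImmersion U g f X) (hb : IsBiharmonic U g X) (hh : ¬ IsHarmonic U g X)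
    (hp : p ∈ U) : tension g X p ≠ 0 := by
  have hI := isOpen_fst_image hU
  have hIc : IsPreconnected (Prod.fst '' U) := hc.image _ continuous_fst.continuousOn
  have hτ := hX.contDiffOn_tension hU
  have hf := hX.contDiffOn_factor hU
  have hW : IsOpen {q ∈ U | tension g X q ≠ 0} :=
    hτ.continuousOn.isOpen_inter_preimage hU isOpen_compl_singleton
  have hA := isOpen_fst_image hW
  suffices h : Prod.fst '' U ⊆ Prod.fst '' {q ∈ U | tension g X q ≠ 0} by
    obtain ⟨q, ⟨hq, hqτ⟩, hqp⟩ := h (mem_fst_image hp)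
    exact hD.tension_ne_zero_of_fst_eq hU hX hb hq hqτ hp hqp.symm
  refine hIc.subset_of_closure_inter_subset hA ?_ ?_
  · simp only [IsHarmonic, not_forall] at hh
    obtain ⟨q, hq, hqτ⟩ := hh
    exact ⟨q.1, mem_fst_image hq, q, ⟨hq, hqτ⟩, rfl⟩
  rintro _ ⟨hcl, q, hq, rfl⟩
  set Q : ℝ × ℝ → ℝ := fun q => inner ℝ (tension g X q) (tension g X q) ^ 3 / f q ^ 2 with hQ
  have hQs : ContDiffOn ℝ ∞ Q U := ((hτ.inner ℝ hτ).pow 3).div (hf.pow 2)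
    fun q hq => pow_ne_zero 2 (hX.factor_pos q hq).ne'
  have hQ0 : ∀ q ∈ U, Q q ≠ 0 ↔ tension g X q ≠ 0 := by
    intro q hq
    simp [hQ, (hX.factor_pos q hq).ne']
  -- With `H' = ⟨a', e⟩`, the curve `c` through `q` has velocity `∂₀ - ⟨a', e⟩ ∂₁`, along which `Q`
  -- is constant.
  obtain ⟨H, hH, hH'⟩ := exists_smooth_primitive hI hIc
    ((contDiffOn_deriv hI hD.smooth_base).inner ℝ hD.smooth_dir)
  set c : ℝ → ℝ × ℝ := fun s => (s, q.2 - (H s - H q.1)) with hcdef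
  have hcs : ContinuousOn c (Prod.fst '' U) :=
    continuousOn_id.prodMk (continuousOn_const.sub (hH.continuousOn.sub continuousOn_const))
  have hcq : c q.1 = q := by simp [hcdef]
  obtain ⟨δ, hδ, hball⟩ := Metric.isOpen_iff.1 (hcs.isOpen_inter_preimage hI hU) q.1
    ⟨mem_fst_image hq, by rw [Set.mem_preimage, hcq]; exact hq⟩
  have hd : ∀ s ∈ Metric.ball q.1 δ, HasDerivAt (fun s => Q (c s)) 0 s := by
    intro s hs
    obtain ⟨hsI, hsU⟩ := hball hs
    have dc : HasDerivAt c ((1 : ℝ), -(deriv H s)) s := by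
      refine (hasDerivAt_id s).prodMk ?_
      simpa using ((differentiableAt_of_contDiffOn hI hH hsI).hasDerivAt.sub_const
        (H q.1)).const_sub q.2
    have h1 := (differentiableAt_of_contDiffOn hU hQs hsU).hasFDerivAt.comp_hasDerivAt s dc
    have h2 : ((1 : ℝ), -(deriv H s)) = coordVec 0 + (-(deriv H s)) • coordVec 1 := by
      simp [coordVec]
    have h3 : pd 0 Q (c s) = _ := hD.first_integral hU hX hb hsU
    have h4 : fderiv ℝ Q (c s) ((1 : ℝ), -(deriv H s)) = 0 := by
      rw [h2, map_add, map_smul]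
      change pd 0 Q (c s) + (-(deriv H s)) • pd 1 Q (c s) = 0
      rw [h3, hH' s hsI, smul_eq_mul]
      ring
    rw [h4] at h1
    exact h1
  obtain ⟨s, hs, ⟨q', ⟨hq', hqτ'⟩, hqs⟩⟩ :=
    mem_closure_iff.1 hcl _ Metric.isOpen_ball (Metric.mem_ball_self hδ)
  have h4 : Q (c s) = Q (c q.1) := Metric.isOpen_ball.is_const_of_deriv_eq_zero
    (convex_ball _ _).isPreconnected
    (fun x hx => (hd x hx).differentiableAt.differentiableWithinAt) (fun x hx => (hd x hx).deriv) hs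
    (Metric.mem_ball_self hδ)
  -- The trajectory may miss `q'`, but it meets the same ruling, on which `τ` vanishes nowhere.
  have h5 := (hQ0 _ (hball hs).2).2
    (hD.tension_ne_zero_of_fst_eq hU hX hb hq' hqτ' (hball hs).2 (by simp [hcdef, hqs]))
  rw [h4, hcq] at h5
  exact ⟨q, ⟨hq, (hQ0 q hq).1 h5⟩, rfl⟩

/-- A proper biharmonic developable surface is a cylinder over a curve without inflection
points. -/
theorem exists_cylinder (hU : IsOpen U) (hc : IsConnected U) (hD : IsDevelopableOn U X a e)
    (hX : IsConformalImmersion U g f X) (hb : IsBiharmonic U g X) (hh : ¬ IsHarmonic U g X) :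
    ∃ b J γ σ h, IsCylinderOver U X b J γ σ h ∧ ∀ t ∈ J, deriv (deriv γ) t ≠ 0 := by
  have hI := isOpen_fst_image hU
  have hIc : IsPreconnected (Prod.fst '' U) := hc.isPreconnected.image _ continuous_fst.continuousOn
  have hτ := fun p hp => hD.tension_ne_zero hU hc.isPreconnected hX hb hh (p := p) hp
  obtain ⟨p₀, hp₀⟩ := hc.nonempty
  have he' : ∀ s ∈ Prod.fst '' U, deriv e s = 0 := by
    rintro _ ⟨p, hp, rfl⟩
    by_contra hne
    exact hτ p hp (hD.tension_eq_zero hU hX hb hp hne)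
  have he : ∀ s ∈ Prod.fst '' U, e s = e p₀.1 := fun s hs =>
    hI.is_const_of_deriv_eq_zero hIc (hD.smooth_dir.differentiableOn (by simp))
      (fun x hx => he' x hx) hs (mem_fst_image hp₀)
  obtain ⟨J, γ, σ, hC⟩ := exists_isCylinderOver hU hIc hD.smooth_base
    (hD.norm_dir _ (mem_fst_image hp₀))
    (fun p hp => by rw [hD.eq_ruled p hp, he _ (mem_fst_image hp)])
    fun p hp => hX.linearIndependent hp
  refine ⟨e p₀.1, J, γ, σ, _, hC, ?_⟩
  rw [← hC.image_param]
  rintro _ ⟨_, ⟨p, hp, rfl⟩, rfl⟩ h0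
  refine hτ p hp ?_
  rw [hC.tension_eq hU hX hp, h0, smul_zero]

end IsDevelopableOn

end Propagation

/-! ### Linear equations of second order with constant coefficients -/

/-- `c` and `s`, with derivatives `c'` and `s'`, are solutions of `y'' = K y` with Wronskian 1. -/
structure IsFundamentalPair (K : ℝ) (c c' s s' : ℝ → ℝ) : Prop where
  deriv_fst : ∀ t, HasDerivAt c (c' t) t
  deriv_fst' : ∀ t, HasDerivAt c' (K * c t) t
  deriv_snd : ∀ t, HasDerivAt s (s' t) t
  deriv_snd' : ∀ t, HasDerivAt s' (K * s t) t
  wronskian : ∀ t, c t * s' t - c' t * s t = 1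

theorem IsFundamentalPair.congr {K K' : ℝ} {c c' s s' : ℝ → ℝ}
    (hF : IsFundamentalPair K c c' s s') (h : K' = K) : IsFundamentalPair K' c c' s s' := h ▸ hF

theorem hasDerivAt_const_mul_id (ν t : ℝ) : HasDerivAt (fun t => ν * t) ν t := by
  simpa using (hasDerivAt_id t).const_mul ν

theorem hasDerivAt_cos_mul (ν t : ℝ) :
    HasDerivAt (fun t => Real.cos (ν * t)) (-(ν * Real.sin (ν * t))) t := by
  exact ((hasDerivAt_const_mul_id ν t).cos).congr_deriv (by ring)

theorem hasDerivAt_sin_mul (ν t : ℝ) :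
    HasDerivAt (fun t => Real.sin (ν * t)) (ν * Real.cos (ν * t)) t := by
  exact ((hasDerivAt_const_mul_id ν t).sin).congr_deriv (by ring)

theorem hasDerivAt_exp_mul (ν t : ℝ) :
    HasDerivAt (fun t => Real.exp (ν * t)) (ν * Real.exp (ν * t)) t := by
  exact ((hasDerivAt_const_mul_id ν t).exp).congr_deriv (by ring)

theorem hasDerivAt_exp_neg_mul (ν t : ℝ) :
    HasDerivAt (fun t => Real.exp (-(ν * t))) (-(ν * Real.exp (-(ν * t)))) t := by
  exact ((hasDerivAt_const_mul_id ν t).fun_neg.exp).congr_deriv (by ring)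

theorem isFundamentalPair_trig {ν : ℝ} (hν : ν ≠ 0) :
    IsFundamentalPair (-ν ^ 2) (fun t => Real.cos (ν * t)) (fun t => -(ν * Real.sin (ν * t)))
      (fun t => ν⁻¹ * Real.sin (ν * t)) (fun t => Real.cos (ν * t)) where
  deriv_fst := hasDerivAt_cos_mul ν
  deriv_fst' t := by
    exact (((hasDerivAt_sin_mul ν t).const_mul ν).fun_neg).congr_deriv (by ring)
  deriv_snd t := by
    exact ((hasDerivAt_sin_mul ν t).const_mul ν⁻¹).congr_deriv (by field_simp)
  deriv_snd' t := by
    exact (hasDerivAt_cos_mul ν t).congr_deriv (by field_simp)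
  wronskian t := by
    field_simp
    linear_combination Real.sin_sq_add_cos_sq (ν * t)

theorem isFundamentalPair_exp {ν : ℝ} (hν : ν ≠ 0) :
    IsFundamentalPair (ν ^ 2) (fun t => Real.exp (ν * t)) (fun t => ν * Real.exp (ν * t))
      (fun t => -(2 * ν)⁻¹ * Real.exp (-(ν * t))) (fun t => 1 / 2 * Real.exp (-(ν * t))) where
  deriv_fst := hasDerivAt_exp_mul ν
  deriv_fst' t := by
    exact ((hasDerivAt_exp_mul ν t).const_mul ν).congr_deriv (by ring)
  deriv_snd t := by
    exact ((hasDerivAt_exp_neg_mul ν t).const_mul (-(2 * ν)⁻¹)).congr_deriv (by field_simp)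
  deriv_snd' t := by
    exact ((hasDerivAt_exp_neg_mul ν t).const_mul (1 / 2)).congr_deriv (by field_simp)
  wronskian t := by
    have : Real.exp (ν * t) * Real.exp (-(ν * t)) = 1 := by rw [← Real.exp_add]; simp
    field_simp
    linear_combination 2 * this

theorem isFundamentalPair_linear :
    IsFundamentalPair 0 (fun _ => 1) (fun _ => 0) (fun t => t) (fun _ => 1) where
  deriv_fst t := hasDerivAt_const t 1
  deriv_fst' t := by simpa using hasDerivAt_const t (0 : ℝ)
  deriv_snd t := hasDerivAt_id t
  deriv_snd' t := by simpa using hasDerivAt_const t (1 : ℝ)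
  wronskian t := by simp

theorem eq_of_hasDerivAt_zero {J : Set ℝ} (hJ : IsOpen J) (hc : IsPreconnected J) {y : ℝ → ℝ}
    (h : ∀ t ∈ J, HasDerivAt y 0 t) {t t' : ℝ} (ht : t ∈ J) (ht' : t' ∈ J) : y t = y t' :=
  hJ.is_const_of_deriv_eq_zero hc (fun x hx => (h x hx).differentiableAt.differentiableWithinAt)
    (fun x hx => (h x hx).deriv) ht ht'

/-- Variation of constants: the Wronskians of `y` with `s` and with `c` are constant, and since that
of the pair is 1 they are the coefficients, up to sign. -/
theorem IsFundamentalPair.exists_eq {K : ℝ} {c c' s s' : ℝ → ℝ}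
    (hF : IsFundamentalPair K c c' s s') {J : Set ℝ} (hJ : IsOpen J) (hc : IsPreconnected J)
    {y y' : ℝ → ℝ} (hy : ∀ t ∈ J, HasDerivAt y (y' t) t)
    (hy' : ∀ t ∈ J, HasDerivAt y' (K * y t) t) :
    ∃ α β : ℝ, ∀ t ∈ J, y t = α * c t + β * s t ∧ y' t = α * c' t + β * s' t := by
  rcases J.eq_empty_or_nonempty with rfl | ⟨t₀, ht₀⟩
  · exact ⟨0, 0, by simp⟩
  have hα : ∀ t ∈ J, HasDerivAt (fun t => y t * s' t - y' t * s t) 0 t := fun t ht => by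
    exact (((hy t ht).fun_mul (hF.deriv_snd' t)).fun_sub
      ((hy' t ht).fun_mul (hF.deriv_snd t))).congr_deriv (by ring)
  have hβ : ∀ t ∈ J, HasDerivAt (fun t => y' t * c t - y t * c' t) 0 t := fun t ht => by
    exact (((hy' t ht).fun_mul (hF.deriv_fst t)).fun_sub
      ((hy t ht).fun_mul (hF.deriv_fst' t))).congr_deriv (by ring)
  refine ⟨y t₀ * s' t₀ - y' t₀ * s t₀, y' t₀ * c t₀ - y t₀ * c' t₀, fun t ht => ?_⟩
  have h1 := eq_of_hasDerivAt_zero hJ hc hα ht₀ ht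
  have h2 := eq_of_hasDerivAt_zero hJ hc hβ ht₀ ht
  have h3 := hF.wronskian t
  beta_reduce at h1 h2
  rw [h1, h2]
  constructor
  · linear_combination -y t * h3
  · linear_combination -y' t * h3

/-! ### The curvature of the directrix -/

/-- The reciprocal `z = 1/k` turns the equation into `4Kz² = 4 - 2zz'' + z'²`, whose derivative is
linear in `z` up to a factor `z`. -/
theorem ermakov_of_eq_one_div {J : Set ℝ} (hJ : IsOpen J) {k z z₁ z₂ : ℝ → ℝ}
    (hz : ∀ t ∈ J, HasDerivAt z (z₁ t) t) (hz₁ : ∀ t ∈ J, HasDerivAt z₁ (z₂ t) t)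
    (h0 : ∀ t ∈ J, z t ≠ 0) (hk : ∀ t ∈ J, k t = 1 / z t) {t : ℝ} (ht : t ∈ J) :
    ermakov k t = (4 - 2 * z t * z₂ t + z₁ t ^ 2) / (4 * z t ^ 2) := by
  have h1 : ∀ t ∈ J, deriv k t = -z₁ t / z t ^ 2 := by
    intro t ht
    rw [deriv_congr_of_isOpen hJ (y := fun t => (z t)⁻¹) (fun t ht => by rw [hk t ht, one_div]) ht]
    exact ((hz t ht).fun_inv (h0 t ht)).deriv
  have h2 : deriv (deriv k) t = (-z₂ t * z t ^ 2 - -z₁ t * (2 * z t * z₁ t)) / (z t ^ 2) ^ 2 := by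
    rw [deriv_congr_of_isOpen hJ h1 ht]
    have := ((hz₁ t ht).fun_neg.fun_div ((hz t ht).fun_pow 2) (pow_ne_zero 2 (h0 t ht))).deriv
    rw [this]; simp
  have := h0 t ht
  rw [ermakov, h2, h1 t ht, hk t ht]
  field_simp
  ring

theorem IsKappaN.pos_and_ermakov {K : ℝ} {J : Set ℝ} {k : ℝ → ℝ} (hJ : IsOpen J)
    (hk : IsKappaN K J k) : ∀ t ∈ J, 0 < k t ∧ ermakov k t = K := by
  rcases hk with ⟨hK, C₁, C₂, ε, h1, h2, hε, hD, hk⟩ | ⟨rfl, C₃, C₄, h3, hk⟩ | ⟨hK, C₄, C₅, hk⟩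
  · set ν := 2 * √(-K) with hν
    have hν2 : ν ^ 2 = -(4 * K) := by
      rw [hν, mul_pow, Real.sq_sqrt (by linarith)]; ring
    set d := ε * √(4 * C₁ * C₂ + 1 / K) with hd
    have hd2 : d ^ 2 = 4 * C₁ * C₂ + 1 / K := by
      rw [hd, mul_pow, Real.sq_sqrt hD]
      rcases hε with rfl | rfl <;> ring
    have hKi : K * (1 / K) = 1 := mul_one_div_cancel hK.ne
    have hKn : 1 / K < 0 := one_div_neg.2 hK
    have hexp : ∀ t, Real.exp (ν * t) * Real.exp (-(ν * t)) = 1 := fun t => by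
      rw [← Real.exp_add]; simp
    have hpos : ∀ t, 0 < C₁ * Real.exp (ν * t) + C₂ * Real.exp (-(ν * t)) + d := by
      intro t
      have hP : 0 < C₁ * Real.exp (ν * t) := by positivity
      have hQ : 0 < C₂ * Real.exp (-(ν * t)) := by positivity
      have hPQ : (C₁ * Real.exp (ν * t)) * (C₂ * Real.exp (-(ν * t))) = C₁ * C₂ := by
        linear_combination C₁ * C₂ * hexp t
      -- Arithmetic-geometric mean: the square on the right is at least `4 C₁ C₂`, which exceeds
      -- `d²` because `1 / K < 0`. So the denominator is positive for either sign of the root.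
      have h5 : d ^ 2 < (C₁ * Real.exp (ν * t) + C₂ * Real.exp (-(ν * t))) ^ 2 := by
        nlinarith [sq_nonneg (C₁ * Real.exp (ν * t) - C₂ * Real.exp (-(ν * t)))]
      have h6 := abs_lt_of_sq_lt_sq h5 (by positivity)
      linarith [(abs_lt.1 (by simpa using h6)).1]
    intro t ht
    refine ⟨by rw [hk t ht]; exact one_div_pos.2 (hpos t), ?_⟩
    rw [ermakov_of_eq_one_div hJ
      (z := fun t => C₁ * Real.exp (ν * t) + C₂ * Real.exp (-(ν * t)) + d)
      (z₁ := fun t => C₁ * (ν * Real.exp (ν * t)) + C₂ * (-(ν * Real.exp (-(ν * t)))))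
      (z₂ := fun t => C₁ * (ν * (ν * Real.exp (ν * t)))
        + C₂ * (-(ν * -(ν * Real.exp (-(ν * t))))))
      (fun t _ => (((hasDerivAt_exp_mul ν t).const_mul C₁).fun_add
        ((hasDerivAt_exp_neg_mul ν t).const_mul C₂)).add_const d)
      (fun t _ => (((hasDerivAt_exp_mul ν t).const_mul ν).const_mul C₁).fun_add
        (((hasDerivAt_exp_neg_mul ν t).const_mul ν).fun_neg.const_mul C₂))
      (fun t _ => (hpos t).ne') hk ht, div_eq_iff (by have := (hpos t).ne'; positivity)]
    have := hexp t
    set P := Real.exp (ν * t)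
    set Q := Real.exp (-(ν * t))
    linear_combination ((C₁ * P - C₂ * Q) ^ 2 - 2 * (C₁ * P + C₂ * Q + d) * (C₁ * P + C₂ * Q)) * hν2
      - 4 * K * hd2 + 16 * K * C₁ * C₂ * this - 4 * hKi
  · have hpos : ∀ t, 0 < (16 + C₃ ^ 2 * (t + C₄) ^ 2) / (4 * C₃) := fun t => by positivity
    have hd : ∀ t, HasDerivAt (fun t => (16 + C₃ ^ 2 * (t + C₄) ^ 2) / (4 * C₃))
        (C₃ * (t + C₄) / 2) t := by
      intro t
      have := ((((((hasDerivAt_id t).add_const C₄).fun_pow 2).const_mul (C₃ ^ 2)).const_add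
        16).div_const (4 * C₃))
      exact this.congr_deriv (by simp; field_simp; ring)
    have hd' : ∀ t, HasDerivAt (fun t => C₃ * (t + C₄) / 2) (C₃ / 2) t := by
      intro t
      have := ((((hasDerivAt_id t).add_const C₄).const_mul C₃).div_const 2)
      simpa using this
    have hk' : ∀ t ∈ J, k t = 1 / ((16 + C₃ ^ 2 * (t + C₄) ^ 2) / (4 * C₃)) :=
      fun t ht => by rw [hk t ht, one_div_div]
    intro t ht
    refine ⟨by rw [hk' t ht]; exact one_div_pos.2 (hpos t), ?_⟩
    rw [ermakov_of_eq_one_div hJ (fun t _ => hd t) (fun t _ => hd' t)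
      (fun t _ => (hpos t).ne') hk' ht, div_eq_zero_iff]
    left
    field_simp
    ring
  · set ν := 2 * √K with hν
    have hν2 : ν ^ 2 = 4 * K := by
      rw [hν, mul_pow, Real.sq_sqrt hK.le]; ring
    have hKi : K * (1 / K) = 1 := mul_one_div_cancel hK.ne'
    have hKn : 0 < 1 / K := one_div_pos.2 hK
    set d := √(1 / K + (C₄ ^ 2 + C₅ ^ 2)) with hd
    have hd2 : d ^ 2 = 1 / K + (C₄ ^ 2 + C₅ ^ 2) := Real.sq_sqrt (by positivity)
    have hd0 : 0 ≤ d := Real.sqrt_nonneg _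
    have hpos : ∀ t, 0 < C₄ * Real.cos (ν * t) + C₅ * Real.sin (ν * t) + d := by
      intro t
      -- Cauchy-Schwarz bounds the left side by `C₄² + C₅²`, which is `d² - 1 / K`.
      have h5 : (C₄ * Real.cos (ν * t) + C₅ * Real.sin (ν * t)) ^ 2 < d ^ 2 := by
        nlinarith [Real.sin_sq_add_cos_sq (ν * t),
          sq_nonneg (C₄ * Real.sin (ν * t) - C₅ * Real.cos (ν * t))]
      linarith [(abs_lt.1 (abs_lt_of_sq_lt_sq h5 hd0)).1]
    intro t ht
    refine ⟨by rw [hk t ht]; exact one_div_pos.2 (hpos t), ?_⟩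
    rw [ermakov_of_eq_one_div hJ (z := fun t => C₄ * Real.cos (ν * t) + C₅ * Real.sin (ν * t) + d)
      (z₁ := fun t => C₄ * (-(ν * Real.sin (ν * t))) + C₅ * (ν * Real.cos (ν * t)))
      (z₂ := fun t => C₄ * (-(ν * (ν * Real.cos (ν * t)))) + C₅ * (ν * (-(ν * Real.sin (ν * t)))))
      (fun t _ => (((hasDerivAt_cos_mul ν t).const_mul C₄).fun_add
        ((hasDerivAt_sin_mul ν t).const_mul C₅)).add_const d)
      (fun t _ => (((hasDerivAt_sin_mul ν t).const_mul ν).fun_neg.const_mul C₄).fun_add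
        (((hasDerivAt_cos_mul ν t).const_mul ν).const_mul C₅))
      (fun t _ => (hpos t).ne') hk ht, div_eq_iff (by have := (hpos t).ne'; positivity)]
    have := Real.sin_sq_add_cos_sq (ν * t)
    set P := Real.cos (ν * t)
    set Q := Real.sin (ν * t)
    linear_combination (2 * (C₄ * P + C₅ * Q + d) * (C₄ * P + C₅ * Q)
      + (C₄ * Q - C₅ * P) ^ 2) * hν2
      - 4 * K * hd2 + 4 * K * (C₄ ^ 2 + C₅ ^ 2) * this - 4 * hKi

/-- For `z = 1/k` there are the first integrals `z'' + 4Kz = m` and `z'² = 2mz - 4 - 4Kz²`. The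
first makes `z - m/(4K)` a solution of a homogeneous linear equation if `K ≠ 0`. The second ties `m`
to the two remaining constants and produces the square roots in `κ_N`. -/
theorem isKappaN_of_ermakov {K : ℝ} {J : Set ℝ} {k : ℝ → ℝ} (hJ : IsOpen J)
    (hc : IsConnected J) (hks : ContDiffOn ℝ ∞ k J) (hpos : ∀ t ∈ J, 0 < k t)
    (hk : ∀ t ∈ J, ermakov k t = K) : IsKappaN K J k := by
  have D : ∀ {u : ℝ → ℝ}, ContDiffOn ℝ ∞ u J → ∀ t ∈ J, HasDerivAt u (deriv u t) t :=
    fun hu t ht => (differentiableAt_of_contDiffOn hJ hu ht).hasDerivAt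
  have hz : ContDiffOn ℝ ∞ (fun t => (k t)⁻¹) J := hks.inv fun t ht => (hpos t ht).ne'
  set z : ℝ → ℝ := fun t => (k t)⁻¹ with hzdef
  have hz0 : ∀ t ∈ J, 0 < z t := fun t ht => inv_pos.2 (hpos t ht)
  have hz1 := contDiffOn_deriv hJ hz
  have hz2 := contDiffOn_deriv hJ hz1
  set z₁ := deriv z
  set z₂ := deriv z₁
  have hkz : ∀ t ∈ J, k t = 1 / z t := fun t _ => by simp [hzdef]
  have h1 : ∀ t ∈ J, 4 * K * z t ^ 2 = 4 - 2 * z t * z₂ t + z₁ t ^ 2 := by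
    intro t ht
    have := ermakov_of_eq_one_div hJ (D hz) (D hz1) (fun t ht => (hz0 t ht).ne') hkz ht
    rw [hk t ht, eq_div_iff (by have := (hz0 t ht).ne'; positivity)] at this
    linear_combination this
  have h3 : ∀ t ∈ J, deriv z₂ t = -(4 * K * z₁ t) := by
    intro t ht
    have e1 : HasDerivAt (fun t => 4 * K * z t ^ 2) _ t := ((D hz t ht).fun_pow 2).const_mul (4 * K)
    have e2 : HasDerivAt (fun t => 4 - 2 * z t * z₂ t + z₁ t ^ 2) _ t :=
      ((((D hz t ht).const_mul 2).fun_mul (D hz2 t ht)).const_sub 4).fun_add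
        ((D hz1 t ht).fun_pow 2)
    have e3 := deriv_congr_of_isOpen hJ h1 ht
    rw [e1.deriv, e2.deriv] at e3
    simp only [Nat.cast_ofNat, Nat.add_one_sub_one, pow_one] at e3
    have e4 : z t * (deriv z₂ t + 4 * K * z₁ t) = 0 := by
      change _ = -(2 * z₁ t * z₂ t + 2 * z t * deriv z₂ t) + 2 * z₁ t * z₂ t at e3
      change 4 * K * (2 * z t * z₁ t) = _ at e3
      linear_combination e3 / 2
    have e5 := (mul_eq_zero.1 e4).resolve_left (hz0 t ht).ne'
    linarith
  obtain ⟨t₀, ht₀⟩ := hc.nonempty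
  obtain ⟨m, hm⟩ : ∃ m, ∀ t ∈ J, z₂ t + 4 * K * z t = m := by
    refine ⟨z₂ t₀ + 4 * K * z t₀, fun t ht => eq_of_hasDerivAt_zero hJ hc.isPreconnected
      (y := fun t => z₂ t + 4 * K * z t) (fun t ht => ?_) ht ht₀⟩
    exact ((D hz2 t ht).fun_add ((D hz t ht).const_mul (4 * K))).congr_deriv
      (by rw [h3 t ht]; change _ + 4 * K * z₁ t = 0; ring)
  have h4 : ∀ t ∈ J, z₁ t ^ 2 = 2 * m * z t - 4 - 4 * K * z t ^ 2 := by
    intro t ht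
    rw [← hm t ht]
    linear_combination -h1 t ht
  have hz2m : ∀ t ∈ J, z₂ t = m - 4 * K * z t := fun t ht => by rw [← hm t ht]; ring
  have hm0 : 0 ≤ K → 0 < m := by
    intro hK
    have e1 := h4 t₀ ht₀
    have e2 := hz0 t₀ ht₀
    by_contra! hm'
    nlinarith [sq_nonneg (z₁ t₀), mul_nonneg hK (sq_nonneg (z t₀)),
      mul_nonneg (neg_nonneg.2 hm') e2.le]
  rcases lt_trichotomy K 0 with hK | hK | hK
  · left
    refine ⟨hK, ?_⟩
    set ν := 2 * √(-K) with hν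
    have hν2 : ν ^ 2 = -(4 * K) := by
      rw [hν, mul_pow, Real.sq_sqrt (by linarith)]; ring
    have hν0 : 0 < ν := by have := Real.sqrt_pos.2 (neg_pos.2 hK); positivity
    set d := m / (4 * K) with hd
    have hdm : 4 * K * d = m := by rw [hd, mul_div_cancel₀ m (by linarith)]
    obtain ⟨α, β, hαβ⟩ := (isFundamentalPair_exp hν0.ne').exists_eq hJ hc.isPreconnected
      (y := fun t => z t - d) (fun t ht => (D hz t ht).sub_const d)
      (fun t ht => (D hz1 t ht).congr_deriv (by
        change z₂ t = _
        rw [hz2m t ht]; linear_combination -(z t - d) * hν2 - hdm))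
    have hKi : K * (1 / K) = 1 := mul_one_div_cancel hK.ne
    have hexp : ∀ t, Real.exp (ν * t) * Real.exp (-(ν * t)) = 1 := fun t => by
      rw [← Real.exp_add]; simp
    set C₂ := β * -(2 * ν)⁻¹ with hC₂
    have hβ : β = -(2 * ν) * C₂ := by rw [hC₂]; field_simp
    have hz' : ∀ t ∈ J, z t = α * Real.exp (ν * t) + C₂ * Real.exp (-(ν * t)) + d := by
      intro t ht
      linear_combination (hαβ t ht).1
    have hz1' : ∀ t ∈ J, z₁ t = ν * (α * Real.exp (ν * t) - C₂ * Real.exp (-(ν * t))) := by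
      intro t ht
      have := (hαβ t ht).2
      rw [hβ] at this
      linear_combination this
    -- The quadratic first integral, evaluated at one point.
    have hD : 4 * α * C₂ + 1 / K = d ^ 2 := by
      have e1 := h4 t₀ ht₀
      rw [hz1' t₀ ht₀, hz' t₀ ht₀, ← hdm] at e1
      have e2 : K * (4 * α * C₂ + 1 / K - d ^ 2) = 0 := by
        set P := Real.exp (ν * t₀)
        set Q := Real.exp (-(ν * t₀))
        linear_combination e1 / 4 - (α * P - C₂ * Q) ^ 2 / 4 * hν2 - 4 * K * α * C₂ * hexp t₀ + hKi
      linarith [(mul_eq_zero.1 e2).resolve_left hK.ne]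
    have hKn : 1 / K < 0 := one_div_neg.2 hK
    have hprod : 0 < α * C₂ := by nlinarith [sq_nonneg d]
    have hα : 0 < α := by
      by_contra! hα
      have hα' : α < 0 := lt_of_le_of_ne hα (by rintro rfl; simp at hprod)
      have hC : C₂ < 0 := by
        by_contra! hC
        nlinarith
      have hP : 0 < -α * Real.exp (ν * t₀) := mul_pos (by linarith) (Real.exp_pos _)
      have hQ : 0 < -C₂ * Real.exp (-(ν * t₀)) := mul_pos (by linarith) (Real.exp_pos _)
      have e1 := hz0 t₀ ht₀
      rw [hz' t₀ ht₀] at e1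
      have hPQ : (-α * Real.exp (ν * t₀)) * (-C₂ * Real.exp (-(ν * t₀))) = α * C₂ := by
        linear_combination α * C₂ * hexp t₀
      -- If both coefficients were negative, `z > 0` would require `d` to exceed the sum of the two
      -- positive exponential terms, contrary to `d² < 4 α C₂`.
      have e2 : d ^ 2 < (-α * Real.exp (ν * t₀) + -C₂ * Real.exp (-(ν * t₀))) ^ 2 := by
        nlinarith [sq_nonneg (-α * Real.exp (ν * t₀) - -C₂ * Real.exp (-(ν * t₀)))]
      have e3 := (abs_lt.1 (abs_lt_of_sq_lt_sq e2 (by linarith))).2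
      linarith
    have hC : 0 < C₂ := pos_of_mul_pos_right hprod hα.le
    -- The sign in front of the root in `κ_N` is the sign of `d`.
    rcases le_total 0 d with h | h
    · refine ⟨α, C₂, 1, hα, hC, Or.inl rfl, by rw [hD]; positivity, fun t ht => ?_⟩
      rw [hkz t ht, hz' t ht, hD, Real.sqrt_sq h, one_mul]
    · refine ⟨α, C₂, -1, hα, hC, Or.inr rfl, by rw [hD]; positivity, fun t ht => ?_⟩
      rw [hkz t ht, hz' t ht, hD, Real.sqrt_sq_eq_abs, abs_of_nonpos h]
      simp
  · right; left
    refine ⟨hK, ?_⟩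
    have hm1 := hm0 hK.ge
    subst hK
    obtain ⟨n, hn⟩ : ∃ n, ∀ t ∈ J, z₁ t - m * t = n := by
      refine ⟨z₁ t₀ - m * t₀, fun t ht => eq_of_hasDerivAt_zero hJ hc.isPreconnected
        (y := fun t => z₁ t - m * t) (fun t ht => ?_) ht ht₀⟩
      refine ((D hz1 t ht).fun_sub (hasDerivAt_const_mul_id m t)).congr_deriv ?_
      change z₂ t - m = 0
      rw [hz2m t ht]; ring
    -- For `K = 0` one has `z' = m t + n` and `2mz = 4 + z'²`; comparison with `κ_N` gives `C₃ = 2m`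
    -- and `C₄ = n/m`.
    refine ⟨2 * m, n / m, by positivity, fun t ht => ?_⟩
    have e1 := h4 t ht
    have e2 : z₁ t = m * t + n := by rw [← hn t ht]; ring
    have e3 : z t = (16 + (2 * m) ^ 2 * (t + n / m) ^ 2) / (4 * (2 * m)) := by
      rw [e2] at e1
      field_simp
      linear_combination -4 * e1
    rw [hkz t ht, e3, one_div_div]
  · right; right
    refine ⟨hK, ?_⟩
    have hm1 := hm0 hK.le
    set ν := 2 * √K with hν
    have hν2 : ν ^ 2 = 4 * K := by
      rw [hν, mul_pow, Real.sq_sqrt hK.le]; ring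
    have hν0 : 0 < ν := by have := Real.sqrt_pos.2 hK; positivity
    set d := m / (4 * K) with hd
    have hdm : 4 * K * d = m := by rw [hd]; field_simp
    have hd0 : 0 ≤ d := by positivity
    obtain ⟨α, β, hαβ⟩ := (isFundamentalPair_trig hν0.ne').exists_eq hJ hc.isPreconnected
      (y := fun t => z t - d) (fun t ht => (D hz t ht).sub_const d)
      (fun t ht => (D hz1 t ht).congr_deriv (by
        change z₂ t = _
        rw [hz2m t ht]; linear_combination (z t - d) * hν2 - hdm))
    have hKi : K * (1 / K) = 1 := mul_one_div_cancel hK.ne'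
    set C := β * ν⁻¹ with hC
    have hβ : β = ν * C := by rw [hC]; field_simp
    have hz' : ∀ t ∈ J, z t = α * Real.cos (ν * t) + C * Real.sin (ν * t) + d := by
      intro t ht
      linear_combination (hαβ t ht).1
    have hz1' : ∀ t ∈ J, z₁ t = ν * (C * Real.cos (ν * t) - α * Real.sin (ν * t)) := by
      intro t ht
      have := (hαβ t ht).2
      rw [hβ] at this
      linear_combination this
    have hD : 1 / K + (α ^ 2 + C ^ 2) = d ^ 2 := by
      have e1 := h4 t₀ ht₀
      rw [hz1' t₀ ht₀, hz' t₀ ht₀, ← hdm] at e1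
      have e2 : K * (1 / K + (α ^ 2 + C ^ 2) - d ^ 2) = 0 := by
        have := Real.sin_sq_add_cos_sq (ν * t₀)
        set P := Real.cos (ν * t₀)
        set Q := Real.sin (ν * t₀)
        linear_combination e1 / 4 - (C * P - α * Q) ^ 2 / 4 * hν2
          - K * (α ^ 2 + C ^ 2) * this + hKi
      linarith [(mul_eq_zero.1 e2).resolve_left hK.ne']
    refine ⟨α, C, fun t ht => ?_⟩
    rw [hkz t ht, hz' t ht, hD, Real.sqrt_sq hd0]

/-! ### The conformal factor -/

theorem IsPsi.exists_deriv {K : ℝ} {ψ : ℝ → ℝ} (hψ : IsPsi K ψ) :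
    ∃ ψ' : ℝ → ℝ, (∀ w, HasDerivAt ψ (ψ' w) w) ∧ ∀ w, HasDerivAt ψ' (K * ψ w) w := by
  have key : ∀ {c c' s s' : ℝ → ℝ} (_ : IsFundamentalPair K c c' s s') (α β : ℝ),
      (∀ w, ψ w = α * c w + β * s w) →
      ∃ ψ' : ℝ → ℝ, (∀ w, HasDerivAt ψ (ψ' w) w) ∧ ∀ w, HasDerivAt ψ' (K * ψ w) w := by
    intro c c' s s' hF α β h
    obtain rfl : ψ = fun w => α * c w + β * s w := funext h
    refine ⟨fun w => α * c' w + β * s' w, fun w => ?_, fun w => ?_⟩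
    · exact ((hF.deriv_fst w).const_mul α).fun_add ((hF.deriv_snd w).const_mul β)
    · exact (((hF.deriv_fst' w).const_mul α).fun_add ((hF.deriv_snd' w).const_mul β)).congr_deriv
        (by ring)
  rcases hψ with ⟨hK, d₅, d₆, h⟩ | ⟨rfl, d₃, d₄, h⟩ | ⟨hK, d₁, d₂, h⟩
  · have h0 := (Real.sqrt_pos.2 (neg_pos.2 hK)).ne'
    have h2 : K = -√(-K) ^ 2 := by rw [Real.sq_sqrt (by linarith)]; ring
    refine key ((isFundamentalPair_trig h0).congr h2) d₆ (√(-K) * d₅) fun w => ?_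
    rw [h]; field_simp; ring
  · exact key isFundamentalPair_linear d₄ d₃ fun w => by rw [h]; ring
  · have h0 := (Real.sqrt_pos.2 hK).ne'
    have h2 : K = √K ^ 2 := (Real.sq_sqrt hK.le).symm
    refine key ((isFundamentalPair_exp h0).congr h2) d₁ (-(2 * √K) * d₂) fun w => ?_
    rw [h]; field_simp

theorem IsPsi.contDiff {K : ℝ} {ψ : ℝ → ℝ} (hψ : IsPsi K ψ) : ContDiff ℝ ∞ ψ := by
  rcases hψ with ⟨-, d₅, d₆, h⟩ | ⟨-, d₃, d₄, h⟩ | ⟨-, d₁, d₂, h⟩ <;> rw [funext h] <;> fun_prop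

namespace IsCylinderOver

variable {U : Set (ℝ × ℝ)} {g : ℝ × ℝ → Matrix (Fin 2) (Fin 2) ℝ} {f : ℝ × ℝ → ℝ}
  {X : ℝ × ℝ → E3} {p : ℝ × ℝ} {b : E3} {J : Set ℝ} {γ : ℝ → E3} {σ h : ℝ → ℝ}

theorem frame_comp_height (hU : IsOpen U) (hC : IsCylinderOver U X b J γ σ h) {c : ℝ → ℝ} {y : ℝ}
    (hp : p ∈ U) (hc : HasDerivAt c y (p.2 + h p.1)) :
    horiz σ h (fun q => c (q.2 + h q.1)) p = 0 ∧ pd 1 (fun q => c (q.2 + h q.1)) p = y := by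
  have dw := differentiableAt_of_contDiffOn hU hC.contDiffOn_height hp
  have h1 := hC.frame_height hU hp
  constructor
  · rw [ConformalSurface.horiz_comp (k := fun q : ℝ × ℝ => q.2 + h q.1) hc.differentiableAt dw,
      h1.1, zero_smul]
  · rw [pd_comp (k := fun q : ℝ × ℝ => q.2 + h q.1) hc.differentiableAt dw, h1.2, hc.deriv,
      one_smul]

theorem eq_of_frame_eq_zero (hU : IsOpen U) (hc : IsPreconnected U)
    (hC : IsCylinderOver U X b J γ σ h) {u : ℝ × ℝ → ℝ} (hu : ∀ q ∈ U, DifferentiableAt ℝ u q)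
    (h0 : ∀ q ∈ U, horiz σ h u q = 0) (h1 : ∀ q ∈ U, pd 1 u q = 0) {q : ℝ × ℝ} (hp : p ∈ U)
    (hq : q ∈ U) : u p = u q := by
  refine hU.is_const_of_fderiv_eq_zero hc (fun x hx => (hu x hx).differentiableWithinAt)
    (fun x hx => fderiv_eq_zero_of_pd ?_ (h1 x hx)) hp hq
  have := h0 x hx
  rw [horiz, h1 x hx, smul_zero, sub_zero] at this
  exact (smul_eq_zero.1 this).resolve_left (inv_ne_zero (hC.regular_param _ (mem_fst_image hx)))

/-- A function killed by `horiz` is only locally a function of the height, as level sets of the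
height in `U` may be disconnected. The Wronskians of `G` with a fundamental pair have zero
differential, hence are constant on the connected set `U`, and this yields one global `ψ`. -/
theorem exists_psi (hU : IsOpen U) (hc : IsPreconnected U) (hC : IsCylinderOver U X b J γ σ h)
    {K : ℝ} {G : ℝ × ℝ → ℝ} (hG : ContDiffOn ℝ ∞ G U) (h0 : ∀ q ∈ U, horiz σ h G q = 0)
    (h1 : ∀ q ∈ U, pd 1 (pd 1 G) q = K * G q) :
    ∃ ψ, IsPsi K ψ ∧ ∀ p ∈ U, G p = ψ (p.2 + h p.1) := by
  have key : ∀ {c c' s s' : ℝ → ℝ} (_ : IsFundamentalPair K c c' s s'),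
      ∃ α β : ℝ, ∀ p ∈ U, G p = α * c (p.2 + h p.1) + β * s (p.2 + h p.1) := by
    intro c c' s s' hF
    rcases U.eq_empty_or_nonempty with rfl | ⟨p₀, hp₀⟩
    · exact ⟨0, 0, by simp⟩
    have hG1 := contDiffOn_pd hU hG 1
    have h01 : ∀ q ∈ U, horiz σ h (pd 1 G) q = 0 := fun q hq => by
      rw [← hC.pd_one_horiz hU hG hq, pd_congr hU h0 hq, pd_const]
    have Dw : ∀ {q : ℝ × ℝ}, q ∈ U → ∀ {k : ℝ → ℝ} {y : ℝ}, HasDerivAt k y (q.2 + h q.1) →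
        DifferentiableAt ℝ (fun q : ℝ × ℝ => k (q.2 + h q.1)) q := fun {q} hq {k} {y} hk =>
      hk.differentiableAt.comp (f := fun q : ℝ × ℝ => q.2 + h q.1) q
        (differentiableAt_of_contDiffOn hU hC.contDiffOn_height hq)
    have hconst : ∀ {k k' : ℝ → ℝ}, (∀ t, HasDerivAt k (k' t) t) →
        (∀ t, HasDerivAt k' (K * k t) t) → ∀ q ∈ U,
        G q * k' (q.2 + h q.1) - pd 1 G q * k (q.2 + h q.1)
          = G p₀ * k' (p₀.2 + h p₀.1) - pd 1 G p₀ * k (p₀.2 + h p₀.1) := by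
      intro k k' hk hk' q hq
      have dG := fun q hq => differentiableAt_of_contDiffOn hU hG (x := q) hq
      have dG1 := fun q hq => differentiableAt_of_contDiffOn hU hG1 (x := q) hq
      refine hC.eq_of_frame_eq_zero hU hc
        (u := fun q => G q * k' (q.2 + h q.1) - pd 1 G q * k (q.2 + h q.1)) ?_ ?_ ?_ hq hp₀
      · exact fun q hq => ((dG q hq).fun_mul (Dw hq (hk' _))).fun_sub
          ((dG1 q hq).fun_mul (Dw hq (hk _)))
      · intro q hq
        have e : ∀ u v : ℝ × ℝ → ℝ, DifferentiableAt ℝ u q → DifferentiableAt ℝ v q →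
            horiz σ h (fun q => u q - v q) q = horiz σ h u q - horiz σ h v q := by
          intro u v hu hv
          simp only [horiz, pd_sub hu hv, smul_eq_mul]; ring
        rw [e _ _ ((dG q hq).fun_mul (Dw hq (hk' _))) ((dG1 q hq).fun_mul (Dw hq (hk _))),
          horiz_mul (dG q hq) (Dw hq (hk' _)), horiz_mul (dG1 q hq) (Dw hq (hk _)), h0 q hq,
          h01 q hq, (hC.frame_comp_height hU hq (hk _)).1, (hC.frame_comp_height hU hq (hk' _)).1]
        ring
      · intro q hq
        rw [pd_sub ((dG q hq).fun_mul (Dw hq (hk' _))) ((dG1 q hq).fun_mul (Dw hq (hk _))),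
          pd_mul (dG q hq) (Dw hq (hk' _)), pd_mul (dG1 q hq) (Dw hq (hk _)), h1 q hq,
          (hC.frame_comp_height hU hq (hk _)).2, (hC.frame_comp_height hU hq (hk' _)).2]
        ring
    refine ⟨G p₀ * s' (p₀.2 + h p₀.1) - pd 1 G p₀ * s (p₀.2 + h p₀.1),
      -(G p₀ * c' (p₀.2 + h p₀.1) - pd 1 G p₀ * c (p₀.2 + h p₀.1)), fun p hp => ?_⟩
    rw [← hconst hF.deriv_snd hF.deriv_snd' p hp, ← hconst hF.deriv_fst hF.deriv_fst' p hp]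
    linear_combination -G p * hF.wronskian (p.2 + h p.1)
  rcases lt_trichotomy K 0 with hK | hK | hK
  · have h0 := (Real.sqrt_pos.2 (neg_pos.2 hK)).ne'
    have h2 : K = -√(-K) ^ 2 := by rw [Real.sq_sqrt (by linarith)]; ring
    obtain ⟨α, β, hαβ⟩ := key ((isFundamentalPair_trig h0).congr h2)
    exact ⟨_, Or.inl ⟨hK, β * (√(-K))⁻¹, α, fun _ => rfl⟩, fun p hp => by rw [hαβ p hp]; ring⟩
  · subst hK
    obtain ⟨α, β, hαβ⟩ := key isFundamentalPair_linear
    exact ⟨_, Or.inr (Or.inl ⟨rfl, β, α, fun _ => rfl⟩), fun p hp => by rw [hαβ p hp]; ring⟩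
  · have h0 := (Real.sqrt_pos.2 hK).ne'
    have h2 : K = √K ^ 2 := (Real.sq_sqrt hK.le).symm
    obtain ⟨α, β, hαβ⟩ := key ((isFundamentalPair_exp h0).congr h2)
    exact ⟨_, Or.inr (Or.inr ⟨hK, α, β * -(2 * √K)⁻¹, fun _ => rfl⟩),
      fun p hp => by rw [hαβ p hp]; ring⟩

theorem hasDerivAt_curvature_rpow (hU : IsOpen U) (hC : IsCylinderOver U X b J γ σ h)
    (h0 : ∀ t ∈ J, deriv (deriv γ) t ≠ 0) (r : ℝ) {t : ℝ} (ht : t ∈ J) :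
    HasDerivAt (fun t => curvature γ t ^ r)
      (r * (deriv (curvature γ) t / curvature γ t) * curvature γ t ^ r) t := by
  have hκ := contDiffOn_curvature (hC.contDiffOn_accel hU) h0
  have hpos : curvature γ t ≠ 0 := by simpa [curvature] using h0 t ht
  refine ((differentiableAt_of_contDiffOn (hC.isOpen_J hU) hκ ht).hasDerivAt.rpow_const
    (p := r) (Or.inl hpos)).congr_deriv ?_
  rw [Real.rpow_sub_one hpos]
  field_simp

theorem contDiffOn_curvature_rpow (hU : IsOpen U) (hC : IsCylinderOver U X b J γ σ h)
    (h0 : ∀ t ∈ J, deriv (deriv γ) t ≠ 0) (r : ℝ) :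
    ContDiffOn ℝ ∞ (fun t => curvature γ t ^ r) J :=
  (contDiffOn_curvature (hC.contDiffOn_accel hU) h0).rpow_const_of_ne
    fun t ht => by simpa [curvature] using h0 t ht

/-- The first biharmonic equation says that `f κ^(3/2)` has zero derivative along the directrix; the
second says that it solves `y'' = K y` along the rulings. -/
theorem factor_eq (hU : IsOpen U) (hc : IsPreconnected U) (hC : IsCylinderOver U X b J γ σ h)
    (hX : IsConformalImmersion U g f X) (h0 : ∀ t ∈ J, deriv (deriv γ) t ≠ 0)
    (hb : IsBiharmonic U g X) {K : ℝ} (hK : ∀ t ∈ J, ermakov (curvature γ) t = K) :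
    ∃ ψ, IsPsi K ψ ∧ ∀ p ∈ U, f p = ψ (p.2 + h p.1) * curvature γ (σ p.1) ^ (-(3 / 2 : ℝ)) := by
  have hh := (hC.isBiharmonic_iff hU hX h0).1 hb
  have hf := hX.contDiffOn_factor hU
  have hR := hC.contDiffOn_curvature_rpow hU h0 (3 / 2)
  have hRc := hC.contDiffOn_comp hR
  have df := fun q hq => differentiableAt_of_contDiffOn hU hf (x := q) hq
  have df1 := fun q hq => differentiableAt_of_contDiffOn hU (contDiffOn_pd hU hf 1) (x := q) hq
  have dR := fun q hq => differentiableAt_of_contDiffOn hU hRc (x := q) hq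
  have e1 : ∀ q ∈ U, horiz σ h (fun p => f p * curvature γ (σ p.1) ^ (3 / 2 : ℝ)) q = 0 := by
    intro q hq
    rw [horiz_mul (df q hq) (dR q hq), hC.horiz_comp hU hR hq,
      (hC.hasDerivAt_curvature_rpow hU h0 _ (hC.mem_J hq)).deriv, (hh q hq).1]
    ring
  have e2 : ∀ q ∈ U, pd 1 (fun p => f p * curvature γ (σ p.1) ^ (3 / 2 : ℝ)) q =
      pd 1 f q * curvature γ (σ q.1) ^ (3 / 2 : ℝ) := by
    intro q hq
    rw [pd_mul (df q hq) (dR q hq), hC.pd_one_comp hU hR hq, mul_zero, zero_add]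
  have e3 : ∀ q ∈ U, pd 1 (pd 1 fun p => f p * curvature γ (σ p.1) ^ (3 / 2 : ℝ)) q =
      K * (f q * curvature γ (σ q.1) ^ (3 / 2 : ℝ)) := by
    intro q hq
    rw [pd_congr hU e2 hq, pd_mul (df1 q hq) (dR q hq), hC.pd_one_comp hU hR hq, (hh q hq).2,
      hK _ (hC.mem_J hq)]
    ring
  obtain ⟨ψ, hψ, hG⟩ := hC.exists_psi hU hc (hf.mul hRc) e1 e3
  refine ⟨ψ, hψ, fun p hp => ?_⟩
  have hpos : 0 < curvature γ (σ p.1) := norm_pos_iff.2 (h0 _ (hC.mem_J hp))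
  rw [← hG p hp, mul_assoc, ← Real.rpow_add hpos]
  simp

theorem isProperBiharmonic (hU : IsOpen U) (hne : U.Nonempty)
    (hC : IsCylinderOver U X b J γ σ h) (hX : IsConformalImmersion U g f X)
    (h0 : ∀ t ∈ J, deriv (deriv γ) t ≠ 0) {K : ℝ} (hK : ∀ t ∈ J, ermakov (curvature γ) t = K)
    {ψ : ℝ → ℝ} (hψ : IsPsi K ψ)
    (hf : ∀ p ∈ U, f p = ψ (p.2 + h p.1) * curvature γ (σ p.1) ^ (-(3 / 2 : ℝ))) :
    IsProperBiharmonic U g X := by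
  obtain ⟨ψ', hψ1, hψ2⟩ := hψ.exists_deriv
  have hR := hC.contDiffOn_curvature_rpow hU h0 (-(3 / 2))
  have hRc := hC.contDiffOn_comp hR
  have dR := fun q hq => differentiableAt_of_contDiffOn hU hRc (x := q) hq
  have Dw : ∀ {q : ℝ × ℝ}, q ∈ U → ∀ {k : ℝ → ℝ} {y : ℝ}, HasDerivAt k y (q.2 + h q.1) →
      DifferentiableAt ℝ (fun q : ℝ × ℝ => k (q.2 + h q.1)) q := fun {q} hq {k} {y} hk =>
    hk.differentiableAt.comp (f := fun q : ℝ × ℝ => q.2 + h q.1) q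
      (differentiableAt_of_contDiffOn hU hC.contDiffOn_height hq)
  refine ⟨(hC.isBiharmonic_iff hU hX h0).2 fun p hp => ⟨?_, ?_⟩, fun hh => ?_⟩
  · rw [horiz_congr hU hf hp, horiz_mul (Dw hp (hψ1 _)) (dR p hp), hC.horiz_comp hU hR hp,
      (hC.hasDerivAt_curvature_rpow hU h0 _ (hC.mem_J hp)).deriv,
      (hC.frame_comp_height hU hp (hψ1 _)).1, hf p hp]
    ring
  · have e : ∀ q ∈ U, pd 1 f q = ψ' (q.2 + h q.1) * curvature γ (σ q.1) ^ (-(3 / 2 : ℝ)) := by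
      intro q hq
      rw [pd_congr hU hf hq, pd_mul (Dw hq (hψ1 _)) (dR q hq), hC.pd_one_comp hU hR hq,
        (hC.frame_comp_height hU hq (hψ1 _)).2]
      ring
    rw [pd_congr hU e hp, pd_mul (Dw hp (hψ2 _)) (dR p hp), hC.pd_one_comp hU hR hp,
        (hC.frame_comp_height hU hp (hψ2 _)).2, hK _ (hC.mem_J hp), hf p hp]
    ring
  · obtain ⟨p, hp⟩ := hne
    have := hh p hp
    rw [hC.tension_eq hU hX hp] at this
    exact smul_ne_zero (hX.factor_pos p hp).ne' (h0 _ (hC.mem_J hp)) this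

/-! ### Circles -/

/-- Differentiating `|γ - c|² = r²` twice gives `γ - c = -r² γ''`, and taking norms gives the
curvature. -/
theorem curvature_of_isCircleArc (hU : IsOpen U) (hC : IsCylinderOver U X b J γ σ h) {r : ℝ}
    (hγ : IsCircleArc b J γ r) {t : ℝ} (ht : t ∈ J) : curvature γ t = 1 / r := by
  obtain ⟨hr, c, hc⟩ := hγ
  have hJ := hC.isOpen_J hU
  have hT := hC.contDiffOn_tangent hU
  have hγc : ContDiffOn ℝ ∞ (fun t => γ t - c) J := hC.smooth_directrix.sub contDiffOn_const
  have hd : ∀ t, deriv (fun t => γ t - c) t = deriv γ t := fun t => deriv_sub_const c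
  have e1 : ∀ t ∈ J, inner ℝ (γ t - c) (deriv γ t) = (0 : ℝ) := by
    intro t ht
    have := deriv_inner_of_const hJ hγc hγc (c := r ^ 2)
      (fun t ht => by rw [real_inner_self_eq_norm_sq, (hc t ht).1]) ht
    rw [hd, real_inner_comm (γ t - c) (deriv γ t)] at this
    linarith
  have e2 := deriv_inner_of_const hJ hγc hT e1 ht
  rw [hd, hC.inner_tangent_self ht] at e2
  have e3 : r ^ 2 • deriv (deriv γ) t + (γ t - c) = 0 := by
    have hne : γ t - c ≠ 0 := by
      rw [← norm_ne_zero_iff, (hc t ht).1]; exact hr.ne'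
    refine eq_zero_of_inner_eq_zero (hC.tangent_ne_zero ht) hne hC.dir_ne_zero
      (by rw [real_inner_comm]; exact e1 t ht) (hC.orthogonal t ht) (hc t ht).2 ?_ ?_ ?_
    · rw [inner_add_left, real_inner_smul_left, hC.inner_accel_tangent hU ht, e1 t ht]; simp
    · rw [inner_add_left, real_inner_smul_left, real_inner_self_eq_norm_sq, (hc t ht).1,
        real_inner_comm]
      linear_combination r ^ 2 * e2
    · rw [inner_add_left, real_inner_smul_left, hC.inner_accel_dir hU ht, (hc t ht).2]; simp
  have e4 : ‖r ^ 2 • deriv (deriv γ) t‖ = r := by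
    rw [eq_neg_of_add_eq_zero_left e3, norm_neg, (hc t ht).1]
  rw [norm_smul, Real.norm_of_nonneg (by positivity)] at e4
  rw [curvature, eq_div_iff hr.ne']
  have : r * (‖deriv (deriv γ) t‖ * r - 1) = 0 := by linear_combination e4
  linarith [(mul_eq_zero.1 this).resolve_left hr.ne']

/-- The centre of curvature `γ + k⁻² γ''` is stationary by the Frenet equations. -/
theorem isCircleArc_of_curvature (hU : IsOpen U) (hC : IsCylinderOver U X b J γ σ h)
    (hJc : IsPreconnected J) {k : ℝ} (hk : 0 < k) (hγ : ∀ t ∈ J, curvature γ t = k) :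
    IsCircleArc b J γ (1 / k) := by
  have hJ := hC.isOpen_J hU
  have hN := hC.contDiffOn_accel hU
  refine ⟨by positivity, ?_⟩
  rcases J.eq_empty_or_nonempty with rfl | ⟨t₀, ht₀⟩
  · exact ⟨0, by simp⟩
  have h0 : ∀ t ∈ J, deriv (deriv γ) t ≠ 0 := by
    intro t ht h0
    have := hγ t ht
    rw [curvature, h0, norm_zero] at this
    exact hk.ne this
  have hd : ∀ t ∈ J, deriv (fun t => γ t + (k ^ 2)⁻¹ • deriv (deriv γ) t) t = 0 := by
    intro t ht
    have dN := differentiableAt_of_contDiffOn hJ hN ht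
    have h1 := hC.frenet hU h0 ht
    rw [deriv_congr_of_isOpen hJ hγ ht, hγ t ht, deriv_const, zero_smul, zero_sub] at h1
    rw [deriv_fun_add (differentiableAt_of_contDiffOn hJ hC.smooth_directrix ht)
      (dN.fun_const_smul _), deriv_fun_const_smul _ dN]
    have h2 : deriv (deriv (deriv γ)) t = -(k ^ 2) • deriv γ t := by
      have h3 := congrArg (fun y => k⁻¹ • y) h1
      simp only [inv_smul_smul₀ hk.ne'] at h3
      rw [h3]
      match_scalars; field_simp
    rw [h2]
    match_scalars; field_simp; ring
  have hs : ContDiffOn ℝ ∞ (fun t => γ t + (k ^ 2)⁻¹ • deriv (deriv γ) t) J :=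
    hC.smooth_directrix.add (hN.const_smul _)
  have hconst : ∀ t ∈ J, γ t + (k ^ 2)⁻¹ • deriv (deriv γ) t = _ := fun t ht =>
    hJ.is_const_of_deriv_eq_zero hJc (hs.differentiableOn (by simp)) hd ht ht₀
  refine ⟨γ t₀ + (k ^ 2)⁻¹ • deriv (deriv γ) t₀, fun t ht => ?_⟩
  rw [← hconst t ht, sub_add_cancel_left, norm_neg, norm_smul, inner_neg_left,
    real_inner_smul_left, hC.inner_accel_dir hU ht]
  have := hγ t ht
  rw [curvature] at this
  rw [this, Real.norm_of_nonneg (by positivity)]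
  constructor
  · field_simp
  · simp

/-- The first three derivatives of `γ` are all orthogonal to `b`, hence dependent. -/
theorem torsion_eq_zero (hU : IsOpen U) (hC : IsCylinderOver U X b J γ σ h) {t : ℝ}
    (ht : t ∈ J) : torsion γ t = 0 := by
  have hJ := hC.isOpen_J hU
  have e3 : inner ℝ (deriv (deriv (deriv γ)) t) b = (0 : ℝ) := by
    simpa using deriv_inner_of_const hJ (hC.contDiffOn_accel hU) (contDiffOn_const (c := b))
      (fun t ht => hC.inner_accel_dir hU ht) ht
  have h0 : triple (deriv γ t) (deriv (deriv γ) t) (deriv (deriv (deriv γ)) t) = 0 := by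
    refine Matrix.exists_mulVec_eq_zero_iff.1 ⟨fun i => b i, ?_, ?_⟩
    · intro hb
      exact hC.dir_ne_zero (by ext i; exact congrFun hb i)
    · have key : ∀ x : E3, inner ℝ x b = (0 : ℝ) → ∑ j, x j * b j = 0 := by
        intro x hx
        rw [← hx, PiLp.inner_apply]
        simp [mul_comm]
      ext i
      fin_cases i
      · exact key _ (hC.orthogonal t ht)
      · exact key _ (hC.inner_accel_dir hU ht)
      · exact key _ e3
  rw [torsion, h0, zero_div]

theorem inner_sub_dir (hU : IsOpen U) (hC : IsCylinderOver U X b J γ σ h) (hJc : IsPreconnected J)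
    {q : ℝ × ℝ} (hp : p ∈ U) (hq : q ∈ U) :
    inner ℝ (X p - X q) b = (p.2 + h p.1) - (q.2 + h q.1) := by
  have hJ := hC.isOpen_J hU
  have h1 : inner ℝ (γ (σ p.1)) b = inner ℝ (γ (σ q.1)) b := by
    refine hJ.is_const_of_deriv_eq_zero hJc (f := fun t => inner ℝ (γ t) b)
      ((hC.smooth_directrix.inner ℝ contDiffOn_const).differentiableOn (by simp)) ?_
      (hC.mem_J hp) (hC.mem_J hq)
    intro t ht
    have := deriv_inner hJ hC.smooth_directrix (contDiffOn_const (c := b)) ht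
    simpa [hC.orthogonal t ht] using this
  rw [hC.eq_cylinder p hp, hC.eq_cylinder q hq]
  simp only [inner_sub_left, inner_add_left, real_inner_smul_left, h1,
    real_inner_self_eq_norm_sq, hC.norm_dir]
  ring

end IsCylinderOver

/-! ### Classification of proper biharmonic developable surfaces -/

section Classification

variable {U : Set (ℝ × ℝ)} {g : ℝ × ℝ → Matrix (Fin 2) (Fin 2) ℝ} {f : ℝ × ℝ → ℝ}
  {X : ℝ × ℝ → E3} {p : ℝ × ℝ} {b : E3} {J : Set ℝ} {γ : ℝ → E3} {σ h : ℝ → ℝ} {r K : ℝ}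

/-- The conformal factors of proper biharmonic circular cylinders. -/
def IsCircularFactor (U : Set (ℝ × ℝ)) (h : ℝ → ℝ) (r : ℝ) (f : ℝ × ℝ → ℝ) : Prop :=
  ∃ d₁ d₂ : ℝ, ∀ p ∈ U,
    f p = d₁ * Real.exp ((p.2 + h p.1) / r) + d₂ * Real.exp (-((p.2 + h p.1) / r))

/-- The conformal factors of proper biharmonic cylinders over curves with curvature `κ_N`. -/
def IsKappaNFactor (U : Set (ℝ × ℝ)) (γ : ℝ → E3) (σ h : ℝ → ℝ) (K : ℝ) (f : ℝ × ℝ → ℝ) : Prop :=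
  ∃ ψ : ℝ → ℝ, IsPsi K ψ ∧ ∀ p ∈ U,
    f p = ψ (p.2 + h p.1) * curvature γ (σ p.1) ^ (-(3 / 2 : ℝ))

namespace IsCylinderOver

theorem isPreconnected_J (hc : IsPreconnected U) (hC : IsCylinderOver U X b J γ σ h) :
    IsPreconnected J := by
  rw [← hC.image_param]
  exact (hc.image _ continuous_fst.continuousOn).image _ hC.smooth_param.continuousOn

theorem accel_ne_zero_of_isCircleArc (hU : IsOpen U) (hC : IsCylinderOver U X b J γ σ h)
    (hγ : IsCircleArc b J γ r) : ∀ t ∈ J, deriv (deriv γ) t ≠ 0 := by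
  intro t ht h0
  have := hC.curvature_of_isCircleArc hU hγ ht
  rw [curvature, h0, norm_zero] at this
  exact (one_div_pos.2 hγ.1).ne this

theorem isProperBiharmonic_of_isCircleArc (hU : IsOpen U) (hne : U.Nonempty)
    (hC : IsCylinderOver U X b J γ σ h) (hX : IsConformalImmersion U g f X)
    (hγ : IsCircleArc b J γ r) (hf : IsCircularFactor U h r f) : IsProperBiharmonic U g X := by
  obtain ⟨d₁, d₂, hf⟩ := hf
  have hJ := hC.isOpen_J hU
  have hκ : ∀ t ∈ J, curvature γ t = 1 / r := fun t ht => hC.curvature_of_isCircleArc hU hγ ht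
  have hr : 0 < 1 / r := one_div_pos.2 hγ.1
  have hE : ∀ t ∈ J, ermakov (curvature γ) t = (1 / r) ^ 2 := by
    intro t ht
    have h1 : ∀ t ∈ J, deriv (curvature γ) t = 0 := fun t ht => by
      rw [deriv_congr_of_isOpen hJ hκ ht, deriv_const]
    rw [ermakov, deriv_congr_of_isOpen hJ h1 ht, h1 t ht, hκ t ht]
    simp
  refine hC.isProperBiharmonic hU hne hX (hC.accel_ne_zero_of_isCircleArc hU hγ) hE
    -- The factor `(1 / r)^(3/2)` compensates the constant `κ^(-3/2)` of the general formula.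
    (ψ := fun w => (1 / r) ^ (3 / 2 : ℝ) * d₁ * Real.exp (√((1 / r) ^ 2) * w)
      + (1 / r) ^ (3 / 2 : ℝ) * d₂ * Real.exp (-(√((1 / r) ^ 2) * w)))
    (Or.inr (Or.inr ⟨by positivity, _, _, fun _ => rfl⟩)) fun p hp => ?_
  have e : (1 / r) ^ (3 / 2 : ℝ) * (1 / r) ^ (-(3 / 2 : ℝ)) = 1 := by
    rw [← Real.rpow_add hr]; simp
  rw [hf p hp, hκ _ (hC.mem_J hp), Real.sqrt_sq hr.le, one_div_mul_eq_div]
  linear_combination -(d₁ * Real.exp ((p.2 + h p.1) / r)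
    + d₂ * Real.exp (-((p.2 + h p.1) / r))) * e

theorem accel_ne_zero_of_isKappaNCurve (hU : IsOpen U) (hC : IsCylinderOver U X b J γ σ h)
    (hγ : IsKappaNCurve K J γ) : ∀ t ∈ J, deriv (deriv γ) t ≠ 0 := by
  intro t ht h0
  have := (hγ.1.pos_and_ermakov (hC.isOpen_J hU) t ht).1
  rw [curvature, h0, norm_zero] at this
  exact lt_irrefl _ this

theorem isProperBiharmonic_of_isKappaNCurve (hU : IsOpen U) (hne : U.Nonempty)
    (hC : IsCylinderOver U X b J γ σ h) (hX : IsConformalImmersion U g f X)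
    (hγ : IsKappaNCurve K J γ) (hf : IsKappaNFactor U γ σ h K f) : IsProperBiharmonic U g X := by
  obtain ⟨ψ, hψ, hf⟩ := hf
  exact hC.isProperBiharmonic hU hne hX (hC.accel_ne_zero_of_isKappaNCurve hU hγ)
    (fun t ht => (hγ.1.pos_and_ermakov (hC.isOpen_J hU) t ht).2) hψ hf

/-- The induced metric divided by a positive function. -/
theorem isConformalImmersion (hU : IsOpen U) (hC : IsCylinderOver U X b J γ σ h)
    (hf : ContDiffOn ℝ ∞ f U) (hpos : ∀ p ∈ U, 0 < f p) :
    IsConformalImmersion U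
      (fun p => Matrix.of fun i j => (f p)⁻¹ * inner ℝ (pd i X p) (pd j X p)) f X := by
  have hX : ContDiffOn ℝ ∞ X U :=
    ((hC.contDiffOn_comp hC.smooth_directrix).add
      (hC.contDiffOn_height.smul contDiffOn_const)).congr hC.eq_cylinder
  refine ⟨⟨fun i j => (hf.inv fun p hp => (hpos p hp).ne').mul
    ((contDiffOn_pd hU hX i).inner ℝ (contDiffOn_pd hU hX j)), fun p hp => ?_⟩, hX, hpos,
    fun p hp i j => ?_⟩
  · have hfp := hpos p hp
    have ht := hC.mem_J hp
    have hb : inner ℝ b b = (1 : ℝ) := by rw [real_inner_self_eq_norm_sq, hC.norm_dir]; norm_num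
    have hTb := hC.orthogonal _ ht
    have hbT : inner ℝ b (deriv γ (σ p.1)) = (0 : ℝ) := by rw [real_inner_comm]; exact hTb
    refine Matrix.PosDef.of_dotProduct_mulVec_pos ?_ fun x hx => ?_
    · ext i j
      simp [real_inner_comm]
    · simp only [Matrix.mulVec, dotProduct, Fin.sum_univ_two, Matrix.of_apply,
        hC.pd_zero_X hU hp, (hC.frame_X hU hp).2, inner_add_left, inner_add_right,
        real_inner_smul_left, real_inner_smul_right, hb, hTb, hbT,
        hC.inner_tangent_self ht, Pi.star_apply, star_trivial]
      -- In the coordinates `σ` and `w` the induced metric is `dσ² + dw²`, so the quadratic form is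
      -- this sum of squares.
      have e : (0 : ℝ) < (f p)⁻¹ * ((x 0 * deriv σ p.1) ^ 2 + (x 0 * deriv h p.1 + x 1) ^ 2) := by
        refine mul_pos (inv_pos.2 hfp) ?_
        by_cases h0 : x 0 = 0
        · have h1 : x 1 ≠ 0 := fun h1 => hx (by ext i; fin_cases i <;> simp [h0, h1])
          simp only [h0, zero_mul, zero_add]
          positivity
        · have h1 : x 0 * deriv σ p.1 ≠ 0 := mul_ne_zero h0 (hC.regular_param _ (mem_fst_image hp))
          positivity
      refine lt_of_lt_of_eq e ?_
      ring
  · simp [mul_inv_cancel_left₀ (hpos p hp).ne']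

/-- For `K < 0` the witness is `sin (√(-K) (w - inf W))`, where `W` is the set of heights. It is
positive for `w - inf W` strictly between 0 and `π/√(-K)`; the strict inequalities follow from the
weak bound on the extent because `U` is open. -/
theorem exists_positive_psi (hU : IsOpen U) (hc : IsConnected U)
    (hC : IsCylinderOver U X b J γ σ h)
    (hext : K < 0 → ∀ p ∈ U, ∀ q ∈ U, inner ℝ (X p - X q) b ≤ Real.pi / √(-K)) :
    ∃ ψ, IsPsi K ψ ∧ ∀ p ∈ U, 0 < ψ (p.2 + h p.1) := by
  rcases lt_trichotomy K 0 with hK | hK | hK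
  · have hν : 0 < √(-K) := Real.sqrt_pos.2 (neg_pos.2 hK)
    have hw : ∀ p ∈ U, ∀ q ∈ U, (p.2 + h p.1) - (q.2 + h q.1) ≤ Real.pi / √(-K) := by
      intro p hp q hq
      rw [← hC.inner_sub_dir hU (hC.isPreconnected_J hc.isPreconnected) hp hq]
      exact hext hK p hp q hq
    obtain ⟨p₀, hp₀⟩ := hc.nonempty
    set W : Set ℝ := (fun p : ℝ × ℝ => p.2 + h p.1) '' U
    have hbdd : BddBelow W := by
      refine ⟨p₀.2 + h p₀.1 - Real.pi / √(-K), ?_⟩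
      rintro _ ⟨q, hq, rfl⟩
      have := hw p₀ hp₀ q hq
      simp only
      linarith
    -- Moving a little along the ruling shows that no height is extremal in `W`.
    have hshift : ∀ p ∈ U, ∃ δ > 0, ((p.2 + h p.1) - δ ∈ W) ∧ ((p.2 + h p.1) + δ ∈ W) := by
      intro p hp
      obtain ⟨δ, hδ, hball⟩ := Metric.isOpen_iff.1 hU p hp
      have hm : ∀ x : ℝ, |x| < δ → (p.1, p.2 + x) ∈ U := fun x hx => by
        refine hball ?_
        rw [Metric.mem_ball, Prod.dist_eq]
        simp [hx]
      refine ⟨δ / 2, by positivity, ⟨_, hm (-(δ / 2)) ?_, ?_⟩, ⟨_, hm (δ / 2) ?_, ?_⟩⟩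
      · rw [abs_neg, abs_of_pos (by positivity)]; linarith
      · simp only; ring
      · rw [abs_of_pos (by positivity)]; linarith
      · simp only; ring
    refine ⟨fun w => Real.cos (√(-K) * sInf W) * Real.sin (√(-K) * w)
      + -Real.sin (√(-K) * sInf W) * Real.cos (√(-K) * w), Or.inl ⟨hK, _, _, fun _ => rfl⟩, ?_⟩
    intro p hp
    obtain ⟨δ, hδ, h1, h2⟩ := hshift p hp
    have e1 : sInf W ≤ (p.2 + h p.1) - δ := csInf_le hbdd h1
    have e2 : (p.2 + h p.1) + δ - Real.pi / √(-K) ≤ sInf W := by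
      refine le_csInf ⟨_, h1⟩ ?_
      rintro _ ⟨q, hq, rfl⟩
      obtain ⟨q', hq', e⟩ := h2
      have := hw q' hq' q hq
      simp only at e ⊢
      linarith
    have e3 : 0 < Real.sin (√(-K) * ((p.2 + h p.1) - sInf W)) := by
      refine Real.sin_pos_of_pos_of_lt_pi (mul_pos hν (by linarith)) ?_
      have : (p.2 + h p.1) - sInf W < Real.pi / √(-K) := by linarith
      rw [lt_div_iff₀ hν] at this
      linarith
    rw [mul_sub, Real.sin_sub] at e3
    simp only
    linarith
  · exact ⟨fun _ => 1, Or.inr (Or.inl ⟨hK, 0, 1, by simp⟩), by simp⟩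
  · exact ⟨fun w => 1 * Real.exp (√K * w) + 1 * Real.exp (-(√K * w)),
      Or.inr (Or.inr ⟨hK, _, _, fun _ => rfl⟩), fun p _ => by positivity⟩

/-- For `K < 0`, shifting by `π/√(-K)` changes the sign of `ψ`. The heights form an interval because
`U` is connected, so a larger extent would contain two heights with opposite values of `ψ`, although
`f > 0`. -/
theorem extent_le (hU : IsOpen U) (hc : IsPreconnected U) (hC : IsCylinderOver U X b J γ σ h)
    (hX : IsConformalImmersion U g f X) (hγ : IsKappaNCurve K J γ)
    (hf : IsKappaNFactor U γ σ h K f) (hK : K < 0) {q : ℝ × ℝ} (hp : p ∈ U) (hq : q ∈ U) :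
    inner ℝ (X p - X q) b ≤ Real.pi / √(-K) := by
  have hν : 0 < √(-K) := Real.sqrt_pos.2 (neg_pos.2 hK)
  rw [hC.inner_sub_dir hU (hC.isPreconnected_J hc) hp hq]
  by_contra! hlt
  obtain ⟨ψ, hψ, hf⟩ := hf
  have hpos : ∀ w ∈ (fun p : ℝ × ℝ => p.2 + h p.1) '' U, 0 < ψ w := by
    rintro _ ⟨z, hz, rfl⟩
    have h1 := hX.factor_pos z hz
    rw [hf z hz] at h1
    have h2 : 0 < curvature γ (σ z.1) ^ (-(3 / 2 : ℝ)) := Real.rpow_pos_of_pos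
      (hγ.1.pos_and_ermakov (hC.isOpen_J hU) _ (hC.mem_J hz)).1 _
    exact pos_of_mul_pos_left h1 h2.le
  have hW := (hc.image _ hC.contDiffOn_height.continuousOn).ordConnected
  have h1 := hpos _ ⟨q, hq, rfl⟩
  have h2 := hpos ((q.2 + h q.1) + Real.pi / √(-K)) (hW.out ⟨q, hq, rfl⟩ ⟨p, hp, rfl⟩
    ⟨by simp only; have := Real.pi_pos; linarith [div_pos this hν], by simp only; linarith⟩)
  rcases hψ with ⟨-, d₅, d₆, h⟩ | ⟨h0, -⟩ | ⟨h0, -⟩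
  · simp only [h] at h1 h2
    rw [mul_add, mul_div_cancel₀ _ hν.ne', Real.sin_add_pi, Real.cos_add_pi] at h2
    linarith
  · exact hK.ne h0
  · exact hK.not_gt h0

end IsCylinderOver

theorem IsDevelopable.exists_isDevelopableOn (hD : IsDevelopable U X) :
    ∃ a e, IsDevelopableOn U X a e := by
  obtain ⟨a, e, ha, he, hn, ht, hX, -⟩ := hD
  exact ⟨a, e, ha, he, hn, ht, hX⟩

theorem IsDevelopable.isProperBiharmonic_iff (hU : IsOpen U) (hc : IsConnected U)
    (hD : IsDevelopable U X) (hX : IsConformalImmersion U g f X) :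
    IsProperBiharmonic U g X ↔
      (∃ b J γ σ h r, IsCylinderOver U X b J γ σ h ∧ IsCircleArc b J γ r ∧
        IsCircularFactor U h r f) ∨
      (∃ K b J γ σ h, IsCylinderOver U X b J γ σ h ∧ IsKappaNCurve K J γ ∧
        IsKappaNFactor U γ σ h K f) := by
  constructor
  · rintro ⟨hb, hh⟩
    obtain ⟨a, e, hDae⟩ := hD.exists_isDevelopableOn
    obtain ⟨b, J, γ, σ, h, hC, h0⟩ := hDae.exists_cylinder hU hc hX hb hh
    have hJ := hC.isOpen_J hU
    have hJc := hC.isPreconnected_J hc.isPreconnected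
    obtain ⟨p₀, hp₀⟩ := hc.nonempty
    have ht₀ := hC.mem_J hp₀
    obtain ⟨hE, hE'⟩ := hC.deriv_ermakov hU hX h0 hb
    have hκ := contDiffOn_curvature (hC.contDiffOn_accel hU) h0
    have hpos : ∀ t ∈ J, 0 < curvature γ t := fun t ht => norm_pos_iff.2 (h0 t ht)
    obtain ⟨K, hK⟩ : ∃ K, ∀ t ∈ J, ermakov (curvature γ) t = K :=
      ⟨_, fun t ht => hJ.is_const_of_deriv_eq_zero hJc (hE.differentiableOn (by simp)) hE' ht ht₀⟩
    obtain ⟨ψ, hψ, hf⟩ := hC.factor_eq hU hc.isPreconnected hX h0 hb hK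
    -- With constant curvature `k` the derivative terms of `ermakov` vanish, so `K = k² > 0` and
    -- only the exponential family of `ψ` remains, with `√K = k = 1/r`.
    by_cases hconst : ∃ c : ℝ, ∀ s ∈ J, curvature γ s = c
    · left
      obtain ⟨k, hk⟩ := hconst
      have hk0 : 0 < k := by rw [← hk _ ht₀]; exact hpos _ ht₀
      refine ⟨b, J, γ, σ, h, 1 / k, hC, hC.isCircleArc_of_curvature hU hJc hk0 hk, ?_⟩
      have hKk : K = k ^ 2 := by
        have h1 : ∀ t ∈ J, deriv (curvature γ) t = 0 := fun t ht => by
          rw [deriv_congr_of_isOpen hJ hk ht, deriv_const]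
        rw [← hK _ ht₀, ermakov, deriv_congr_of_isOpen hJ h1 ht₀, h1 _ ht₀, hk _ ht₀]
        simp
      have hK0 : 0 < K := by rw [hKk]; positivity
      rcases hψ with ⟨hn, -⟩ | ⟨hn, -⟩ | ⟨-, d₁, d₂, hd⟩
      · exact absurd hn hK0.not_gt
      · exact absurd hn hK0.ne'
      · refine ⟨d₁ * k ^ (-(3 / 2 : ℝ)), d₂ * k ^ (-(3 / 2 : ℝ)), fun p hp => ?_⟩
        have e : (p.2 + h p.1) / (1 / k) = k * (p.2 + h p.1) := by field_simp
        rw [hf p hp, hd, hk _ (hC.mem_J hp), hKk, Real.sqrt_sq hk0.le, e]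
        ring
    · right
      exact ⟨K, b, J, γ, σ, h, hC, ⟨isKappaN_of_ermakov hJ ⟨⟨_, ht₀⟩, hJc⟩ hκ hpos hK, hconst,
        fun t ht => hC.torsion_eq_zero hU ht⟩, ψ, hψ, hf⟩
  · rintro (⟨b, J, γ, σ, h, r, hC, hγ, hf⟩ | ⟨K, b, J, γ, σ, h, hC, hγ, hf⟩)
    · exact hC.isProperBiharmonic_of_isCircleArc hU hc.nonempty hX hγ hf
    · exact hC.isProperBiharmonic_of_isKappaNCurve hU hc.nonempty hX hγ hf

theorem IsDevelopable.exists_isProperBiharmonic_iff (hU : IsOpen U) (hc : IsConnected U)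
    (hD : IsDevelopable U X) :
    (∃ (g : ℝ × ℝ → Matrix (Fin 2) (Fin 2) ℝ) (f : ℝ × ℝ → ℝ),
      IsConformalImmersion U g f X ∧ IsProperBiharmonic U g X) ↔
      IsCircularCylinder U X ∨ IsKappaNCylinder U X := by
  constructor
  · rintro ⟨g, f, hX, hb⟩
    rcases (hD.isProperBiharmonic_iff hU hc hX).1 hb with
      ⟨b, J, γ, σ, h, r, hC, hγ, -⟩ | ⟨K, b, J, γ, σ, h, hC, hγ, hf⟩
    · exact Or.inl ⟨b, J, γ, σ, h, r, hC, hγ⟩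
    · exact Or.inr ⟨K, b, J, γ, σ, h, hC, hγ, fun hK p hp q hq =>
        hC.extent_le hU hc.isPreconnected hX hγ hf hK hp hq⟩
  · rintro (⟨b, J, γ, σ, h, r, hC, hγ⟩ | ⟨K, b, J, γ, σ, h, hC, hγ, hext⟩)
    · set f : ℝ × ℝ → ℝ := fun p =>
        1 * Real.exp ((p.2 + h p.1) / r) + 1 * Real.exp (-((p.2 + h p.1) / r))
      have hw := hC.contDiffOn_height.div_const r
      have hf : ContDiffOn ℝ ∞ f U :=
        (contDiffOn_const.mul hw.exp).add (contDiffOn_const.mul hw.neg.exp)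
      have hX := hC.isConformalImmersion hU hf fun p _ => by positivity
      exact ⟨_, f, hX, hC.isProperBiharmonic_of_isCircleArc hU hc.nonempty hX hγ
        ⟨1, 1, fun _ _ => rfl⟩⟩
    · obtain ⟨ψ, hψ, hψ0⟩ := hC.exists_positive_psi hU hc hext
      set f : ℝ × ℝ → ℝ := fun p => ψ (p.2 + h p.1) * curvature γ (σ p.1) ^ (-(3 / 2 : ℝ))
      have hf : ContDiffOn ℝ ∞ f U :=
        (hψ.contDiff.comp_contDiffOn hC.contDiffOn_height).mul (hC.contDiffOn_comp
          (hC.contDiffOn_curvature_rpow hU (hC.accel_ne_zero_of_isKappaNCurve hU hγ) _))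
      have hX := hC.isConformalImmersion hU hf fun p hp => mul_pos (hψ0 p hp)
        (Real.rpow_pos_of_pos (hγ.1.pos_and_ermakov (hC.isOpen_J hU) _ (hC.mem_J hp)).1 _)
      exact ⟨_, f, hX, hC.isProperBiharmonic_of_isKappaNCurve hU hc.nonempty hX hγ
        ⟨ψ, hψ, fun _ _ => rfl⟩⟩

end Classification

end ConformalSurface

end

theorem mainTheorem3 :
    (∀ (U : Set (ℝ × ℝ)) (X : ℝ × ℝ → E3), IsOpen U →
      (IsCone U X ∨ IsTangentSurface U X) →
      ¬ ∃ (g : ℝ × ℝ → Matrix (Fin 2) (Fin 2) ℝ) (f : ℝ × ℝ → ℝ),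
        IsConformalImmersion U g f X ∧ IsProperBiharmonic U g X) ∧
    (∀ (U : Set (ℝ × ℝ)) (X : ℝ × ℝ → E3), IsOpen U → IsConnected U → IsDevelopable U X →
      ((∃ (g : ℝ × ℝ → Matrix (Fin 2) (Fin 2) ℝ) (f : ℝ × ℝ → ℝ),
          IsConformalImmersion U g f X ∧ IsProperBiharmonic U g X) ↔
        IsCircularCylinder U X ∨ IsKappaNCylinder U X) ∧
      (∀ (g : ℝ × ℝ → Matrix (Fin 2) (Fin 2) ℝ) (f : ℝ × ℝ → ℝ),
        IsConformalImmersion U g f X →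
        (IsProperBiharmonic U g X ↔
          (∃ b J γ σ h r, IsCylinderOver U X b J γ σ h ∧ IsCircleArc b J γ r ∧
            ∃ d₁ d₂ : ℝ, ∀ p ∈ U,
              f p = d₁ * Real.exp ((p.2 + h p.1) / r) + d₂ * Real.exp (-((p.2 + h p.1) / r))) ∨
          (∃ K b J γ σ h, IsCylinderOver U X b J γ σ h ∧ IsKappaNCurve K J γ ∧
            ∃ ψ : ℝ → ℝ, IsPsi K ψ ∧ ∀ p ∈ U,
              f p = ψ (p.2 + h p.1) * curvature γ (σ p.1) ^ (-(3 / 2 : ℝ)))))) := by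
  refine ⟨fun U X hU hX => ?_, fun U X hU hc hD => ⟨hD.exists_isProperBiharmonic_iff hU hc,
    fun g f hX => hD.isProperBiharmonic_iff hU hc hX⟩⟩
  rintro ⟨g, f, hf, hb, hh⟩
  exact hh (isHarmonic_of_cone_or_tangentSurface hU hX hf hb)
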